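/- Let $K=\mathbb{C}\{\!\{t\}\!\}$ be the field of Puiseux series with its $t$-adic valuation $\operatorname{val}$. Let $\Delta\subset\mathbb{R}^2$ be a two-dimensional lattice polygon with $n+1$ lattice points, $g$ of which lie in the interior, and let $0\le\delta\le g$. Let $Y(\Delta)=\operatorname{Proj}\bigoplus_{d\ge 0}\bigoplus_{u\in d\Delta\cap\mathbb{Z}^2}K\,x^u$ be the projective toric surface over $K$ with its polarization $L(\Delta)$, so that the members of the complete linear series $|L(\Delta)|$ are the zero schemes $C_f\subset Y(\Delta)$ of the nonzero sections $f=\sum_{u\in\Delta\cap\mathbb{Z}^2}a_ux^u$, up to scaling. *Tropical curves.* The tropicalization of the curve $f=0$ in the dense torus is the corner locus of $\psi_f(v)=\min_{a_u\ne0}\left(\langle u,v\rangle+\operatorname{val}(a_u)\right)$, in which each edge is weighted by the lattice length of the dual edge of the Newton subdivision of $f$. A tropical curve of degree $\Delta$ is the (weighted) tropicalization of a Laurent polynomial over $K$ with Newton polygon $\Delta$. A parameterization of a tropical curve $\Gamma$ is a finite metric graph $\Gamma'$, possibly with unbounded edges, with a continuous map $p$ onto $\Gamma$ that is affine with derivative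 in $\mathbb{Z}^2$ on every edge, is balanced at every vertex, and is such that over all but finitely many points of $\Gamma$ the dilation factors of the edges above the point add up to the weight of $\Gamma$ there. The genus of $\Gamma$ is the smallest first Betti number of a graph that parameterizes $\Gamma$. *General position.* Points $v_1,\dots,v_{n-\delta}\in\mathbb{R}^2$ are in general position if they are general for the evaluation map on parameterized tropical curves of degree $\Delta$ with first Betti number $g-\delta$: for every such curve $p:\Gamma'\to\mathbb{R}^2$ and all vertices $m_1,\dots,m_{n-\delta}$ of $\Gamma'$ (which may be subdivided) with $p(m_i)=v_i$, the points $(q(m_1),\dots,q(m_{n-\delta}))$ fill a neighbourhood of $(v_1,\dots,v_{n-\delta})$ when $q$ runs over the deformations of $p$ with the same graph, the same slopes, arbitrary positive edge lengths, and the same coincidences among the images of the vertices. Let $S=\{x_1,\dots,x_{n-\delta}\}$ be points of the dense torus $(K^*)^2$ of $Y(\Delta)$ whose tropicalizations $v_i=\operatorname{trop}(x_i)$ (coordinatewise valuations) are in general position, and let $|L|\subset|L(\Delta)|$ be the linear series of the curves that pass through $x_1,\dots,x_{n-\delta}$. Let $\Gamma$ be a tropical curve of degree $\Delta$ and genus $g-\delta$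 that passes through $v_1,\dots,v_{n-\delta}$, and let $|L|_\Gamma\subset|L|$ be the set of curves whose intersection with the dense torus has tropicalization $\Gamma$, with its weights. Then every curve in $|L|_\Gamma$ is an integral scheme and is contained in the smooth locus of $Y(\Delta)$. -/

import Mathlib

open CategoryTheory AlgebraicGeometry Topology
open scoped Pointwise

noncomputable section

/-! ### The field of Puiseux series -/

/-- The embedding of formal Laurent series into Hahn series with rational exponents that
sends `t` to `t ^ (1 / m)`. -/
def laurentRoot (m : ℕ+) : HahnSeries ℤ ℂ →+* HahnSeries ℚ ℂ :=
  HahnSeries.embDomainRingHom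
    (((AddMonoidHom.mulLeft ((m : ℚ)⁻¹)).comp (Int.castAddHom ℚ)))
    (by
      intro a b h
      have hm : ((m : ℕ) : ℚ) ≠ 0 := by exact_mod_cast m.ne_zero
      simpa [hm] using h)
    (by
      intro a b
      have hm : (0 : ℚ) < ((m : ℕ) : ℚ)⁻¹ := by
        have : (0 : ℚ) < ((m : ℕ) : ℚ) := by exact_mod_cast m.pos
        positivity
      simp [mul_le_mul_iff_right₀ hm])

/-- A Hahn series with bounded denominators comes from a Laurent series. -/
theorem mem_range_laurentRoot {m : ℕ+} {f : HahnSeries ℚ ℂ} :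
    f ∈ (laurentRoot m).fieldRange ↔ ∀ q ∈ f.support, ∃ k : ℤ, q = k / (m : ℚ) := by
  have hm : (0 : ℚ) < ((m : ℕ) : ℚ) := by exact_mod_cast m.pos
  constructor
  · rintro ⟨g, rfl⟩ q hq
    obtain ⟨k, -, rfl⟩ := HahnSeries.support_embDomain_subset hq
    exact ⟨k, by simp [div_eq_inv_mul]⟩
  · intro h
    have hinj : Function.Injective (fun k : ℤ => (k : ℚ) / (m : ℚ)) := by
      intro a b hab
      have hab' : (a : ℚ) / (m : ℚ) = (b : ℚ) / (m : ℚ) := hab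
      rw [div_left_inj' hm.ne'] at hab'
      exact_mod_cast hab'
    let g : HahnSeries ℤ ℂ :=
      { coeff := fun k => f.coeff ((k : ℚ) / (m : ℚ))
        isPWO_support' := by
          have hs : (f.support).IsPWO := f.isPWO_support
          intro u
          obtain ⟨a, b, hab, hle⟩ := hs fun i => ⟨((u i : ℤ) : ℚ) / (m : ℚ), (u i).2⟩
          refine ⟨a, b, hab, ?_⟩
          have hle' : ((u a : ℤ) : ℚ) / (m : ℚ) ≤ ((u b : ℤ) : ℚ) / (m : ℚ) := hle
          rw [div_le_div_iff_of_pos_right hm] at hle'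
          have hle'' : (u a : ℤ) ≤ (u b : ℤ) := by exact_mod_cast hle'
          exact hle'' }
    refine ⟨g, ?_⟩
    ext q
    by_cases hq : ∃ k : ℤ, q = k / (m : ℚ)
    · obtain ⟨k, rfl⟩ := hq
      have : (k : ℚ) / (m : ℚ) = ((m : ℕ) : ℚ)⁻¹ * (k : ℚ) := by rw [div_eq_inv_mul]
      conv_lhs => rw [this]
      exact HahnSeries.embDomain_coeff (a := k)
    · have h0 : f.coeff q = 0 := by
        by_contra hne
        exact hq (h q hne)
      rw [h0]
      refine HahnSeries.embDomain_of_notMem_range ?_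
      rintro ⟨k, hk⟩
      exact hq ⟨k, by rw [← hk]; simp [div_eq_inv_mul]⟩

theorem laurentRoot_range_le {m m' : ℕ+} {f : HahnSeries ℚ ℂ}
    (hf : f ∈ (laurentRoot m).fieldRange) : f ∈ (laurentRoot (m * m')).fieldRange := by
  rw [mem_range_laurentRoot] at hf ⊢
  intro q hq
  obtain ⟨k, rfl⟩ := hf q hq
  have hm : ((m : ℕ) : ℚ) ≠ 0 := by exact_mod_cast m.ne_zero
  have hm' : ((m' : ℕ) : ℚ) ≠ 0 := by exact_mod_cast m'.ne_zero
  refine ⟨k * (m' : ℕ), ?_⟩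
  push_cast
  field_simp

/-- The field `ℂ{{t}}` of Puiseux series: the union over `m ≥ 1` of the Laurent series fields
`ℂ((t ^ (1 / m)))`. -/
def Puiseux : Subfield (HahnSeries ℚ ℂ) where
  carrier := {f | ∃ m : ℕ+, f ∈ (laurentRoot m).fieldRange}
  mul_mem' := by
    rintro a b ⟨m, ha⟩ ⟨m', hb⟩
    refine ⟨m * m', mul_mem (laurentRoot_range_le ha) ?_⟩
    rw [mul_comm m m']
    exact laurentRoot_range_le hb
  one_mem' := ⟨1, one_mem _⟩
  add_mem' := by
    rintro a b ⟨m, ha⟩ ⟨m', hb⟩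
    refine ⟨m * m', add_mem (laurentRoot_range_le ha) ?_⟩
    rw [mul_comm m m']
    exact laurentRoot_range_le hb
  zero_mem' := ⟨1, zero_mem _⟩
  neg_mem' := by
    rintro a ⟨m, ha⟩
    exact ⟨m, neg_mem ha⟩
  inv_mem' := by
    rintro a ⟨m, ha⟩
    exact ⟨m, inv_mem ha⟩

/-- The `t`-adic valuation of a Puiseux series. It is only used for nonzero series; the value
at `0` is the junk value `0`. -/
def Puiseux.val (a : Puiseux) : ℝ := ((HahnSeries.order (a : HahnSeries ℚ ℂ) : ℚ) : ℝ)

/-! ### Lattice polygons -/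

/-- The lattice `M = ℤ²` inside `ℝ²`. The dual lattice `N` is also identified with `ℤ²`. -/
def latticeToReal (u : ℤ × ℤ) : ℝ × ℝ := ((u.1 : ℝ), (u.2 : ℝ))

/-- A lattice polygon: the convex hull of finitely many lattice points, of dimension two. -/
structure LatticePolygon where
  carrier : Set (ℝ × ℝ)
  exists_eq_convexHull : ∃ A : Finset (ℤ × ℤ), carrier = convexHull ℝ (latticeToReal '' A)
  nonempty_interior : (interior carrier).Nonempty

namespace LatticePolygon

variable (Δ : LatticePolygon)

theorem convex : Convex ℝ Δ.carrier := by
  obtain ⟨A, hA⟩ := Δ.exists_eq_convexHull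
  rw [hA]
  exact convex_convexHull ℝ _

theorem nonempty : Δ.carrier.Nonempty := Δ.nonempty_interior.mono interior_subset

/-- The lattice points of `Δ`. -/
def latticePoints : Set (ℤ × ℤ) := {u | latticeToReal u ∈ Δ.carrier}

/-- The lattice points in the interior of `Δ`. -/
def interiorLatticePoints : Set (ℤ × ℤ) := {u | latticeToReal u ∈ interior Δ.carrier}

/-- The monoid of lattice points of the cone over `Δ × {1}`: the pairs `(u, d)` with `u` a
lattice point of the dilated polygon `d Δ`. -/
def coneMonoid : AddSubmonoid ((ℤ × ℤ) × ℕ) where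
  carrier := {p | latticeToReal p.1 ∈ (p.2 : ℝ) • Δ.carrier}
  zero_mem' := by
    obtain ⟨x, hx⟩ := Δ.nonempty
    exact ⟨x, hx, by ext <;> simp [latticeToReal]⟩
  add_mem' := by
    intro a b ha hb
    have h := Δ.convex.add_smul (Nat.cast_nonneg (α := ℝ) a.2) (Nat.cast_nonneg (α := ℝ) b.2)
    have e : latticeToReal (a + b).1 = latticeToReal a.1 + latticeToReal b.1 := by
      simp [latticeToReal]
    change latticeToReal (a + b).1 ∈ ((a + b).2 : ℝ) • Δ.carrier
    rw [e, Prod.snd_add, Nat.cast_add, h]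
    exact Set.add_mem_add ha hb

/-- The degree `(u, d) ↦ d` on the cone monoid. -/
def degree : Δ.coneMonoid →+ ℕ := (AddMonoidHom.snd (ℤ × ℤ) ℕ).comp Δ.coneMonoid.subtype

/-! ### The polarized toric surface -/

/-- The homogeneous coordinate algebra `⨁ d, H⁰(Y(Δ), d L(Δ))` of the polarized toric surface:
the monoid algebra of the cone over `Δ`, over the Puiseux series. -/
abbrev CoordAlgebra : Type := AddMonoidAlgebra Puiseux Δ.coneMonoid

/-- The graded pieces: degree `d` is spanned by the monomials `x ^ u` with `u ∈ d Δ`. -/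
abbrev grading : ℕ → Submodule Puiseux Δ.CoordAlgebra :=
  AddMonoidAlgebra.gradeBy Puiseux Δ.degree

/-- The projective toric surface `Y(Δ)`. -/
def toricSurface : Scheme.{0} := Proj Δ.grading

/-- The structure morphism of `Y(Δ)` over the field of Puiseux series. -/
def toricSurfaceStr : Δ.toricSurface ⟶ Spec (.of Puiseux) :=
  Proj.toSpecZero Δ.grading ≫ Spec.map (CommRingCat.ofHom (algebraMap Puiseux (Δ.grading 0)))

/-- The smooth locus of `Y(Δ)` over the Puiseux series: the points that have an open
neighbourhood which is smooth over the base field. -/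
def smoothLocus : Set Δ.toricSurface :=
  {x | ∃ U : Δ.toricSurface.Opens, x ∈ U ∧ Smooth (U.ι ≫ Δ.toricSurfaceStr)}

/-- The vector space `H⁰(Y(Δ), L(Δ))`, with basis the monomials `x ^ u` for the lattice points `u`
of `Δ`. -/
abbrev Sections : Type := Δ.grading 1

/-- The complete linear series `|L(Δ)|`: the projective space of lines in `H⁰(Y(Δ), L(Δ))`. -/
abbrev LinearSeries : Type := Projectivization Puiseux Δ.Sections

/-- The ideal sheaf on `Y(Δ)` of the vanishing locus of a section `s`: a function `h` belongs to it
if, at every point `x`, its germ is a multiple of `s` in the localization at `x` of the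
homogeneous coordinate algebra. (These ideals already form a quasi-coherent ideal sheaf, which
`ofIdeals` returns.) -/
def idealSheaf (s : Δ.Sections) : Δ.toricSurface.IdealSheafData :=
  Scheme.IdealSheafData.ofIdeals (X := Proj Δ.grading) fun U =>
    ⨅ (x : ProjectiveSpectrum Δ.grading) (hx : x ∈ U.1), Ideal.comap
      ((algebraMap (HomogeneousLocalization.AtPrime Δ.grading x.asHomogeneousIdeal.toIdeal)
          (Localization.AtPrime x.asHomogeneousIdeal.toIdeal)).comp
        (AlgebraicGeometry.openToLocalization Δ.grading U.1 x hx).hom)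
      (Ideal.span {algebraMap Δ.CoordAlgebra _ s.1})

variable {Δ}

/-- The closed subscheme of `Y(Δ)` given by a member of `|L(Δ)|`: the zero scheme of a section
that represents it. -/
def curveIdeal (C : Δ.LinearSeries) : Δ.toricSurface.IdealSheafData := Δ.idealSheaf C.rep

/-- The restriction of a section of `L(Δ)` to the dense torus, as a Laurent polynomial. -/
def Sections.laurent (s : Δ.Sections) : AddMonoidAlgebra Puiseux (ℤ × ℤ) :=
  AddMonoidAlgebra.mapDomain (fun p : Δ.coneMonoid => p.1.1) s.1

end LatticePolygon

/-! ### Tropicalization -/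

/-- The `Puiseux`-points of the dense torus. -/
abbrev TorusPoint : Type := Puiseuxˣ × Puiseuxˣ

/-- Coordinatewise valuation. -/
def TorusPoint.trop (x : TorusPoint) : ℝ × ℝ := (Puiseux.val x.1, Puiseux.val x.2)

/-- The value of a Laurent polynomial at a point of the torus. -/
def laurentEval (f : AddMonoidAlgebra Puiseux (ℤ × ℤ)) (x : TorusPoint) : Puiseux :=
  f.coeff.sum fun u a => a * ((x.1 ^ u.1 * x.2 ^ u.2 : Puiseuxˣ) : Puiseux)

/-- The tropical monomial `⟨u, v⟩ + val (a_u)` of `f` at `v`. -/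
def tropMonomial (f : AddMonoidAlgebra Puiseux (ℤ × ℤ)) (u : ℤ × ℤ) (v : ℝ × ℝ) : ℝ :=
  u.1 * v.1 + u.2 * v.2 + Puiseux.val (f.coeff u)

/-- The exponents of `f` at which the minimum defining the piecewise linear function `ψ_f` is
attained at `v`. Their convex hull is the cell of the Newton subdivision dual to the face of the
tropical curve that contains `v` in its relative interior. -/
def activeSet (f : AddMonoidAlgebra Puiseux (ℤ × ℤ)) (v : ℝ × ℝ) : Set (ℤ × ℤ) :=
  {u | u ∈ f.coeff.support ∧ ∀ u' ∈ f.coeff.support, tropMonomial f u v ≤ tropMonomial f u' v}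

/-- The lattice length of a vector of `ℤ²`. -/
def latticeLength (u : ℤ × ℤ) : ℕ := Int.gcd u.1 u.2

/-- A subset of `ℝ²` with a weight at every point. A weighted one-dimensional polyhedral complex is
encoded by its support together with the function whose value at `v` is the weight of the edge
that contains `v` in its relative interior, for the coarsest polyhedral structure, and `0` if
`v` is a vertex or does not lie in the support. -/
@[ext] structure WeightedSet where
  support : Set (ℝ × ℝ)
  weight : ℝ × ℝ → ℕ

open Classical in
/-- The tropicalization of the curve `f = 0` in the torus, with its weights. The support is the
corner locus of `ψ_f`. A point whose dual cell is a segment lies in the relative interior of an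
edge, and has the lattice length of that segment as weight. -/
def tropicalization (f : AddMonoidAlgebra Puiseux (ℤ × ℤ)) : WeightedSet where
  support := {v | (activeSet f v).Nontrivial}
  weight v :=
    if Collinear ℝ (latticeToReal '' activeSet f v) then
      sSup {l | ∃ u ∈ activeSet f v, ∃ u' ∈ activeSet f v, l = latticeLength (u - u')}
    else 0

/-- The Newton polygon of a Laurent polynomial. -/
def newtonPolygon (f : AddMonoidAlgebra Puiseux (ℤ × ℤ)) : Set (ℝ × ℝ) :=
  convexHull ℝ (latticeToReal '' f.coeff.support)

/-- A tropical curve of degree `Δ`: the tropicalization of a curve defined by a Laurent polynomial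
with Newton polygon `Δ`. -/
def IsTropicalCurveOfDegree (Δ : LatticePolygon) (Γ : WeightedSet) : Prop :=
  ∃ f : AddMonoidAlgebra Puiseux (ℤ × ℤ), newtonPolygon f = Δ.carrier ∧ tropicalization f = Γ

/-! ### Parameterized tropical curves and the genus -/

open Classical in
/-- A finite metric graph, possibly with unbounded edges ("rays"), with a continuous map to `ℝ²`
that is affine with integral slope on every edge and satisfies the balancing condition at every
vertex. Edges and rays may be contracted (slope `0`). -/
structure ParamCurve where
  V : Type
  E : Type
  R : Type
  [fintypeV : Fintype V]
  [fintypeE : Fintype E]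
  [fintypeR : Fintype R]
  src : E → V
  tgt : E → V
  base : R → V
  len : E → ℝ
  len_pos : ∀ e, 0 < len e
  pos : V → ℝ × ℝ
  slope : E → ℤ × ℤ
  dir : R → ℤ × ℤ
  pos_tgt : ∀ e, pos (tgt e) = pos (src e) + len e • latticeToReal (slope e)
  balanced : ∀ v, (∑ e, if src e = v then slope e else 0) - (∑ e, if tgt e = v then slope e else 0)
    + (∑ r, if base r = v then dir r else 0) = 0

attribute [instance] ParamCurve.fintypeV ParamCurve.fintypeE ParamCurve.fintypeR

namespace ParamCurve

variable (C : ParamCurve)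

/-- The image of a bounded edge. -/
def edgeImage (e : C.E) : Set (ℝ × ℝ) := segment ℝ (C.pos (C.src e)) (C.pos (C.tgt e))

/-- The image of an unbounded edge. -/
def rayImage (r : C.R) : Set (ℝ × ℝ) :=
  {p | ∃ t : ℝ, 0 ≤ t ∧ p = C.pos (C.base r) + t • latticeToReal (C.dir r)}

/-- The image of the parameterization. -/
def image : Set (ℝ × ℝ) := Set.range C.pos ∪ (⋃ e, C.edgeImage e) ∪ ⋃ r, C.rayImage r

open Classical in
/-- The weight that the parameterization induces at a general point `p` of the plane: the sum over
the edges through `p` of the dilation factors (a contracted edge contributes `0`). -/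
def inducedWeight (p : ℝ × ℝ) : ℕ :=
  (∑ e, if p ∈ C.edgeImage e then latticeLength (C.slope e) else 0) +
    ∑ r, if p ∈ C.rayImage r then latticeLength (C.dir r) else 0

/-- `C` is a parameterization of `Γ`: it maps onto `Γ`, and over all but finitely many points (the
vertices of a subdivision) the dilation factors add up to the weight of `Γ`. -/
def Parameterizes (Γ : WeightedSet) : Prop :=
  C.image = Γ.support ∧ ∃ F : Set (ℝ × ℝ), F.Finite ∧ ∀ p ∉ F, C.inducedWeight p = Γ.weight p

/-- The boundary map of the graph, with rational coefficients. Rays are contractible onto their base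
and play no role. -/
def boundary : (C.E →₀ ℚ) →ₗ[ℚ] (C.V →₀ ℚ) :=
  Finsupp.lmapDomain ℚ ℚ C.tgt - Finsupp.lmapDomain ℚ ℚ C.src

/-- The first Betti number of the graph. -/
def firstBetti : ℕ := Module.finrank ℚ (LinearMap.ker C.boundary)

/-- The stratum of the space of parameterized tropical curves that contains `C`: the vertex
positions of the parameterized curves with the same graph and the same slopes (and arbitrary
positive edge lengths), for which the same vertices have the same image. -/
def stratum : Set (C.V → ℝ × ℝ) :=
  {q | (∀ e, ∃ l : ℝ, 0 < l ∧ q (C.tgt e) = q (C.src e) + l • latticeToReal (C.slope e)) ∧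
    ∀ v w, q v = q w ↔ C.pos v = C.pos w}

/-- Evaluation at marked vertices. -/
def eval {k : ℕ} (m : Fin k → C.V) (q : C.V → ℝ × ℝ) : Fin k → ℝ × ℝ := fun i => q (m i)

end ParamCurve

/-- The genus of `Γ` is `h`: this is the smallest first Betti number of a metric graph that
parameterizes `Γ`. -/
def HasGenus (Γ : WeightedSet) (h : ℕ) : Prop :=
  IsLeast {b | ∃ C : ParamCurve, C.Parameterizes Γ ∧ C.firstBetti = b} h

/-- Points of the plane in general position for parameterized tropical curves of degree `Δ` with
first Betti number `h`, that is, general with respect to the evaluation map. Whenever such a curve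
with marked vertices maps its markings to the given points, the evaluation map at the markings
sends the stratum of the curve onto a neighbourhood of the configuration. (Any point of the
parameterizing graph becomes a vertex after subdivision.) -/
def InGeneralPosition (Δ : LatticePolygon) (h : ℕ) {k : ℕ} (v : Fin k → ℝ × ℝ) : Prop :=
  ∀ Γ : WeightedSet, IsTropicalCurveOfDegree Δ Γ →
    ∀ C : ParamCurve, C.Parameterizes Γ → C.firstBetti = h →
      ∀ m : Fin k → C.V, C.eval m C.pos = v → v ∈ interior (C.eval m '' C.stratum)

namespace LatticePolygon

variable {Δ : LatticePolygon}

/-- The linear series `|L|` of the members of `|L(Δ)|` that pass through the points of `S`. -/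
def linearSeriesThrough {k : ℕ} (S : Fin k → TorusPoint) : Set Δ.LinearSeries :=
  {C | ∀ i, laurentEval (Sections.laurent C.rep) (S i) = 0}

/-- The set `|L|_Γ` of the members of `|L|` whose intersection with the dense torus has
tropicalization `Γ`. -/
def linearSeriesWithTrop {k : ℕ} (S : Fin k → TorusPoint) (Γ : WeightedSet) :
    Set Δ.LinearSeries :=
  {C | C ∈ linearSeriesThrough S ∧ tropicalization (Sections.laurent C.rep) = Γ}

end LatticePolygon

end

/-!
The proof has a tropical part, which shows that a section `f` of the linear series whose
tropicalization is `Γ` has Newton polygon `Δ` and is irreducible as a Laurent polynomial, and an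
algebraic part, which derives the integrality and the position of the zero scheme from this.

**Rigidity.** Take a parameterization of `Γ` of minimal first Betti number, without contracted edges
and subdivided so that the given points lie under vertices. The moments (with respect to the origin)
of the edges and rays of a deformation form a flow that is conserved at every vertex. General
position makes the space of these moments at least as large as the number `n - δ` of points. The
space of conserved flows is at most as large as the number of rays plus the first Betti number minus
the number of connected components, and the number of rays is bounded by their total weight, which is
at most the number `n + 1 - g` of lattice points on the boundary of `Δ`
(`ParamCurve.IsAdapted.sum_latticeLength_dir_le`). Since the first Betti number is `g - δ`, all these
estimates are equalities (`ParamCurve.Immersed.regular_of_count`): the graph is connected, its rays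
are primitive, and every conserved flow comes from a deformation. Dualizing the last property, every
linear relation between the slopes of the edges that start over a point has constant coefficients at
each vertex over that point (`ParamCurve.Regular.exists_eq_vertex`). In particular distinct edges do
not leave a point in the same direction.

**Irreducibility.** Let `f = f₁ * f₂`. The dual cells of `f` are the Minkowski sums of those of `f₁`
and `f₂`, so every edge of `Γ` splits its weight between the two factors. The edges of the dual cell
of `f₁` at a point close up to a polygon, which is a linear relation between the slopes of the edges
over the point with the shares of `f₁` as coefficients. By rigidity the share of `f₁` is constant at
every vertex, hence on the connected graph. On a primitive ray it is an integer between `0` and `1`,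
so that one of the factors has trivial dual cells everywhere and is a monomial
(`ParamCurve.IsAdapted.support_subsingleton_or`). The Newton polygon of `f` is contained in `Δ` and
its widths are determined by `Γ`, since the width in a direction is the sum of the widths of the dual
cells along a generic line in that direction; hence it is `Δ`. Both facts are collected in
`newtonPolygon_eq_and_irreducible`.

**Integrality.** The ring of Laurent polynomials is factorial, so `f` is prime. As the Newton polygon
of `f` is all of `Δ`, a quotient of a form of degree `d` by `f` has its exponents in `(d - 1) • Δ`;
therefore the section generates a homogeneous prime ideal of the coordinate algebra
(`LatticePolygon.isPrime_span`). Its zero scheme is the closure of the corresponding point of `Proj`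
with the reduced structure, an integral scheme (`LatticePolygon.isIntegral_subscheme`).

**Smoothness.** All vertices of `Δ` are exponents of `f`, so the curve avoids the torus-fixed points:
at each of its points some monomial over a point of `Δ` that is not a vertex is invertible
(`LatticePolygon.exists_monomial_notMem_of_mem`). The charts of these monomials have the coordinate
algebras `K[ℤ × ℤ]` and `K[ℤ × ℕ]`, which are smooth
(`LatticePolygon.smooth_awayStr_of_notMem_extremePoints`).
-/

noncomputable section

/-! ### Minima of finitely many affine functions of one variable -/

/-- The width of a set in the direction of a real function: the largest difference of values. -/
def width {ι : Type*} (B : Set ι) (s : ι → ℝ) : ℝ :=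
  sSup {x | ∃ i ∈ B, ∃ j ∈ B, x = s i - s j}

theorem width_eq {ι : Type*} {B : Set ι} {s : ι → ℝ} {i j : ι} (hi : i ∈ B) (hj : j ∈ B)
    (h : ∀ k ∈ B, s j ≤ s k ∧ s k ≤ s i) : width B s = s i - s j := by
  refine IsGreatest.csSup_eq ⟨⟨i, hi, j, hj, rfl⟩, ?_⟩
  rintro x ⟨a, ha, b, hb, rfl⟩
  linarith [h a ha, h b hb]

theorem exists_width_eq {ι : Type*} {B : Set ι} (hB : B.Finite) (hne : B.Nonempty) (s : ι → ℝ) :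
    ∃ i ∈ B, ∃ j ∈ B, (∀ k ∈ B, s j ≤ s k ∧ s k ≤ s i) ∧ width B s = s i - s j := by
  obtain ⟨i, hi, hi'⟩ := Set.exists_max_image B s hB hne
  obtain ⟨j, hj, hj'⟩ := Set.exists_min_image B s hB hne
  have h : ∀ k ∈ B, s j ≤ s k ∧ s k ≤ s i := fun k hk => ⟨hj' k hk, hi' k hk⟩
  exact ⟨i, hi, j, hj, h, width_eq hi hj h⟩

theorem width_nonneg {ι : Type*} {B : Set ι} (hB : B.Finite) (hne : B.Nonempty) (s : ι → ℝ) :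
    0 ≤ width B s := by
  obtain ⟨i, hi, j, hj, h, e⟩ := exists_width_eq hB hne s
  rw [e]
  linarith [h i hi]

theorem sub_le_width {ι : Type*} {B : Set ι} (hB : B.Finite) {s : ι → ℝ} {i j : ι} (hi : i ∈ B)
    (hj : j ∈ B) : s i - s j ≤ width B s := by
  obtain ⟨a, ha, b, hb, h, e⟩ := exists_width_eq hB ⟨i, hi⟩ s
  rw [e]
  linarith [h i hi, h j hj]

/-- The elements of `A` at which `φ` attains its minimum over `A`. -/
def argmin {ι : Type*} (A : Set ι) (φ : ι → ℝ) : Set ι := {i | i ∈ A ∧ ∀ j ∈ A, φ i ≤ φ j}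

theorem argmin_subset {ι : Type*} (A : Set ι) (φ : ι → ℝ) : argmin A φ ⊆ A := fun _ h => h.1

theorem argmin_nonempty {ι : Type*} {A : Set ι} (hA : A.Finite) (hne : A.Nonempty) (φ : ι → ℝ) :
    (argmin A φ).Nonempty := by
  obtain ⟨i, hi, h⟩ := Set.exists_min_image A φ hA hne
  exact ⟨i, hi, h⟩

theorem argmin_eq_of_mem {ι : Type*} {A : Set ι} {φ : ι → ℝ} {i j : ι} (hi : i ∈ argmin A φ)
    (hj : j ∈ argmin A φ) : φ i = φ j :=
  le_antisymm (hi.2 j hj.1) (hj.2 i hi.1)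

theorem mem_argmin_of_eq {ι : Type*} {A : Set ι} {φ : ι → ℝ} {i j : ι} (hi : i ∈ argmin A φ)
    (hj : j ∈ A) (h : φ j ≤ φ i) : j ∈ argmin A φ :=
  ⟨hj, fun k hk => h.trans (hi.2 k hk)⟩

section OneVariable

variable {ι : Type*} {A : Set ι} (s b : ι → ℝ)

/-- At a point where the slope of the minimum function jumps, the slopes that are attained bound an
interval; a slope strictly in between belongs to exactly one such interval. -/
theorem exists_argmin_slope_between (hA : A.Finite) {m : ℝ} (hm : m ∉ s '' A)
    (h1 : ∃ i ∈ A, m < s i) (h2 : ∃ j ∈ A, s j < m) :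
    ∃ t : ℝ, ∃ i ∈ argmin A (fun k => s k * t + b k), ∃ j ∈ argmin A (fun k => s k * t + b k),
      s j < m ∧ m < s i := by
  set Ip : Set ι := {i | i ∈ A ∧ m < s i}
  set Im : Set ι := {j | j ∈ A ∧ s j < m}
  have hIp : Ip.Finite := hA.subset fun _ h => h.1
  have hIm : Im.Finite := hA.subset fun _ h => h.1
  have hImne : Im.Nonempty := h2
  let τ : ι → ι → ℝ := fun i j => (b j - b i) / (s i - s j)
  -- for every steep line, its first crossing with a flat line
  have hmin : ∀ i, ∃ j ∈ Im, ∀ j' ∈ Im, τ i j ≤ τ i j' := fun i =>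
    Set.exists_min_image Im (τ i) hIm hImne
  choose J hJ hJmin using hmin
  obtain ⟨i, hi, himax⟩ := Set.exists_max_image Ip (fun i => τ i (J i)) hIp h1
  have cross : ∀ a ∈ Ip, ∀ c ∈ Im, ∀ t : ℝ, t ≤ τ a c ↔ s a * t + b a ≤ s c * t + b c := by
    intro a ha c hc t
    have : 0 < s a - s c := by linarith [ha.2, hc.2]
    simp only [τ]
    rw [le_div_iff₀ this]
    constructor <;> intro h <;> linarith
  have cross' : ∀ a ∈ Ip, ∀ c ∈ Im, ∀ t : ℝ, τ a c ≤ t ↔ s c * t + b c ≤ s a * t + b a := by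
    intro a ha c hc t
    have : 0 < s a - s c := by linarith [ha.2, hc.2]
    simp only [τ]
    rw [div_le_iff₀ this]
    constructor <;> intro h <;> linarith
  set t := τ i (J i)
  have hiJ : s (J i) * t + b (J i) = s i * t + b i :=
    le_antisymm ((cross' i hi _ (hJ i) t).1 le_rfl) ((cross i hi _ (hJ i) t).1 le_rfl)
  have hiact : i ∈ argmin A (fun k => s k * t + b k) := by
    refine ⟨hi.1, fun k hk => ?_⟩
    have hneg : ∀ c ∈ Im, s i * t + b i ≤ s c * t + b c := fun c hc =>
      (cross i hi c hc t).1 (hJmin i c hc)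
    rcases lt_trichotomy (s k) m with h | h | h
    · exact hneg k ⟨hk, h⟩
    · exact absurd ⟨k, hk, h⟩ hm
    · exact (hneg _ (hJ k)).trans ((cross' k ⟨hk, h⟩ _ (hJ k) t).1 (himax k ⟨hk, h⟩))
  exact ⟨t, i, hiact, J i, mem_argmin_of_eq hiact (hJ i).1 hiJ.le, (hJ i).2, hi.2⟩

/-- The slopes of the minimum function are antitone. -/
theorem argmin_slope_antitone {t t' : ℝ} (htt' : t < t') {i j : ι}
    (hi : i ∈ argmin A (fun k => s k * t' + b k)) (hj : j ∈ argmin A (fun k => s k * t + b k)) :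
    s i ≤ s j := by
  have h1 : s j * t + b j ≤ s i * t + b i := hj.2 i hi.1
  have h2 : s i * t' + b i ≤ s j * t' + b j := hi.2 j hj.1
  by_contra h
  push Not at h
  nlinarith

theorem finite_setOf_width_ne_zero (hA : A.Finite) :
    {t : ℝ | width (argmin A (fun k => s k * t + b k)) s ≠ 0}.Finite := by
  refine ((hA.prod hA).image fun p : ι × ι => (b p.2 - b p.1) / (s p.1 - s p.2)).subset ?_
  intro t ht
  have hfin : (argmin A (fun k => s k * t + b k)).Finite := hA.subset (argmin_subset _ _)
  rcases (argmin A (fun k => s k * t + b k)).eq_empty_or_nonempty with h0 | hne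
  · simp [h0, width] at ht
  obtain ⟨i, hi, j, hj, -, e⟩ := exists_width_eq hfin hne s
  refine ⟨(i, j), ⟨hi.1, hj.1⟩, ?_⟩
  have hij : s i - s j ≠ 0 := by rw [← e]; exact ht
  have := argmin_eq_of_mem hi hj
  simp only at this ⊢
  rw [div_eq_iff hij]
  linarith

/-- The jumps of the slope of a minimum of finitely many affine functions add up to the difference
of the extremal slopes. -/
theorem finsum_width_argmin (hA : A.Finite) (hne : A.Nonempty) :
    ∑ᶠ t : ℝ, width (argmin A (fun k => s k * t + b k)) s = width A s := by
  classical
  set act : ℝ → Set ι := fun t => argmin A (fun k => s k * t + b k) with hact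
  have hfin : ∀ t, (act t).Finite := fun t => hA.subset (argmin_subset _ _)
  have hne' : ∀ t, (act t).Nonempty := fun t => argmin_nonempty hA hne _
  choose top htop bot hbot hbd hw using fun t => exists_width_eq (hfin t) (hne' t) s
  obtain ⟨i, hi, j, hj, hij, hwA⟩ := exists_width_eq hA hne s
  have hsupp := finite_setOf_width_ne_zero s b hA
  set T := hsupp.toFinset with hT
  rw [finsum_eq_sum_of_support_subset (s := T) _ (by intro t ht; simpa [hT] using ht)]
  -- compare with the lengths of the intervals of slopes, which are disjoint
  set I : ℝ → Set ℝ := fun t => Set.Ioo (s (bot t)) (s (top t)) with hI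
  have hdisj : ∀ t t', t < t' → Disjoint (I t) (I t') := by
    intro t t' h
    rw [Set.disjoint_left]
    intro m hm hm'
    have := argmin_slope_antitone s b h (htop t') (hbot t)
    simp only [hI, Set.mem_Ioo] at hm hm'
    linarith
  have hvol : MeasureTheory.volume (⋃ t ∈ T, I t) = ∑ t ∈ T, MeasureTheory.volume (I t) := by
    refine MeasureTheory.measure_biUnion_finset ?_ fun t _ => measurableSet_Ioo
    intro t _ t' _ htt'
    rcases lt_or_gt_of_ne htt' with h | h
    · exact hdisj t t' h
    · exact (hdisj t' t h).symm
  have hvol2 : MeasureTheory.volume (⋃ t ∈ T, I t) =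
      MeasureTheory.volume (Set.Ioo (s j) (s i)) := by
    apply le_antisymm
    · refine MeasureTheory.measure_mono ?_
      intro m hm
      simp only [Set.mem_iUnion, hI, Set.mem_Ioo] at hm
      obtain ⟨t, -, h1, h2⟩ := hm
      exact ⟨(hij _ (hbot t).1).1.trans_lt h1, h2.trans_le (hij _ (htop t).1).2⟩
    · have hz : MeasureTheory.volume (s '' A) = 0 := (hA.image s).measure_zero _
      calc MeasureTheory.volume (Set.Ioo (s j) (s i))
          ≤ MeasureTheory.volume ((⋃ t ∈ T, I t) ∪ s '' A) := by
            refine MeasureTheory.measure_mono ?_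
            intro m hm
            by_cases hmA : m ∈ s '' A
            · exact Or.inr hmA
            left
            obtain ⟨t, a, ha, c, hc, h1, h2⟩ :=
              exists_argmin_slope_between s b hA hmA ⟨i, hi, hm.2⟩ ⟨j, hj, hm.1⟩
            have h3 : s (bot t) < m := ((hbd t c hc).1).trans_lt h1
            have h4 : m < s (top t) := h2.trans_le (hbd t a ha).2
            simp only [Set.mem_iUnion, hI, Set.mem_Ioo]
            refine ⟨t, ?_, h3, h4⟩
            rw [hT, Set.Finite.mem_toFinset]
            change width (act t) s ≠ 0
            rw [hw t]
            linarith
        _ ≤ _ := (MeasureTheory.measure_union_le _ _).trans (by rw [hz, add_zero])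
  rw [hvol2] at hvol
  simp only [hI, Real.volume_Ioo] at hvol
  rw [← ENNReal.ofReal_sum_of_nonneg] at hvol
  · rw [hwA]
    have hle : 0 ≤ s i - s j := by linarith [hij i hi]
    have hle' : 0 ≤ ∑ t ∈ T, (s (top t) - s (bot t)) :=
      Finset.sum_nonneg fun t _ => by linarith [hbd t _ (htop t)]
    have := (ENNReal.ofReal_eq_ofReal_iff hle hle').1 hvol
    rw [this]
    exact Finset.sum_congr rfl fun t _ => hw t
  · intro t _
    linarith [hbd t _ (htop t)]

end OneVariable

/-! ### Faces of finite planar sets -/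

/-- A small perturbation of a function on a finite set selects, among its minima, those of the
perturbation. -/
theorem eventually_argmin_add {ι : Type*} {A : Set ι} (hA : A.Finite) (φ ψ : ι → ℝ) :
    ∀ᶠ ε in 𝓝[>] (0 : ℝ), argmin A (fun i => φ i + ε * ψ i) = argmin (argmin A φ) ψ := by
  rcases A.eq_empty_or_nonempty with rfl | hne
  · filter_upwards with ε
    simp [argmin]
  have key : ∀ i ∈ A, ∀ j ∈ A, ∀ᶠ ε in 𝓝[>] (0 : ℝ), φ i < φ j →
      φ i + ε * ψ i < φ j + ε * ψ j := by
    intro i _ j _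
    by_cases h : φ i < φ j
    · have hc : ContinuousAt (fun ε : ℝ => (φ j + ε * ψ j) - (φ i + ε * ψ i)) 0 := by fun_prop
      have := hc.eventually (lt_mem_nhds (a := 0) (by simpa using h))
      filter_upwards [this.filter_mono nhdsWithin_le_nhds] with ε hε _
      linarith
    · filter_upwards with ε h'
      exact absurd h' h
  have key2 : ∀ᶠ ε in 𝓝[>] (0 : ℝ), ∀ i ∈ A, ∀ j ∈ A, φ i < φ j →
      φ i + ε * ψ i < φ j + ε * ψ j := by
    rw [Filter.eventually_all_finite hA]
    intro i hi
    rw [Filter.eventually_all_finite hA]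
    exact key i hi
  filter_upwards [key2, self_mem_nhdsWithin] with ε hε hpos
  have hpos : 0 < ε := hpos
  obtain ⟨i₀, hi₀⟩ := argmin_nonempty hA hne φ
  ext i
  constructor
  · rintro ⟨hi, h⟩
    have hmin : i ∈ argmin A φ := by
      by_contra hcon
      have : φ i₀ < φ i := by
        by_contra hlt
        exact hcon (mem_argmin_of_eq hi₀ hi (not_lt.1 hlt))
      exact absurd (h i₀ hi₀.1) (not_le.2 (hε i₀ hi₀.1 i hi this))
    refine ⟨hmin, fun j hj => ?_⟩
    have h1 := h j hj.1
    have h2 := argmin_eq_of_mem hmin hj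
    simp only at h1
    exact le_of_mul_le_mul_left (by linarith) hpos
  · rintro ⟨hi, h⟩
    refine ⟨hi.1, fun j hj => ?_⟩
    by_cases hjm : j ∈ argmin A φ
    · have h1 := h j hjm
      have h2 := argmin_eq_of_mem hi hjm
      have h3 := mul_le_mul_of_nonneg_left h1 hpos.le
      linarith
    · have : φ i < φ j := by
        by_contra hlt
        exact hjm (mem_argmin_of_eq hi hj (not_lt.1 hlt))
      exact (hε i hi.1 j hj this).le

/-- The linear function with coefficients `d`, in terms of two coordinate functions `s` and `b`. -/
def lin {ι : Type*} (s b : ι → ℝ) (d : ℝ × ℝ) (i : ι) : ℝ := s i * d.1 + b i * d.2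

/-- Rotation of the plane by a right angle. -/
def rot (d : ℝ × ℝ) : ℝ × ℝ := (d.2, -d.1)

/-- The squared Euclidean length. -/
def normSq (d : ℝ × ℝ) : ℝ := d.1 ^ 2 + d.2 ^ 2

theorem normSq_pos {d : ℝ × ℝ} (hd : d ≠ 0) : 0 < normSq d := by
  unfold normSq
  by_contra h
  have h1 : d.1 = 0 := by nlinarith [sq_nonneg d.1, sq_nonneg d.2]
  have h2 : d.2 = 0 := by nlinarith [sq_nonneg d.1, sq_nonneg d.2]
  exact hd (Prod.ext h1 h2)

section Closure

variable {ι : Type*} {A : Set ι} (s b : ι → ℝ)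

theorem width_smul {B : Set ι} (hB : B.Finite) {s t : ι → ℝ} {c e : ℝ} (hc : 0 ≤ c) (he : 0 ≤ e)
    (h : ∀ i ∈ B, ∀ j ∈ B, c * (s i - s j) = e * (t i - t j)) :
    c * width B s = e * width B t := by
  rcases B.eq_empty_or_nonempty with rfl | hne
  · simp [width]
  obtain ⟨i, hi, j, hj, hij, e1⟩ := exists_width_eq hB hne s
  obtain ⟨i', hi', j', hj', hij', e2⟩ := exists_width_eq hB hne t
  apply le_antisymm
  · rw [e1, h i hi j hj]
    exact mul_le_mul_of_nonneg_left (sub_le_width hB hi hj) he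
  · rw [e2, ← h i' hi' j' hj']
    exact mul_le_mul_of_nonneg_left (sub_le_width hB hi' hj') hc

theorem width_congr_neg {B : Set ι} (hB : B.Finite) {s t : ι → ℝ}
    (h : ∀ i ∈ B, ∀ j ∈ B, s i - s j = -(t i - t j)) : width B s = width B t := by
  rcases B.eq_empty_or_nonempty with rfl | hne
  · simp [width]
  obtain ⟨i, hi, j, hj, hij, e1⟩ := exists_width_eq hB hne s
  rw [e1, width_eq (s := t) hj hi]
  · linarith [h i hi j hj]
  · intro k hk
    constructor <;> linarith [h i hi k hk, h j hj k hk, hij k hk]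

theorem argmin_lin_smul {c : ℝ} (hc : 0 < c) (d : ℝ × ℝ) :
    argmin A (lin s b (c • d)) = argmin A (lin s b d) := by
  have : lin s b (c • d) = fun i => c * lin s b d i := by
    ext i
    simp only [lin, Prod.smul_fst, Prod.smul_snd, smul_eq_mul]
    ring
  rw [this]
  ext i
  simp only [argmin, Set.mem_ofPred_eq, mul_le_mul_iff_right₀ hc]

/-- The width of the face of `A` in the direction `d`, measured along the face. -/
def faceWidth {ι : Type*} (A : Set ι) (s b : ι → ℝ) (d : ℝ × ℝ) : ℝ :=
  width (argmin A (lin s b d)) (lin s b (rot d))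

theorem faceWidth_mul_abs (hA : A.Finite) {d : ℝ × ℝ} :
    |d.2| * faceWidth A s b d = normSq d * width (argmin A (lin s b d)) s := by
  have hfin := hA.subset (argmin_subset A (lin s b d))
  have hn : 0 ≤ normSq d := by unfold normSq; positivity
  have key : ∀ i ∈ argmin A (lin s b d), ∀ j ∈ argmin A (lin s b d),
      d.2 * (lin s b (rot d) i - lin s b (rot d) j) = normSq d * (s i - s j) := by
    intro i hi j hj
    have := argmin_eq_of_mem hi hj
    simp only [lin, rot, normSq] at this ⊢
    linear_combination (-d.1) * this
  rcases le_total 0 d.2 with h | h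
  · rw [abs_of_nonneg h]
    exact width_smul hfin h hn key
  · rw [abs_of_nonpos h]
    have := width_congr_neg hfin (s := lin s b (rot d)) (t := fun i => -lin s b (rot d) i)
      (fun i _ j _ => by ring)
    rw [faceWidth, this]
    refine width_smul hfin (by linarith) hn fun i hi j hj => ?_
    rw [← key i hi j hj]
    ring

theorem faceWidth_smul (hA : A.Finite) {c : ℝ} (hc : 0 < c) (d : ℝ × ℝ) :
    faceWidth A s b (c • d) = c * faceWidth A s b d := by
  have := width_smul (hA.subset (argmin_subset A (lin s b d))) (s := lin s b (rot (c • d)))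
    (t := lin s b (rot d)) (c := 1) (e := c) zero_le_one hc.le (fun i _ j _ => by
      simp only [lin, rot, Prod.smul_fst, Prod.smul_snd, smul_eq_mul]; ring)
  rw [faceWidth, argmin_lin_smul s b hc, faceWidth, ← this, one_mul]

/-- The edges of a planar set with inner normals on one side of a line account for the whole width of
the set along that line: this is `finsum_width_argmin` for the minimization of `s * t + b * σ`, whose
breakpoints `t` are the slopes of the inner normals `(t, σ)`. -/
theorem sum_faceWidth_of_sign (hA : A.Finite) (hne : A.Nonempty) {I : Type*} (σ : ℝ)
    (hσ : σ = 1 ∨ σ = -1) (J : Finset I) (d : I → ℝ × ℝ) (hJ : ∀ i ∈ J, 0 < σ * (d i).2)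
    (hinj : ∀ i ∈ J, ∀ j ∈ J, ∀ c : ℝ, 0 < c → d j = c • d i → i = j)
    (hcover : ∀ e : ℝ × ℝ, 0 < σ * e.2 → faceWidth A s b e ≠ 0 →
      ∃ i ∈ J, ∃ c : ℝ, 0 < c ∧ d i = c • e) :
    ∑ i ∈ J, faceWidth A s b (d i) / normSq (d i) * |(d i).2| = width A s := by
  classical
  have hσ2 : σ * σ = 1 := by rcases hσ with rfl | rfl <;> norm_num
  have habs : ∀ i ∈ J, |(d i).2| = σ * (d i).2 := by
    intro i hi
    have := hJ i hi
    rcases hσ with rfl | rfl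
    · rw [abs_of_pos (by linarith)]; ring
    · rw [abs_of_neg (by linarith)]; ring
  -- the breakpoint to which the normal `d i` belongs
  let τ : I → ℝ := fun i => (d i).1 / (σ * (d i).2)
  have hdτ : ∀ i ∈ J, d i = (σ * (d i).2) • ((τ i, σ) : ℝ × ℝ) := by
    intro i hi
    have h0 := (hJ i hi).ne'
    ext
    · simp only [τ, Prod.smul_fst, smul_eq_mul]
      rw [mul_div_cancel₀ _ h0]
    · simp only [Prod.smul_snd, smul_eq_mul]
      linear_combination (- (d i).2) * hσ2
  have hact : ∀ t : ℝ, argmin A (lin s b (t, σ)) = argmin A (fun k => s k * t + b k * σ) :=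
    fun t => rfl
  rw [← finsum_width_argmin s (fun k => b k * σ) hA hne,
    finsum_eq_sum_of_support_subset (s := J.image τ)]
  · rw [Finset.sum_image]
    · refine Finset.sum_congr rfl fun i hi => ?_
      have h0 : d i ≠ 0 := by
        intro h
        have := hJ i hi
        rw [h] at this
        simp at this
      have h1 := faceWidth_mul_abs s b hA (d := d i)
      have h2 : argmin A (lin s b (d i)) = argmin A (fun k => s k * τ i + b k * σ) := by
        rw [hdτ i hi, argmin_lin_smul s b (hJ i hi)]
        rfl
      rw [← h2]
      have := (normSq_pos h0).ne'
      field_simp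
      linarith
    · intro i hi j hj hij
      refine hinj i hi j hj ((σ * (d j).2) / (σ * (d i).2)) (div_pos (hJ j hj) (hJ i hi)) ?_
      rw [hdτ j hj, hdτ i hi, hij, smul_smul]
      congr 1
      have h0 := (hJ i hi).ne'
      simp only [Prod.smul_snd, smul_eq_mul]
      have e1 : σ * (σ * (d i).2 * σ) = σ * (d i).2 := by linear_combination (σ * (d i).2) * hσ2
      have e2 : σ * (σ * (d j).2 * σ) = σ * (d j).2 := by linear_combination (σ * (d j).2) * hσ2
      rw [e1, e2, div_mul_cancel₀ _ h0]
  · intro t ht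
    have ht' : width (argmin A (lin s b (t, σ))) s ≠ 0 := ht
    have h1 := faceWidth_mul_abs s b hA (d := (t, σ))
    have hσ0 : σ ≠ 0 := by rintro rfl; simp at hσ2
    have hfw : faceWidth A s b (t, σ) ≠ 0 := by
      intro h
      rw [h, mul_zero] at h1
      have : normSq ((t, σ) : ℝ × ℝ) ≠ 0 := (normSq_pos (by
        intro h; exact hσ0 (congrArg Prod.snd h))).ne'
      exact (mul_ne_zero this ht') h1.symm
    obtain ⟨i, hi, c, hc, hd⟩ := hcover (t, σ) (by simp [hσ2]) hfw
    simp only [Finset.coe_image, Set.mem_image, Finset.mem_coe]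
    refine ⟨i, hi, ?_⟩
    simp only [τ]
    rw [hd]
    simp only [Prod.smul_fst, Prod.smul_snd, smul_eq_mul]
    rw [div_eq_iff (by rw [mul_left_comm, hσ2, mul_one]; exact hc.ne')]
    linear_combination (-t * c) * hσ2

/-- The edges of a polygon close up, second coordinate: the normals on the two sides of a line both
account for the width of the polygon along the line. -/
theorem sum_faceWidth_snd (hA : A.Finite) (hne : A.Nonempty) {I : Type*} [Fintype I]
    (d : I → ℝ × ℝ) (hinj : ∀ i j, ∀ c : ℝ, 0 < c → d j = c • d i → i = j)
    (hcover : ∀ e : ℝ × ℝ, e ≠ 0 → faceWidth A s b e ≠ 0 → ∃ i, ∃ c : ℝ, 0 < c ∧ d i = c • e) :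
    ∑ i, faceWidth A s b (d i) / normSq (d i) * (d i).2 = 0 := by
  classical
  have hc : ∀ σ : ℝ, (σ = 1 ∨ σ = -1) →
      ∑ i ∈ Finset.univ.filter (fun i => 0 < σ * (d i).2),
        faceWidth A s b (d i) / normSq (d i) * |(d i).2| = width A s := by
    intro σ hσ
    refine sum_faceWidth_of_sign s b hA hne σ hσ _ d (by simp) (fun i _ j _ => hinj i j) ?_
    intro e he hfw
    obtain ⟨i, c, hc, hd⟩ := hcover e (by rintro rfl; simp at he) hfw
    refine ⟨i, ?_, c, hc, hd⟩
    simp only [Finset.mem_filter, Finset.mem_univ, true_and, hd, Prod.smul_snd, smul_eq_mul]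
    rw [mul_left_comm]
    positivity
  have h1 := hc 1 (Or.inl rfl)
  have h2 := hc (-1) (Or.inr rfl)
  rw [Finset.sum_filter] at h1 h2
  rw [← sub_eq_zero.2 (h1.trans h2.symm), ← Finset.sum_sub_distrib]
  refine Finset.sum_congr rfl fun i _ => ?_
  rcases lt_trichotomy (d i).2 0 with h | h | h
  · rw [if_neg (by linarith), if_pos (by linarith), abs_of_neg h]; ring
  · simp [h]
  · rw [if_pos (by linarith), if_neg (by linarith), abs_of_pos h]; ring

theorem lin_swap (d : ℝ × ℝ) : lin b s d.swap = lin s b d := by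
  ext i
  simp only [lin, Prod.fst_swap, Prod.snd_swap]
  ring

theorem faceWidth_swap (hA : A.Finite) (d : ℝ × ℝ) :
    faceWidth A b s d.swap = faceWidth A s b d := by
  rw [faceWidth, lin_swap, faceWidth]
  refine width_congr_neg (hA.subset (argmin_subset _ _)) fun i _ j _ => ?_
  simp only [lin, rot, Prod.fst_swap, Prod.snd_swap]
  ring

/-- The boundary of a convex polygon is closed: the rotated edge vectors of the convex hull of a
finite planar set add up to zero. -/
theorem sum_faceWidth_smul_eq_zero (hA : A.Finite) (hne : A.Nonempty) {I : Type*} [Fintype I]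
    (d : I → ℝ × ℝ) (hinj : ∀ i j, ∀ c : ℝ, 0 < c → d j = c • d i → i = j)
    (hcover : ∀ e : ℝ × ℝ, e ≠ 0 → faceWidth A s b e ≠ 0 → ∃ i, ∃ c : ℝ, 0 < c ∧ d i = c • e) :
    ∑ i, (faceWidth A s b (d i) / normSq (d i)) • d i = 0 := by
  ext
  · rw [Prod.fst_sum]
    have := sum_faceWidth_snd b s hA hne (fun i => (d i).swap)
      (fun i j c hc h => hinj i j c hc (by
        have := congrArg Prod.swap h
        simpa using this))
      (fun e he hfw => by
        obtain ⟨i, c, hc, h⟩ := hcover e.swap (by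
          intro h; apply he; have := congrArg Prod.swap h; simpa using this) (by
          rwa [← faceWidth_swap s b hA, Prod.swap_swap])
        exact ⟨i, c, hc, by rw [h]; rfl⟩)
    simp only [faceWidth_swap s b hA] at this
    refine Eq.trans (Finset.sum_congr rfl fun i _ => ?_) this
    simp [normSq, add_comm]
  · rw [Prod.snd_sum]
    exact sum_faceWidth_snd s b hA hne d hinj hcover

end Closure

/-! ### Newton polygons and active sets of products -/

theorem Puiseux.coe_ne_zero {a : Puiseux} (ha : a ≠ 0) : (a : HahnSeries ℚ ℂ) ≠ 0 := by
  simpa using ha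

theorem Puiseux.val_mul {a b : Puiseux} (ha : a ≠ 0) (hb : b ≠ 0) :
    Puiseux.val (a * b) = Puiseux.val a + Puiseux.val b := by
  unfold Puiseux.val
  rw [Subfield.coe_mul, HahnSeries.order_mul (coe_ne_zero ha) (coe_ne_zero hb)]
  push_cast
  ring

theorem Puiseux.min_val_le_val_add {a b : Puiseux} (hab : a + b ≠ 0) :
    min (Puiseux.val a) (Puiseux.val b) ≤ Puiseux.val (a + b) := by
  unfold Puiseux.val
  rw [Subfield.coe_add]
  have := HahnSeries.min_order_le_order_add (x := (a : HahnSeries ℚ ℂ)) (y := b)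
    (by rw [← Subfield.coe_add]; exact coe_ne_zero hab)
  exact_mod_cast this

theorem Puiseux.val_neg (a : Puiseux) : Puiseux.val (-a) = Puiseux.val a := by
  unfold Puiseux.val
  rw [Subfield.coe_neg, HahnSeries.order_neg]

theorem Puiseux.val_add_of_lt {a b : Puiseux} (ha : a ≠ 0)
    (hb : b = 0 ∨ Puiseux.val a < Puiseux.val b) :
    a + b ≠ 0 ∧ Puiseux.val (a + b) = Puiseux.val a := by
  rcases hb with rfl | hb
  · simpa using ha
  have hne : a + b ≠ 0 := by
    intro h
    rw [add_eq_zero_iff_eq_neg] at h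
    rw [h, val_neg] at hb
    exact lt_irrefl _ hb
  refine ⟨hne, le_antisymm ?_ ?_⟩
  · have h : (a + b) + -b ≠ 0 := by simpa using ha
    have := min_val_le_val_add h
    rw [val_neg, add_neg_cancel_right] at this
    rcases min_le_iff.1 this with h | h
    · exact h
    · exact absurd hb (not_lt.2 h)
  · have := min_val_le_val_add hne
    rwa [min_eq_left hb.le] at this

/-- A nonzero sum has a summand whose valuation does not exceed that of the sum. -/
theorem Puiseux.exists_val_le_val_sum {ι : Type*} (s : Finset ι) (x : ι → Puiseux)
    (h : ∑ i ∈ s, x i ≠ 0) :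
    ∃ i ∈ s, x i ≠ 0 ∧ Puiseux.val (x i) ≤ Puiseux.val (∑ i ∈ s, x i) := by
  classical
  induction s using Finset.induction_on with
  | empty => simp at h
  | insert i s hi ih =>
    rw [Finset.sum_insert hi] at h ⊢
    by_cases hxi : x i = 0
    · rw [hxi, zero_add] at h ⊢
      obtain ⟨j, hj, h1, h2⟩ := ih h
      exact ⟨j, Finset.mem_insert_of_mem hj, h1, h2⟩
    by_cases hs : ∑ j ∈ s, x j = 0
    · rw [hs, add_zero]
      exact ⟨i, Finset.mem_insert_self _ _, hxi, le_rfl⟩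
    rcases min_le_iff.1 (min_val_le_val_add h) with h' | h'
    · exact ⟨i, Finset.mem_insert_self _ _, hxi, h'⟩
    · obtain ⟨j, hj, h1, h2⟩ := ih hs
      exact ⟨j, Finset.mem_insert_of_mem hj, h1, h2.trans h'⟩

theorem Puiseux.val_sum_of_lt {ι : Type*} {s : Finset ι} {x : ι → Puiseux} {i : ι} (hi : i ∈ s)
    (hxi : x i ≠ 0) (h : ∀ j ∈ s, j ≠ i → x j = 0 ∨ Puiseux.val (x i) < Puiseux.val (x j)) :
    ∑ j ∈ s, x j ≠ 0 ∧ Puiseux.val (∑ j ∈ s, x j) = Puiseux.val (x i) := by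
  classical
  rw [← Finset.add_sum_erase s x hi]
  refine val_add_of_lt hxi ?_
  by_cases hs : ∑ j ∈ s.erase i, x j = 0
  · exact Or.inl hs
  · right
    obtain ⟨j, hj, h1, h2⟩ := exists_val_le_val_sum _ _ hs
    rw [Finset.mem_erase] at hj
    exact ((h j hj.2 hj.1).resolve_left h1).trans_le h2

/-- Laurent polynomials in two variables over the Puiseux series. -/
abbrev Laurent : Type := AddMonoidAlgebra Puiseux (ℤ × ℤ)

/-- The pairing of a real vector with a lattice vector. -/
abbrev pairing (d : ℝ × ℝ) (u : ℤ × ℤ) : ℝ :=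
  lin (fun u : ℤ × ℤ => (u.1 : ℝ)) (fun u => (u.2 : ℝ)) d u

/-- The width along itself of the face of a set of lattice points in a direction. -/
abbrev edgeWidth (A : Set (ℤ × ℤ)) (d : ℝ × ℝ) : ℝ :=
  faceWidth A (fun u : ℤ × ℤ => (u.1 : ℝ)) (fun u => (u.2 : ℝ)) d

theorem pairing_add (d : ℝ × ℝ) (u v : ℤ × ℤ) :
    pairing d (u + v) = pairing d u + pairing d v := by
  simp only [lin, Prod.fst_add, Prod.snd_add]
  push_cast
  ring

theorem pairing_sub (d : ℝ × ℝ) (u v : ℤ × ℤ) :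
    pairing d (u - v) = pairing d u - pairing d v := by
  simp only [lin, Prod.fst_sub, Prod.snd_sub]
  push_cast
  ring

theorem eq_of_pairing_eq {d : ℝ × ℝ} (hd : d ≠ 0) {u v : ℤ × ℤ} (h : pairing d u = pairing d v)
    (h' : pairing (rot d) u = pairing (rot d) v) : u = v := by
  have hn := (normSq_pos hd).ne'
  simp only [lin, rot] at h h'
  have h1 : normSq d * ((u.1 : ℝ) - v.1) = 0 := by
    unfold normSq; linear_combination d.1 * h + d.2 * h'
  have h2 : normSq d * ((u.2 : ℝ) - v.2) = 0 := by
    unfold normSq; linear_combination d.2 * h - d.1 * h'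
  have h3 := (mul_eq_zero.1 h1).resolve_left hn
  have h4 := (mul_eq_zero.1 h2).resolve_left hn
  ext
  · exact_mod_cast sub_eq_zero.1 h3
  · exact_mod_cast sub_eq_zero.1 h4

theorem activeSet_eq_argmin (f : Laurent) (v : ℝ × ℝ) :
    activeSet f v = argmin (f.coeff.support : Set (ℤ × ℤ)) (fun u => tropMonomial f u v) := rfl

theorem activeSet_finite (f : Laurent) (v : ℝ × ℝ) : (activeSet f v).Finite :=
  f.coeff.support.finite_toSet.subset fun _ h => h.1

theorem support_nonempty_of_ne_zero {f : Laurent} (hf : f ≠ 0) :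
    (f.coeff.support : Set (ℤ × ℤ)).Nonempty := by
  rw [Finset.coe_nonempty, Finsupp.support_nonempty_iff]
  intro h
  exact hf (AddMonoidAlgebra.coeff_inj.1 h)

theorem activeSet_nonempty {f : Laurent} (hf : f ≠ 0) (v : ℝ × ℝ) : (activeSet f v).Nonempty :=
  argmin_nonempty f.coeff.support.finite_toSet (support_nonempty_of_ne_zero hf) _

theorem tropMonomial_add_smul (f : Laurent) (u : ℤ × ℤ) (v w : ℝ × ℝ) (ε : ℝ) :
    tropMonomial f u (v + ε • w) = tropMonomial f u v + ε * pairing w u := by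
  simp only [tropMonomial, lin, Prod.fst_add, Prod.snd_add, Prod.smul_fst, Prod.smul_snd,
    smul_eq_mul]
  ring

/-- Near `v` in the direction `w`, the active set is the face in the direction `w` of the active set
at `v`. -/
theorem eventually_activeSet_add_smul (f : Laurent) (v w : ℝ × ℝ) :
    ∀ᶠ ε in 𝓝[>] (0 : ℝ), activeSet f (v + ε • w) = argmin (activeSet f v) (pairing w) := by
  have := eventually_argmin_add (A := (f.coeff.support : Set (ℤ × ℤ))) (Finset.finite_toSet _)
    (fun u => tropMonomial f u v) (pairing w)
  filter_upwards [this] with ε hε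
  rw [activeSet_eq_argmin, activeSet_eq_argmin, ← hε]
  congr 1
  ext u
  exact tropMonomial_add_smul f u v w ε

/-- The weighted set `(S, φ)` behaves like the exponents and tropical monomials of a product of
polynomials with data `(S₁, φ₁)` and `(S₂, φ₂)`: every exponent is a sum of two exponents, and
a sum at which there is no cancellation is an exponent. -/
structure IsProductLike (S S₁ S₂ : Set (ℤ × ℤ)) (φ φ₁ φ₂ : ℤ × ℤ → ℝ) : Prop where
  exists_le : ∀ u ∈ S, ∃ a ∈ S₁, ∃ b ∈ S₂, u = a + b ∧ φ₁ a + φ₂ b ≤ φ u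
  of_unique : ∀ a ∈ S₁, ∀ b ∈ S₂, (∀ a' ∈ S₁, ∀ b' ∈ S₂, a' + b' = a + b →
    a' = a ∧ b' = b ∨ φ₁ a + φ₂ b < φ₁ a' + φ₂ b') → a + b ∈ S ∧ φ (a + b) = φ₁ a + φ₂ b

/-- The valuation of a sum is at least the smallest valuation of a summand, with equality if the
smallest valuation is attained only once. -/
theorem isProductLike_tropMonomial (f₁ f₂ : Laurent) (v : ℝ × ℝ) :
    IsProductLike ((f₁ * f₂).coeff.support : Set (ℤ × ℤ)) (f₁.coeff.support : Set (ℤ × ℤ))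
      (f₂.coeff.support : Set (ℤ × ℤ)) (fun u => tropMonomial (f₁ * f₂) u v)
      (fun u => tropMonomial f₁ u v) (fun u => tropMonomial f₂ u v) := by
  have hcoeff : ∀ u, (f₁ * f₂).coeff u =
      ∑ a ∈ f₁.coeff.support, f₁.coeff a * f₂.coeff (u - a) := by
    intro u
    rw [AddMonoidAlgebra.coeff_mul_apply_left, Finsupp.sum]
    exact Finset.sum_congr rfl fun a _ => by rw [neg_add_eq_sub]
  have htrop : ∀ a b : ℤ × ℤ, f₁.coeff a ≠ 0 → f₂.coeff b ≠ 0 →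
      tropMonomial f₁ a v + tropMonomial f₂ b v = ((a + b).1 : ℝ) * v.1 + ((a + b).2 : ℝ) * v.2 +
        Puiseux.val (f₁.coeff a * f₂.coeff b) := by
    intro a b ha hb
    rw [Puiseux.val_mul ha hb, tropMonomial, tropMonomial, Prod.fst_add, Prod.snd_add]
    push_cast
    ring
  constructor
  · intro u hu
    rw [Finset.mem_coe, Finsupp.mem_support_iff, hcoeff] at hu
    obtain ⟨a, ha, h1, h2⟩ := Puiseux.exists_val_le_val_sum _ _ hu
    have hb : f₂.coeff (u - a) ≠ 0 := right_ne_zero_of_mul h1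
    refine ⟨a, ha, u - a, by simpa using hb, by abel, ?_⟩
    rw [htrop _ _ (by simpa using ha) hb, add_sub_cancel, tropMonomial, hcoeff]
    gcongr
  · intro a ha b hb h
    have ha0 : f₁.coeff a ≠ 0 := by simpa using ha
    have hb0 : f₂.coeff b ≠ 0 := by simpa using hb
    have e : a + b - a = b := by abel
    have := Puiseux.val_sum_of_lt (s := f₁.coeff.support)
      (x := fun c => f₁.coeff c * f₂.coeff (a + b - c)) ha
      (by simp only [e]; exact mul_ne_zero ha0 hb0) (by
        intro c hc hca
        by_cases h0 : f₂.coeff (a + b - c) = 0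
        · left; simp [h0]
        right
        simp only [e]
        have hc0 : f₁.coeff c ≠ 0 := by simpa using hc
        have := (h c hc (a + b - c) (by simpa using h0) (by abel)).resolve_left
          (fun hcon => hca hcon.1)
        rw [htrop _ _ ha0 hb0, htrop _ _ hc0 h0, add_sub_cancel] at this
        linarith)
    rw [← hcoeff] at this
    simp only [e] at this
    refine ⟨by simpa using this.1, ?_⟩
    rw [htrop _ _ ha0 hb0, tropMonomial, this.2]

theorem isProductLike_support (f₁ f₂ : Laurent) :
    IsProductLike ((f₁ * f₂).coeff.support : Set (ℤ × ℤ)) (f₁.coeff.support : Set (ℤ × ℤ))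
      (f₂.coeff.support : Set (ℤ × ℤ)) 0 0 0 := by
  have h := isProductLike_tropMonomial f₁ f₂ 0
  refine ⟨fun u hu => ?_, fun a ha b hb hab => ?_⟩
  · obtain ⟨a, ha, b, hb, e, -⟩ := h.1 u hu
    exact ⟨a, ha, b, hb, e, by simp⟩
  · refine ⟨(h.2 a ha b hb fun a' ha' b' hb' e => Or.inl ?_).1, by simp⟩
    simpa using hab a' ha' b' hb' e

theorem exists_argmin_width_eq {A : Set (ℤ × ℤ)} (hA : A.Finite) (hne : A.Nonempty) (d : ℝ × ℝ) :
    ∃ i ∈ argmin A (pairing d), ∃ j ∈ argmin A (pairing d),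
      (∀ k ∈ argmin A (pairing d), pairing (rot d) j ≤ pairing (rot d) k ∧
        pairing (rot d) k ≤ pairing (rot d) i) ∧
      edgeWidth A d = pairing (rot d) i - pairing (rot d) j :=
  exists_width_eq (hA.subset (argmin_subset _ _)) (argmin_nonempty hA hne _) (pairing (rot d))

namespace IsProductLike

variable {S S₁ S₂ : Set (ℤ × ℤ)} {φ φ₁ φ₂ : ℤ × ℤ → ℝ}

/-- The sum of two lexicographically extremal points is extremal: there is no cancellation. -/
theorem add_mem_of_extremal (h : IsProductLike S S₁ S₂ φ φ₁ φ₂) {d : ℝ × ℝ} (hd : d ≠ 0)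
    (ψ : ℤ × ℤ → ℝ) (hψ : ∀ u v, ψ (u + v) = ψ u + ψ v)
    (hψ' : ∀ u v, ψ u = ψ v → pairing (rot d) u = pairing (rot d) v)
    {a b : ℤ × ℤ} (ha : a ∈ argmin (argmin S₁ φ₁) (pairing d))
    (hb : b ∈ argmin (argmin S₂ φ₂) (pairing d))
    (ha' : ∀ k ∈ argmin (argmin S₁ φ₁) (pairing d), ψ k ≤ ψ a)
    (hb' : ∀ k ∈ argmin (argmin S₂ φ₂) (pairing d), ψ k ≤ ψ b) :
    a + b ∈ S ∧ φ (a + b) = φ₁ a + φ₂ b := by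
  refine h.of_unique a ha.1.1 b hb.1.1 fun a' ha1 b' hb1 e => ?_
  by_cases hlt : φ₁ a + φ₂ b < φ₁ a' + φ₂ b'
  · exact Or.inr hlt
  left
  push Not at hlt
  have h1 := ha.1.2 a' ha1
  have h2 := hb.1.2 b' hb1
  have ha2 : a' ∈ argmin S₁ φ₁ := mem_argmin_of_eq ha.1 ha1 (by linarith)
  have hb2 : b' ∈ argmin S₂ φ₂ := mem_argmin_of_eq hb.1 hb1 (by linarith)
  have e1 := congrArg (pairing d) e
  rw [pairing_add, pairing_add] at e1
  have h3 := ha.2 a' ha2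
  have h4 := hb.2 b' hb2
  have ha3 := mem_argmin_of_eq ha ha2 (by linarith)
  have hb3 := mem_argmin_of_eq hb hb2 (by linarith)
  have e2 := congrArg ψ e
  rw [hψ, hψ] at e2
  have h5 := ha' a' ha3
  have h6 := hb' b' hb3
  have haa : a' = a := eq_of_pairing_eq hd (by linarith) (hψ' _ _ (by linarith))
  refine ⟨haa, ?_⟩
  rw [haa] at e
  exact add_left_cancel e

theorem add_mem_argmin (h : IsProductLike S S₁ S₂ φ φ₁ φ₂) {a b : ℤ × ℤ} (ha : a ∈ argmin S₁ φ₁)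
    (hb : b ∈ argmin S₂ φ₂) (hab : a + b ∈ S) (he : φ (a + b) = φ₁ a + φ₂ b) :
    a + b ∈ argmin S φ := by
  refine ⟨hab, fun u hu => ?_⟩
  obtain ⟨a', ha', b', hb', -, hle⟩ := h.exists_le u hu
  have h1 := ha.2 a' ha'
  have h2 := hb.2 b' hb'
  linarith

theorem exists_extremal (h : IsProductLike S S₁ S₂ φ φ₁ φ₂) (hS₁ : S₁.Finite) (hS₂ : S₂.Finite)
    (hne₁ : S₁.Nonempty) (hne₂ : S₂.Nonempty) {d : ℝ × ℝ} (hd : d ≠ 0) (ψ : ℤ × ℤ → ℝ)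
    (hψ : ∀ u v, ψ (u + v) = ψ u + ψ v)
    (hψ' : ∀ u v, ψ u = ψ v → pairing (rot d) u = pairing (rot d) v) :
    ∃ a ∈ argmin (argmin S₁ φ₁) (pairing d), ∃ b ∈ argmin (argmin S₂ φ₂) (pairing d),
      (∀ k ∈ argmin (argmin S₁ φ₁) (pairing d), ψ k ≤ ψ a) ∧
      (∀ k ∈ argmin (argmin S₂ φ₂) (pairing d), ψ k ≤ ψ b) ∧ a + b ∈ argmin S φ ∧
      φ (a + b) = φ₁ a + φ₂ b := by
  have hA₁ : (argmin S₁ φ₁).Finite := hS₁.subset (argmin_subset _ _)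
  have hA₂ : (argmin S₂ φ₂).Finite := hS₂.subset (argmin_subset _ _)
  obtain ⟨a, ha, ha'⟩ := Set.exists_max_image _ ψ (hA₁.subset (argmin_subset _ (pairing d)))
    (argmin_nonempty hA₁ (argmin_nonempty hS₁ hne₁ φ₁) _)
  obtain ⟨b, hb, hb'⟩ := Set.exists_max_image _ ψ (hA₂.subset (argmin_subset _ (pairing d)))
    (argmin_nonempty hA₂ (argmin_nonempty hS₂ hne₂ φ₂) _)
  obtain ⟨h1, h2⟩ := h.add_mem_of_extremal hd ψ hψ hψ' ha hb ha' hb'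
  exact ⟨a, ha, b, hb, ha', hb', h.add_mem_argmin ha.1 hb.1 h1 h2, h2⟩

/-- Every active exponent of a product is a sum of active exponents of the factors. -/
theorem exists_add_of_mem_argmin (h : IsProductLike S S₁ S₂ φ φ₁ φ₂) (hS₁ : S₁.Finite)
    (hS₂ : S₂.Finite) (hne₁ : S₁.Nonempty) (hne₂ : S₂.Nonempty) {u : ℤ × ℤ}
    (hu : u ∈ argmin S φ) : ∃ a ∈ argmin S₁ φ₁, ∃ b ∈ argmin S₂ φ₂, u = a + b := by
  obtain ⟨a₀, ha₀, b₀, hb₀, -, -, h1, h2⟩ := h.exists_extremal hS₁ hS₂ hne₁ hne₂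
    (d := (1, 0)) (by simp) (pairing (rot (1, 0))) (pairing_add _) (fun _ _ h => h)
  obtain ⟨a, ha, b, hb, e, hle⟩ := h.exists_le u hu.1
  have h3 := hu.2 _ h1.1
  have h4 := ha₀.1.2 a ha
  have h5 := hb₀.1.2 b hb
  exact ⟨a, mem_argmin_of_eq ha₀.1 ha (by linarith), b, mem_argmin_of_eq hb₀.1 hb (by linarith), e⟩

/-- The support function of the active set of a product is the sum of those of the factors. -/
theorem exists_mem_face (h : IsProductLike S S₁ S₂ φ φ₁ φ₂) (hS₁ : S₁.Finite)
    (hS₂ : S₂.Finite) (hne₁ : S₁.Nonempty) (hne₂ : S₂.Nonempty) {d : ℝ × ℝ} (hd : d ≠ 0)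
    (ψ : ℤ × ℤ → ℝ) (hψ : ∀ u v, ψ (u + v) = ψ u + ψ v)
    (hψ' : ∀ u v, ψ u = ψ v → pairing (rot d) u = pairing (rot d) v) :
    ∃ a ∈ argmin (argmin S₁ φ₁) (pairing d), ∃ b ∈ argmin (argmin S₂ φ₂) (pairing d),
      (∀ k ∈ argmin (argmin S₁ φ₁) (pairing d), ψ k ≤ ψ a) ∧
      (∀ k ∈ argmin (argmin S₂ φ₂) (pairing d), ψ k ≤ ψ b) ∧
      a + b ∈ argmin (argmin S φ) (pairing d) ∧
      ∀ k ∈ argmin (argmin S φ) (pairing d), ψ k ≤ ψ (a + b) := by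
  obtain ⟨a, ha, b, hb, ha', hb', h1, h2⟩ := h.exists_extremal hS₁ hS₂ hne₁ hne₂ hd ψ hψ hψ'
  have hmem : a + b ∈ argmin (argmin S φ) (pairing d) := by
    refine ⟨h1, fun u hu => ?_⟩
    obtain ⟨a', ha1, b', hb1, rfl⟩ := h.exists_add_of_mem_argmin hS₁ hS₂ hne₁ hne₂ hu
    rw [pairing_add, pairing_add]
    exact add_le_add (ha.2 a' ha1) (hb.2 b' hb1)
  refine ⟨a, ha, b, hb, ha', hb', hmem, fun k hk => ?_⟩
  obtain ⟨a', ha1, b', hb1, rfl⟩ := h.exists_add_of_mem_argmin hS₁ hS₂ hne₁ hne₂ hk.1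
  have e := argmin_eq_of_mem hmem hk
  rw [pairing_add, pairing_add] at e
  have h3 := ha.2 a' ha1
  have h4 := hb.2 b' hb1
  rw [hψ, hψ]
  exact add_le_add (ha' a' (mem_argmin_of_eq ha ha1 (by linarith)))
    (hb' b' (mem_argmin_of_eq hb hb1 (by linarith)))

theorem edgeWidth_add (h : IsProductLike S S₁ S₂ φ φ₁ φ₂) (hS₁ : S₁.Finite) (hS₂ : S₂.Finite)
    (hne₁ : S₁.Nonempty) (hne₂ : S₂.Nonempty) {d : ℝ × ℝ} (hd : d ≠ 0) :
    edgeWidth (argmin S φ) d = edgeWidth (argmin S₁ φ₁) d + edgeWidth (argmin S₂ φ₂) d := by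
  obtain ⟨a, ha, b, hb, ha', hb', h1, h2⟩ := h.exists_mem_face hS₁ hS₂ hne₁ hne₂ hd
    (pairing (rot d)) (pairing_add _) (fun _ _ h => h)
  obtain ⟨c, hc, e, he, hc', he', h3, h4⟩ := h.exists_mem_face hS₁ hS₂ hne₁ hne₂ hd
    (fun u => -pairing (rot d) u) (fun u v => by rw [pairing_add]; ring)
    (fun _ _ h => neg_injective h)
  rw [show edgeWidth (argmin S φ) d = _ from width_eq h1 h3
      fun k hk => ⟨neg_le_neg_iff.1 (h4 k hk), h2 k hk⟩,
    show edgeWidth (argmin S₁ φ₁) d = _ from width_eq ha hc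
      fun k hk => ⟨neg_le_neg_iff.1 (hc' k hk), ha' k hk⟩,
    show edgeWidth (argmin S₂ φ₂) d = _ from width_eq hb he
      fun k hk => ⟨neg_le_neg_iff.1 (he' k hk), hb' k hk⟩]
  have e1 := pairing_add (rot d) a b
  have e2 := pairing_add (rot d) c e
  linarith

end IsProductLike

/-! ### Subdivision of parameterized curves -/

namespace ParamCurve

variable (C : ParamCurve)

open Classical in
/-- The cycles of the graph, as functions on the edges. -/
def cycles : Submodule ℚ (C.E → ℚ) where
  carrier := {c | ∀ v, (∑ e, if C.src e = v then c e else 0) = ∑ e, if C.tgt e = v then c e else 0}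
  zero_mem' := by simp
  add_mem' := by
    intro a b ha hb v
    simp only [Pi.add_apply, ite_add_zero, Finset.sum_add_distrib, ha v, hb v]
  smul_mem' := by
    intro r a ha v
    have h : ∀ g : C.E → C.V, (∑ e, if g e = v then (r • a) e else 0) =
        r * ∑ e, if g e = v then a e else 0 := by
      intro g
      rw [Finset.mul_sum]
      exact Finset.sum_congr rfl fun e _ => by split_ifs <;> simp
    rw [h, h, ha v]

open Classical in
theorem boundary_apply (c : C.E →₀ ℚ) (v : C.V) : C.boundary c v =
    (∑ e, if C.tgt e = v then c e else 0) - ∑ e, if C.src e = v then c e else 0 := by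
  have : ∀ g : C.E → C.V, Finsupp.lmapDomain ℚ ℚ g c v = ∑ e, if g e = v then c e else 0 := by
    intro g
    rw [Finsupp.lmapDomain_apply, Finsupp.mapDomain, Finsupp.sum_apply, Finsupp.sum_fintype]
    · refine Finset.sum_congr rfl fun e _ => ?_
      rw [Finsupp.single_apply]
    · simp
  rw [boundary, LinearMap.sub_apply, Finsupp.sub_apply, this, this]

theorem firstBetti_eq : C.firstBetti = Module.finrank ℚ C.cycles := by
  classical
  unfold firstBetti
  refine LinearEquiv.finrank_eq
    ((Finsupp.linearEquivFunOnFinite ℚ ℚ C.E).ofSubmodules _ _ ?_)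
  ext c
  simp only [Submodule.mem_map]
  constructor
  · rintro ⟨x, hx, rfl⟩ v
    have := C.boundary_apply x v
    rw [LinearMap.mem_ker.1 hx] at this
    exact (sub_eq_zero.1 this.symm).symm
  · intro hc
    refine ⟨(Finsupp.linearEquivFunOnFinite ℚ ℚ C.E).symm c, ?_, by simp⟩
    rw [LinearMap.mem_ker]
    ext v
    rw [boundary_apply]
    simpa [sub_eq_zero] using (hc v).symm

/-- The point at parameter `t` on the line that contains an edge. -/
def edgePoint (e : C.E) (t : ℝ) : ℝ × ℝ := C.pos (C.src e) + t • latticeToReal (C.slope e)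

/-- The point at parameter `t` on the line that contains a ray. -/
def rayPoint (r : C.R) (t : ℝ) : ℝ × ℝ := C.pos (C.base r) + t • latticeToReal (C.dir r)

/-- The relative interior of the image of an edge. -/
def openEdge (e : C.E) : Set (ℝ × ℝ) := {x | ∃ t, 0 < t ∧ t < C.len e ∧ x = C.edgePoint e t}

/-- The relative interior of the image of a ray. -/
def openRay (r : C.R) : Set (ℝ × ℝ) := {x | ∃ t, 0 < t ∧ x = C.rayPoint r t}

/-- No edge and no ray is contracted. -/
structure Immersed : Prop where
  slope_ne : ∀ e, C.slope e ≠ 0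
  dir_ne : ∀ r, C.dir r ≠ 0

/-- The points of `P` do not lie in the relative interior of an edge or a ray. -/
structure SubdividedAt (P : Set (ℝ × ℝ)) : Prop where
  edge : ∀ e, ∀ x ∈ P, x ∉ C.openEdge e
  ray : ∀ r, ∀ x ∈ P, x ∉ C.openRay r

theorem _root_.latticeToReal_ne_zero {u : ℤ × ℤ} (hu : u ≠ 0) : latticeToReal u ≠ 0 := by
  intro h
  apply hu
  have h1 := congrArg Prod.fst h
  have h2 := congrArg Prod.snd h
  simp only [latticeToReal, Prod.fst_zero, Prod.snd_zero, Int.cast_eq_zero] at h1 h2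
  exact Prod.ext h1 h2

variable {C} in
theorem Immersed.edgePoint_inj (hC : C.Immersed) (e : C.E) {s t : ℝ}
    (h : C.edgePoint e s = C.edgePoint e t) : s = t :=
  smul_left_injective ℝ (latticeToReal_ne_zero (hC.slope_ne e)) (add_left_cancel h)

variable {C} in
theorem Immersed.rayPoint_inj (hC : C.Immersed) (r : C.R) {s t : ℝ}
    (h : C.rayPoint r s = C.rayPoint r t) : s = t :=
  smul_left_injective ℝ (latticeToReal_ne_zero (hC.dir_ne r)) (add_left_cancel h)

theorem edgePoint_len (e : C.E) : C.edgePoint e (C.len e) = C.pos (C.tgt e) := (C.pos_tgt e).symm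

theorem edgePoint_zero (e : C.E) : C.edgePoint e 0 = C.pos (C.src e) := by simp [edgePoint]

theorem rayPoint_zero (r : C.R) : C.rayPoint r 0 = C.pos (C.base r) := by simp [rayPoint]

theorem mem_edgeImage_iff (e : C.E) (x : ℝ × ℝ) :
    x ∈ C.edgeImage e ↔ ∃ t, 0 ≤ t ∧ t ≤ C.len e ∧ x = C.edgePoint e t := by
  have hl := C.len_pos e
  rw [edgeImage, segment_eq_image', C.pos_tgt e]
  simp only [Set.mem_image, Set.mem_Icc, add_sub_cancel_left, edgePoint]
  constructor
  · rintro ⟨θ, ⟨h0, h1⟩, rfl⟩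
    exact ⟨θ * C.len e, by positivity, by nlinarith, by rw [smul_smul]⟩
  · rintro ⟨t, h0, h1, rfl⟩
    refine ⟨t / C.len e, ⟨by positivity, (div_le_one hl).2 h1⟩, ?_⟩
    rw [smul_smul, div_mul_cancel₀ _ hl.ne']

theorem mem_rayImage_iff (r : C.R) (x : ℝ × ℝ) :
    x ∈ C.rayImage r ↔ ∃ t, 0 ≤ t ∧ x = C.rayPoint r t := Iff.rfl

theorem mem_image_iff (x : ℝ × ℝ) : x ∈ C.image ↔
    x ∈ Set.range C.pos ∨ (∃ e, x ∈ C.edgeImage e) ∨ ∃ r, x ∈ C.rayImage r := by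
  simp only [image, Set.mem_union, Set.mem_iUnion, or_assoc]

/-! #### Removing contracted edges -/

theorem sum_subtype_of_eq_zero {E M : Type*} [Fintype E] [AddCommMonoid M] (p : E → Prop)
    [Fintype {e // p e}] (F : E → M) (h : ∀ e, ¬ p e → F e = 0) :
    ∑ e : {e // p e}, F e = ∑ e, F e := by
  classical
  rw [← Finset.sum_subtype (Finset.univ.filter p) (by simp) F]
  exact Finset.sum_filter_of_ne fun e _ hne => by_contra fun hp => hne (h e hp)

open Classical in
/-- The parameterized curve without its contracted edges and rays. -/
def removeContracted : ParamCurve where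
  V := C.V
  E := {e : C.E // C.slope e ≠ 0}
  R := {r : C.R // C.dir r ≠ 0}
  src e := C.src e
  tgt e := C.tgt e
  base r := C.base r
  len e := C.len e
  len_pos e := C.len_pos e
  pos := C.pos
  slope e := C.slope e
  dir r := C.dir r
  pos_tgt e := C.pos_tgt e
  balanced v := by
    refine Eq.trans ?_ (C.balanced v)
    have h1 : ∀ g : C.E → C.V, (∑ e : {e : C.E // C.slope e ≠ 0}, if g e = v then C.slope e else 0)
        = ∑ e, if g e = v then C.slope e else 0 := fun g =>
      sum_subtype_of_eq_zero (fun e => C.slope e ≠ 0) (fun e => if g e = v then C.slope e else 0) (by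
        intro e he
        simp [not_not.1 he])
    have h2 : (∑ r : {r : C.R // C.dir r ≠ 0}, if C.base r = v then C.dir r else 0)
        = ∑ r, if C.base r = v then C.dir r else 0 :=
      sum_subtype_of_eq_zero (fun r => C.dir r ≠ 0) (fun r => if C.base r = v then C.dir r else 0) (by
        intro r hr
        simp [not_not.1 hr])
    rw [h1, h1, h2]

theorem removeContracted_immersed : C.removeContracted.Immersed :=
  ⟨fun e => e.2, fun r => r.2⟩

theorem _root_.latticeLength_zero : latticeLength 0 = 0 := by simp [latticeLength]

theorem Parameterizes.removeContracted {C : ParamCurve} {Γ : WeightedSet}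
    (h : C.Parameterizes Γ) : C.removeContracted.Parameterizes Γ := by
  classical
  obtain ⟨h1, F, hF, h2⟩ := h
  refine ⟨?_, F, hF, ?_⟩
  · rw [← h1]
    ext x
    rw [mem_image_iff, mem_image_iff]
    constructor
    · rintro (h | ⟨e, he⟩ | ⟨r, hr⟩)
      · exact Or.inl h
      · exact Or.inr (Or.inl ⟨e.1, he⟩)
      · exact Or.inr (Or.inr ⟨r.1, hr⟩)
    · rintro (h | ⟨e, he⟩ | ⟨r, hr⟩)
      · exact Or.inl h
      · by_cases h0 : C.slope e = 0
        · left
          obtain ⟨t, -, -, rfl⟩ := (C.mem_edgeImage_iff e x).1 he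
          exact ⟨C.src e, by simp [edgePoint, h0, latticeToReal, ParamCurve.removeContracted]⟩
        · exact Or.inr (Or.inl ⟨⟨e, h0⟩, he⟩)
      · by_cases h0 : C.dir r = 0
        · left
          obtain ⟨t, -, rfl⟩ := hr
          exact ⟨C.base r, by simp [h0, latticeToReal, ParamCurve.removeContracted]⟩
        · exact Or.inr (Or.inr ⟨⟨r, h0⟩, hr⟩)
  · intro p hp
    rw [← h2 p hp]
    unfold inducedWeight
    congr 1
    · exact sum_subtype_of_eq_zero (fun e => C.slope e ≠ 0)
        (fun e => if p ∈ C.edgeImage e then latticeLength (C.slope e) else 0) (by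
          intro e he
          simp [not_not.1 he, latticeLength_zero])
    · exact sum_subtype_of_eq_zero (fun r => C.dir r ≠ 0)
        (fun r => if p ∈ C.rayImage r then latticeLength (C.dir r) else 0) (by
          intro r hr
          simp [not_not.1 hr, latticeLength_zero])

theorem removeContracted_firstBetti_le : C.removeContracted.firstBetti ≤ C.firstBetti := by
  classical
  rw [firstBetti_eq, firstBetti_eq]
  -- a cycle is extended by zero to the contracted edges
  let L : (C.removeContracted.E → ℚ) →ₗ[ℚ] (C.E → ℚ) :=
    { toFun := fun c e => if h : C.slope e ≠ 0 then c ⟨e, h⟩ else 0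
      map_add' := by
        intro a b
        ext e
        by_cases h : C.slope e ≠ 0
        · simp only [Pi.add_apply, dif_pos h]; rfl
        · simp only [Pi.add_apply, dif_neg h, add_zero]
      map_smul' := by
        intro a b
        ext e
        by_cases h : C.slope e ≠ 0
        · simp only [Pi.smul_apply, dif_pos h]; rfl
        · simp only [Pi.smul_apply, dif_neg h, smul_zero] }
  have hLpos : ∀ c (e : C.E) (h : C.slope e ≠ 0), L c e = c ⟨e, h⟩ := fun c e h => dif_pos h
  have hLneg : ∀ c (e : C.E) (_ : ¬ C.slope e ≠ 0), L c e = 0 := fun c e h => dif_neg h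
  have hL : ∀ c ∈ C.removeContracted.cycles, L c ∈ C.cycles := by
    intro c hc v
    have key : ∀ g : C.E → C.V, (∑ e, if g e = v then L c e else 0) =
        ∑ e : C.removeContracted.E, if g e.1 = v then c e else 0 := by
      intro g
      refine Eq.trans (sum_subtype_of_eq_zero (fun e => C.slope e ≠ 0)
        (fun e => if g e = v then L c e else 0) ?_).symm ?_
      · intro e he
        rw [hLneg c e he, ite_self]
      · refine Finset.sum_congr (by congr!) fun e _ => ?_
        rw [hLpos c e e.2]
    rw [key, key]
    exact hc v
  refine LinearMap.finrank_le_finrank_of_injective (f := L.restrict hL) ?_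
  rintro ⟨a, ha⟩ ⟨b, hb⟩ hab
  refine Subtype.ext (funext fun e => ?_)
  have : L a e.1 = L b e.1 := congrFun (congrArg Subtype.val hab) e.1
  rw [hLpos a e.1 e.2, hLpos b e.1 e.2] at this
  exact this

/-! #### Subdividing an edge or a ray -/

theorem sum_ite_update {E V' M : Type*} [Fintype E] [DecidableEq E] [DecidableEq V']
    [AddCommGroup M] (e₀ : E) (g : E → V')
    (F : E → M) (v : V') (x : V') (hx : x ≠ v) :
    (∑ e, if (if e = e₀ then x else g e) = v then F e else 0) =
      (∑ e, if g e = v then F e else 0) - if g e₀ = v then F e₀ else 0 := by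
  rw [eq_sub_iff_add_eq, ← Finset.sum_erase_add _ _ (Finset.mem_univ e₀),
    ← Finset.sum_erase_add Finset.univ (fun e => if g e = v then F e else 0) (Finset.mem_univ e₀)]
  simp only [if_true, if_neg hx, add_zero]
  congr 1
  refine Finset.sum_congr rfl fun e he => ?_
  rw [if_neg (Finset.ne_of_mem_erase he)]

theorem sum_ite_update_self {E V' M : Type*} [Fintype E] [DecidableEq E] [DecidableEq V']
    [AddCommGroup M] (e₀ : E) (g : E → V')
    (F : E → M) (v : V') (hg : ∀ e, g e ≠ v) :
    (∑ e, if (if e = e₀ then v else g e) = v then F e else 0) = F e₀ := by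
  rw [Finset.sum_eq_single e₀] <;> simp +contextual [hg]

open Classical in
/-- The parameterized curve in which the edge `e₀` has been subdivided at the parameter `s`. -/
def subdivideEdge (e₀ : C.E) (s : ℝ) (hs : 0 < s) (hs' : s < C.len e₀) : ParamCurve where
  V := Option C.V
  E := Option C.E
  R := C.R
  src e := e.elim none (fun e => some (C.src e))
  tgt e := e.elim (some (C.tgt e₀)) (fun e => if e = e₀ then none else some (C.tgt e))
  base r := some (C.base r)
  len e := e.elim (C.len e₀ - s) (fun e => if e = e₀ then s else C.len e)
  len_pos e := by
    cases e with
    | none => simpa using hs'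
    | some e => simp only [Option.elim]; split_ifs; exacts [hs, C.len_pos e]
  pos v := v.elim (C.edgePoint e₀ s) C.pos
  slope e := e.elim (C.slope e₀) C.slope
  dir := C.dir
  pos_tgt e := by
    cases e with
    | none =>
      simp only [Option.elim, edgePoint]
      rw [C.pos_tgt, add_assoc, ← add_smul, add_sub_cancel]
    | some e =>
      simp only [Option.elim]
      split_ifs with h
      · rw [h]; rfl
      · exact C.pos_tgt e
  balanced v := by
    refine Eq.trans (congrArg₂ (· + ·) (congrArg₂ (· - ·) (Fintype.sum_option _)
      (Fintype.sum_option _)) rfl) ?_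
    have : ((if none = v then C.slope e₀ else 0) + ∑ e, if some (C.src e) = v then C.slope e else 0)
      - ((if some (C.tgt e₀) = v then C.slope e₀ else 0) +
        ∑ e, if (if e = e₀ then none else some (C.tgt e)) = v then C.slope e else 0)
      + (∑ r, if some (C.base r) = v then C.dir r else 0) = 0 := by
      cases v with
      | none =>
        rw [sum_ite_update_self e₀ (fun e => some (C.tgt e)) C.slope none (by simp)]
        simp
      | some v =>
        rw [sum_ite_update e₀ (fun e => some (C.tgt e)) C.slope (some v) none (by simp)]
        refine Eq.trans ?_ (C.balanced v)
        simp only [Option.some.injEq, reduceCtorEq, if_false]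
        abel
    convert this <;> rfl

open Classical in
/-- The parameterized curve in which the ray `r₀` has been subdivided at the parameter `s`. -/
def subdivideRay (r₀ : C.R) (s : ℝ) (hs : 0 < s) : ParamCurve where
  V := Option C.V
  E := Option C.E
  R := C.R
  src e := e.elim (some (C.base r₀)) (fun e => some (C.src e))
  tgt e := e.elim none (fun e => some (C.tgt e))
  base r := if r = r₀ then none else some (C.base r)
  len e := e.elim s C.len
  len_pos e := by
    cases e with
    | none => exact hs
    | some e => exact C.len_pos e
  pos v := v.elim (C.rayPoint r₀ s) C.pos
  slope e := e.elim (C.dir r₀) C.slope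
  dir := C.dir
  pos_tgt e := by
    cases e with
    | none => rfl
    | some e => exact C.pos_tgt e
  balanced v := by
    refine Eq.trans (congrArg₂ (· + ·) (congrArg₂ (· - ·) (Fintype.sum_option _)
      (Fintype.sum_option _)) rfl) ?_
    have : ((if some (C.base r₀) = v then C.dir r₀ else 0) +
        ∑ e, if some (C.src e) = v then C.slope e else 0)
      - ((if none = v then C.dir r₀ else 0) + ∑ e, if some (C.tgt e) = v then C.slope e else 0)
      + (∑ r, if (if r = r₀ then none else some (C.base r)) = v then C.dir r else 0) = 0 := by
      cases v with
      | none =>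
        rw [sum_ite_update_self r₀ (fun r => some (C.base r)) C.dir none (by simp)]
        simp
      | some v =>
        rw [sum_ite_update r₀ (fun r => some (C.base r)) C.dir (some v) none (by simp)]
        refine Eq.trans ?_ (C.balanced v)
        simp only [Option.some.injEq, reduceCtorEq, if_false]
        abel
    convert this <;> rfl

end ParamCurve

namespace ParamCurve

variable (C : ParamCurve)

/-- The parameterized curve `D` is a subdivision of `C` at the point `p`: a piece of curve (an edge
or a ray) through `p` is replaced by two pieces. -/
structure IsSubdivisionAt (D : ParamCurve) (p : ℝ × ℝ) : Prop where
  immersed : C.Immersed → D.Immersed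
  betti : D.firstBetti ≤ C.firstBetti
  range_pos : Set.range D.pos = insert p (Set.range C.pos)
  mem_image : ∀ x, x ∈ D.image ↔ x ∈ C.image
  weight : C.Immersed → ∀ x, x ≠ p → D.inducedWeight x = C.inducedWeight x

open Classical in
/-- The number of incidences of the points of `P` with the relative interiors of the edges and
rays. -/
def incidences (P : Finset (ℝ × ℝ)) : ℕ :=
  (∑ e, (P.filter (· ∈ C.openEdge e)).card) + ∑ r, (P.filter (· ∈ C.openRay r)).card

section SubdivideEdge

variable (e₀ : C.E) (s : ℝ) (hs : 0 < s) (hs' : s < C.len e₀)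

/-- The edge of the subdivision that comes from an edge `e`; for `e = e₀`, the first half of `e₀`. -/
def subdivideEdgeOld (e : C.E) : (C.subdivideEdge e₀ s hs hs').E := some e

/-- The second half of the edge `e₀`. -/
def subdivideEdgeNew : (C.subdivideEdge e₀ s hs hs').E := none

local notation "D" => C.subdivideEdge e₀ s hs hs'
local notation "old" => C.subdivideEdgeOld e₀ s hs hs'
local notation "new" => C.subdivideEdgeNew e₀ s hs hs'

theorem subdivideEdge_sum {M : Type*} [AddCommMonoid M] (F : (D).E → M) :
    ∑ e, F e = F new + ∑ e, F (old e) := Fintype.sum_option F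

theorem subdivideEdge_forall {p : (D).E → Prop} : (∀ e, p e) ↔ p new ∧ ∀ e, p (old e) :=
  Option.forall

theorem subdivideEdge_exists {p : (D).E → Prop} : (∃ e, p e) ↔ p new ∨ ∃ e, p (old e) :=
  Option.exists

theorem subdivideEdge_len_old_self : (D).len (old e₀) = s := if_pos rfl

theorem subdivideEdge_len_old {e : C.E} (he : e ≠ e₀) : (D).len (old e) = C.len e := if_neg he

theorem subdivideEdge_edgePoint_new (t : ℝ) : (D).edgePoint new t = C.edgePoint e₀ (s + t) := by
  change C.pos (C.src e₀) + s • latticeToReal (C.slope e₀) + t • latticeToReal (C.slope e₀) = _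
  rw [edgePoint, add_smul, add_assoc]

theorem subdivideEdge_edgeImage_old {e : C.E} (he : e ≠ e₀) :
    (D).edgeImage (old e) = C.edgeImage e := by
  ext x
  rw [mem_edgeImage_iff, mem_edgeImage_iff, subdivideEdge_len_old C e₀ s hs hs' he]
  rfl

theorem subdivideEdge_openEdge_old {e : C.E} (he : e ≠ e₀) :
    (D).openEdge (old e) = C.openEdge e := by
  unfold openEdge
  rw [subdivideEdge_len_old C e₀ s hs hs' he]
  rfl

theorem mem_subdivideEdge_edgeImage_old_self (x : ℝ × ℝ) :
    x ∈ (D).edgeImage (old e₀) ↔ ∃ t, 0 ≤ t ∧ t ≤ s ∧ x = C.edgePoint e₀ t := by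
  rw [mem_edgeImage_iff, subdivideEdge_len_old_self]
  rfl

theorem mem_subdivideEdge_edgeImage_new (x : ℝ × ℝ) :
    x ∈ (D).edgeImage new ↔ ∃ t, s ≤ t ∧ t ≤ C.len e₀ ∧ x = C.edgePoint e₀ t := by
  rw [mem_edgeImage_iff]
  constructor
  · rintro ⟨t, h0, h1, rfl⟩
    change t ≤ C.len e₀ - s at h1
    exact ⟨s + t, by linarith, by linarith, subdivideEdge_edgePoint_new ..⟩
  · rintro ⟨t, h0, h1, rfl⟩
    refine ⟨t - s, by linarith, ?_, ?_⟩
    · change t - s ≤ C.len e₀ - s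
      linarith
    · rw [subdivideEdge_edgePoint_new, add_sub_cancel]

theorem mem_edgeImage_iff_subdivideEdge (x : ℝ × ℝ) : x ∈ C.edgeImage e₀ ↔
    x ∈ (D).edgeImage new ∨ x ∈ (D).edgeImage (old e₀) := by
  rw [mem_edgeImage_iff, mem_subdivideEdge_edgeImage_old_self, mem_subdivideEdge_edgeImage_new]
  constructor
  · rintro ⟨t, h0, h1, rfl⟩
    rcases le_total t s with h | h
    · exact Or.inr ⟨t, h0, h, rfl⟩
    · exact Or.inl ⟨t, h, h1, rfl⟩
  · rintro (⟨t, h0, h1, rfl⟩ | ⟨t, h0, h1, rfl⟩)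
    · exact ⟨t, by linarith, h1, rfl⟩
    · exact ⟨t, h0, by linarith, rfl⟩

theorem subdivideEdge_firstBetti_le : (D).firstBetti ≤ C.firstBetti := by
  classical
  rw [firstBetti_eq, firstBetti_eq]
  let L : ((D).E → ℚ) →ₗ[ℚ] (C.E → ℚ) := LinearMap.funLeft ℚ ℚ old
  have hcyc : ∀ c ∈ (D).cycles, ∀ v : Option C.V,
      (if none = v then c new else 0) + (∑ e, if some (C.src e) = v then c (old e) else 0) =
      (if some (C.tgt e₀) = v then c new else 0) +
        ∑ e, if (if e = e₀ then none else some (C.tgt e)) = v then c (old e) else 0 := by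
    intro c hc v
    have := hc v
    rw [subdivideEdge_sum, subdivideEdge_sum] at this
    convert this <;> rfl
  have hnew : ∀ c ∈ (D).cycles, c new = c (old e₀) := by
    intro c hc
    have := hcyc c hc none
    rw [sum_ite_update_self e₀ (fun e => some (C.tgt e)) (fun e => c (old e)) none (by simp)] at this
    simpa using this
  have hL : ∀ c ∈ (D).cycles, L c ∈ C.cycles := by
    intro c hc v
    have := hcyc c hc (some v)
    rw [sum_ite_update e₀ (fun e => some (C.tgt e)) (fun e => c (old e)) (some v) none (by simp),
      hnew c hc] at this
    simp only [Option.some.injEq, reduceCtorEq, if_false, zero_add, add_sub_cancel] at this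
    exact this
  refine LinearMap.finrank_le_finrank_of_injective (f := L.restrict hL) ?_
  rintro ⟨a, ha⟩ ⟨b, hb⟩ hab
  have hold : ∀ e, a (old e) = b (old e) := fun e => congrFun (congrArg Subtype.val hab) e
  refine Subtype.ext (funext ((subdivideEdge_forall C e₀ s hs hs').2 ⟨?_, hold⟩))
  change a new = b new
  rw [hnew a ha, hnew b hb, hold]

theorem subdivideEdge_inducedWeight (hC : C.Immersed) {x : ℝ × ℝ} (hx : x ≠ C.edgePoint e₀ s) :
    (D).inducedWeight x = C.inducedWeight x := by
  classical
  unfold inducedWeight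
  rw [subdivideEdge_sum]
  refine congrArg₂ (· + ·) ?_ rfl
  rw [← Finset.add_sum_erase _ _ (Finset.mem_univ e₀),
    ← Finset.add_sum_erase Finset.univ (fun e => if x ∈ C.edgeImage e then _ else _)
      (Finset.mem_univ e₀), ← add_assoc]
  refine congrArg₂ (· + ·) ?_ (Finset.sum_congr rfl fun e he => ?_)
  · change (if x ∈ (D).edgeImage new then latticeLength (C.slope e₀) else 0) +
      (if x ∈ (D).edgeImage (old e₀) then latticeLength (C.slope e₀) else 0) = _
    by_cases h1 : x ∈ (D).edgeImage new <;> by_cases h2 : x ∈ (D).edgeImage (old e₀) <;>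
      simp only [h1, h2, if_true, if_false, mem_edgeImage_iff_subdivideEdge C e₀ s hs hs', or_self,
        or_true, true_or, add_zero, zero_add]
    exfalso
    obtain ⟨t, ht, -, e⟩ := (C.mem_subdivideEdge_edgeImage_new e₀ s hs hs' x).1 h1
    obtain ⟨t', -, ht', e'⟩ := (C.mem_subdivideEdge_edgeImage_old_self e₀ s hs hs' x).1 h2
    have := hC.edgePoint_inj e₀ (e.symm.trans e')
    exact hx (by rw [e, show t = s by linarith])
  · rw [subdivideEdge_edgeImage_old C e₀ s hs hs' (Finset.ne_of_mem_erase he)]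
    rfl

theorem subdivideEdge_isSubdivisionAt : C.IsSubdivisionAt (D) (C.edgePoint e₀ s) where
  immersed h := ⟨(subdivideEdge_forall C e₀ s hs hs').2 ⟨h.1 e₀, h.1⟩, h.2⟩
  betti := C.subdivideEdge_firstBetti_le e₀ s hs hs'
  range_pos := by
    ext x
    refine Option.exists.trans (or_congr ?_ Iff.rfl)
    exact eq_comm
  mem_image x := by
    rw [mem_image_iff, mem_image_iff, subdivideEdge_exists]
    have hp : C.edgePoint e₀ s ∈ C.edgeImage e₀ := (C.mem_edgeImage_iff _ _).2 ⟨s, hs.le, hs'.le, rfl⟩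
    have hr : ∀ r, x ∈ (D).rayImage r ↔ x ∈ C.rayImage r := fun r => Iff.rfl
    constructor
    · rintro (⟨v, rfl⟩ | (h | ⟨e, he⟩) | ⟨r, h⟩)
      · cases v with
        | none => exact Or.inr (Or.inl ⟨e₀, hp⟩)
        | some v => exact Or.inl ⟨v, rfl⟩
      · exact Or.inr (Or.inl ⟨e₀, (C.mem_edgeImage_iff_subdivideEdge e₀ s hs hs' x).2 (Or.inl h)⟩)
      · by_cases h0 : e = e₀
        · subst h0
          exact Or.inr (Or.inl ⟨e, (C.mem_edgeImage_iff_subdivideEdge e s hs hs' x).2 (Or.inr he)⟩)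
        · rw [subdivideEdge_edgeImage_old C e₀ s hs hs' h0] at he
          exact Or.inr (Or.inl ⟨e, he⟩)
      · exact Or.inr (Or.inr ⟨r, h⟩)
    · rintro (⟨v, rfl⟩ | ⟨e, he⟩ | ⟨r, h⟩)
      · exact Or.inl ⟨some v, rfl⟩
      · by_cases h0 : e = e₀
        · subst h0
          rcases (C.mem_edgeImage_iff_subdivideEdge e s hs hs' x).1 he with h | h
          · exact Or.inr (Or.inl (Or.inl h))
          · exact Or.inr (Or.inl (Or.inr ⟨e, h⟩))
        · exact Or.inr (Or.inl (Or.inr ⟨e, by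
            rwa [subdivideEdge_edgeImage_old C e₀ s hs hs' h0]⟩))
      · exact Or.inr (Or.inr ⟨r, h⟩)
  weight hC x hx := C.subdivideEdge_inducedWeight e₀ s hs hs' hC hx

/-- Subdividing at a point of `P` takes at least one incidence of `P` with the open edges away; this
is what makes the subdivision at all points of `P` terminate. -/
theorem subdivideEdge_incidences_lt (hC : C.Immersed) {P : Finset (ℝ × ℝ)}
    (hP : C.edgePoint e₀ s ∈ P) : (D).incidences P < C.incidences P := by
  classical
  unfold incidences
  rw [subdivideEdge_sum]
  refine Nat.add_lt_add_of_lt_of_le ?_ le_rfl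
  rw [← Finset.add_sum_erase _ _ (Finset.mem_univ e₀),
    ← Finset.add_sum_erase Finset.univ (fun e => (P.filter (· ∈ C.openEdge e)).card)
      (Finset.mem_univ e₀), ← add_assoc]
  refine Nat.add_lt_add_of_lt_of_le ?_ (Finset.sum_le_sum fun e he => ?_)
  · rw [← Finset.card_union_of_disjoint]
    · refine Finset.card_lt_card ⟨?_, fun hsub => ?_⟩
      · intro x hx
        simp only [Finset.mem_union, Finset.mem_filter] at hx ⊢
        rcases hx with ⟨hx, t, h0, h1, rfl⟩ | ⟨hx, t, h0, h1, rfl⟩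
        · change t < C.len e₀ - s at h1
          exact ⟨hx, s + t, by linarith, by linarith, subdivideEdge_edgePoint_new ..⟩
        · rw [subdivideEdge_len_old_self] at h1
          exact ⟨hx, t, h0, by linarith, rfl⟩
      · have : C.edgePoint e₀ s ∈ P.filter (· ∈ C.openEdge e₀) := by
          simp only [Finset.mem_filter]
          exact ⟨hP, s, hs, hs', rfl⟩
        have := hsub this
        simp only [Finset.mem_union, Finset.mem_filter] at this
        rcases this with ⟨-, t, h0, h1, e⟩ | ⟨-, t, h0, h1, e⟩
        · rw [subdivideEdge_edgePoint_new] at e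
          have := hC.edgePoint_inj e₀ e
          linarith
        · rw [subdivideEdge_len_old_self] at h1
          have := hC.edgePoint_inj e₀ e
          linarith
    · rw [Finset.disjoint_left]
      intro x hx hx'
      simp only [Finset.mem_filter] at hx hx'
      obtain ⟨-, t, h0, h1, e⟩ := hx
      obtain ⟨-, t', h0', h1', e'⟩ := hx'
      rw [subdivideEdge_edgePoint_new] at e
      rw [subdivideEdge_len_old_self] at h1'
      have := hC.edgePoint_inj e₀ (e.symm.trans e')
      linarith
  · rw [subdivideEdge_openEdge_old C e₀ s hs hs' (Finset.ne_of_mem_erase he)]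

end SubdivideEdge

end ParamCurve

namespace ParamCurve

variable (C : ParamCurve)

section SubdivideRay

variable (r₀ : C.R) (s : ℝ) (hs : 0 < s)

/-- The edge of the subdivision of a ray that comes from an edge `e`. -/
def subdivideRayOld (e : C.E) : (C.subdivideRay r₀ s hs).E := some e

/-- The bounded part of the ray `r₀`. -/
def subdivideRayNew : (C.subdivideRay r₀ s hs).E := none

/-- The ray of the subdivision that comes from a ray `r`; for `r = r₀`, the unbounded part of
`r₀`. -/
def subdivideRayRay (r : C.R) : (C.subdivideRay r₀ s hs).R := r

local notation "D" => C.subdivideRay r₀ s hs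
local notation "old" => C.subdivideRayOld r₀ s hs
local notation "new" => C.subdivideRayNew r₀ s hs
local notation "ray" => C.subdivideRayRay r₀ s hs

theorem subdivideRay_sum {M : Type*} [AddCommMonoid M] (F : (D).E → M) :
    ∑ e, F e = F new + ∑ e, F (old e) := Fintype.sum_option F

theorem subdivideRay_sum_ray {M : Type*} [AddCommMonoid M] (F : (D).R → M) :
    ∑ r, F r = ∑ r, F (ray r) := rfl

theorem subdivideRay_forall {p : (D).E → Prop} : (∀ e, p e) ↔ p new ∧ ∀ e, p (old e) :=
  Option.forall

theorem subdivideRay_exists {p : (D).E → Prop} : (∃ e, p e) ↔ p new ∨ ∃ e, p (old e) :=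
  Option.exists

open Classical in
theorem subdivideRay_pos_base_self : (D).pos ((D).base (ray r₀)) = C.rayPoint r₀ s := by
  change Option.elim (if r₀ = r₀ then none else some (C.base r₀)) (C.rayPoint r₀ s) C.pos = _
  rw [if_pos rfl]
  rfl

open Classical in
theorem subdivideRay_pos_base {r : C.R} (hr : r ≠ r₀) :
    (D).pos ((D).base (ray r)) = C.pos (C.base r) := by
  change Option.elim (if r = r₀ then none else some (C.base r)) (C.rayPoint r₀ s) C.pos = _
  rw [if_neg hr]
  rfl

theorem subdivideRay_rayPoint_self (t : ℝ) : (D).rayPoint (ray r₀) t = C.rayPoint r₀ (s + t) := by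
  rw [rayPoint, subdivideRay_pos_base_self, rayPoint, rayPoint, add_smul, add_assoc]
  rfl

theorem subdivideRay_rayPoint {r : C.R} (hr : r ≠ r₀) (t : ℝ) :
    (D).rayPoint (ray r) t = C.rayPoint r t := by
  rw [rayPoint, subdivideRay_pos_base C r₀ s hs hr]
  rfl

theorem subdivideRay_rayImage {r : C.R} (hr : r ≠ r₀) :
    (D).rayImage (ray r) = C.rayImage r := by
  ext x
  simp only [mem_rayImage_iff, subdivideRay_rayPoint C r₀ s hs hr]

theorem subdivideRay_openRay {r : C.R} (hr : r ≠ r₀) :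
    (D).openRay (ray r) = C.openRay r := by
  unfold openRay
  simp only [subdivideRay_rayPoint C r₀ s hs hr]

theorem mem_subdivideRay_rayImage_self (x : ℝ × ℝ) :
    x ∈ (D).rayImage (ray r₀) ↔ ∃ t, s ≤ t ∧ x = C.rayPoint r₀ t := by
  rw [mem_rayImage_iff]
  constructor
  · rintro ⟨t, h0, rfl⟩
    exact ⟨s + t, by linarith, subdivideRay_rayPoint_self ..⟩
  · rintro ⟨t, h0, rfl⟩
    exact ⟨t - s, by linarith, by rw [subdivideRay_rayPoint_self, add_sub_cancel]⟩

theorem mem_subdivideRay_edgeImage_new (x : ℝ × ℝ) :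
    x ∈ (D).edgeImage new ↔ ∃ t, 0 ≤ t ∧ t ≤ s ∧ x = C.rayPoint r₀ t := by
  rw [mem_edgeImage_iff]
  rfl

theorem mem_rayImage_iff_subdivideRay (x : ℝ × ℝ) : x ∈ C.rayImage r₀ ↔
    x ∈ (D).edgeImage new ∨ x ∈ (D).rayImage (ray r₀) := by
  rw [mem_rayImage_iff, mem_subdivideRay_rayImage_self, mem_subdivideRay_edgeImage_new]
  constructor
  · rintro ⟨t, h0, rfl⟩
    rcases le_total t s with h | h
    · exact Or.inl ⟨t, h0, h, rfl⟩
    · exact Or.inr ⟨t, h, rfl⟩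
  · rintro (⟨t, h0, h1, rfl⟩ | ⟨t, h0, rfl⟩)
    · exact ⟨t, h0, rfl⟩
    · exact ⟨t, by linarith, rfl⟩

theorem subdivideRay_firstBetti_le : (D).firstBetti ≤ C.firstBetti := by
  classical
  rw [firstBetti_eq, firstBetti_eq]
  let L : ((D).E → ℚ) →ₗ[ℚ] (C.E → ℚ) := LinearMap.funLeft ℚ ℚ old
  have hcyc : ∀ c ∈ (D).cycles, ∀ v : Option C.V,
      (if some (C.base r₀) = v then c new else 0) +
        (∑ e, if some (C.src e) = v then c (old e) else 0) =
      (if none = v then c new else 0) + ∑ e, if some (C.tgt e) = v then c (old e) else 0 := by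
    intro c hc v
    have := hc v
    rw [subdivideRay_sum, subdivideRay_sum] at this
    convert this <;> rfl
  have hnew : ∀ c ∈ (D).cycles, c new = 0 := by
    intro c hc
    have := hcyc c hc none
    simpa using this.symm
  have hL : ∀ c ∈ (D).cycles, L c ∈ C.cycles := by
    intro c hc v
    have := hcyc c hc (some v)
    rw [hnew c hc] at this
    simp only [Option.some.injEq, ite_self, zero_add] at this
    exact this
  refine LinearMap.finrank_le_finrank_of_injective (f := L.restrict hL) ?_
  rintro ⟨a, ha⟩ ⟨b, hb⟩ hab
  have hold : ∀ e, a (old e) = b (old e) := fun e => congrFun (congrArg Subtype.val hab) e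
  refine Subtype.ext (funext ((subdivideRay_forall C r₀ s hs).2 ⟨?_, hold⟩))
  change a new = b new
  rw [hnew a ha, hnew b hb]

theorem subdivideRay_inducedWeight (hC : C.Immersed) {x : ℝ × ℝ} (hx : x ≠ C.rayPoint r₀ s) :
    (D).inducedWeight x = C.inducedWeight x := by
  classical
  unfold inducedWeight
  rw [subdivideRay_sum, subdivideRay_sum_ray, add_comm (ite _ _ _), add_assoc]
  refine congrArg₂ (· + ·) rfl ?_
  rw [← Finset.add_sum_erase _ _ (Finset.mem_univ r₀),
    ← Finset.add_sum_erase Finset.univ (fun r => if x ∈ C.rayImage r then _ else _)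
      (Finset.mem_univ r₀), ← add_assoc]
  refine congrArg₂ (· + ·) ?_ (Finset.sum_congr rfl fun r hr => ?_)
  · change (if x ∈ (D).edgeImage new then latticeLength (C.dir r₀) else 0) +
      (if x ∈ (D).rayImage (ray r₀) then latticeLength (C.dir r₀) else 0) = _
    by_cases h1 : x ∈ (D).edgeImage new <;> by_cases h2 : x ∈ (D).rayImage (ray r₀) <;>
      simp only [h1, h2, if_true, if_false, mem_rayImage_iff_subdivideRay C r₀ s hs, or_self,
        or_true, true_or, add_zero, zero_add]
    exfalso
    obtain ⟨t, -, ht, e⟩ := (C.mem_subdivideRay_edgeImage_new r₀ s hs x).1 h1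
    obtain ⟨t', ht', e'⟩ := (C.mem_subdivideRay_rayImage_self r₀ s hs x).1 h2
    have := hC.rayPoint_inj r₀ (e.symm.trans e')
    exact hx (by rw [e, show t = s by linarith])
  · rw [subdivideRay_rayImage C r₀ s hs (Finset.ne_of_mem_erase hr)]
    rfl

theorem subdivideRay_isSubdivisionAt : C.IsSubdivisionAt (D) (C.rayPoint r₀ s) where
  immersed h := ⟨(subdivideRay_forall C r₀ s hs).2 ⟨h.2 r₀, h.1⟩, h.2⟩
  betti := C.subdivideRay_firstBetti_le r₀ s hs
  range_pos := by
    ext x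
    refine Option.exists.trans (or_congr ?_ Iff.rfl)
    exact eq_comm
  mem_image x := by
    rw [mem_image_iff, mem_image_iff, subdivideRay_exists]
    have hp : C.rayPoint r₀ s ∈ C.rayImage r₀ := ⟨s, hs.le, rfl⟩
    have hr : ∀ r : C.R, x ∈ (D).rayImage (ray r) → ∃ r, x ∈ C.rayImage r := by
      intro r h
      by_cases h0 : r = r₀
      · subst h0
        exact ⟨r, (C.mem_rayImage_iff_subdivideRay r s hs x).2 (Or.inr h)⟩
      · rw [subdivideRay_rayImage C r₀ s hs h0] at h
        exact ⟨r, h⟩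
    constructor
    · rintro (⟨v, rfl⟩ | (h | ⟨e, he⟩) | ⟨r, h⟩)
      · cases v with
        | none => exact Or.inr (Or.inr ⟨r₀, hp⟩)
        | some v => exact Or.inl ⟨v, rfl⟩
      · exact Or.inr (Or.inr ⟨r₀, (C.mem_rayImage_iff_subdivideRay r₀ s hs x).2 (Or.inl h)⟩)
      · exact Or.inr (Or.inl ⟨e, he⟩)
      · exact Or.inr (Or.inr (hr r h))
    · rintro (⟨v, rfl⟩ | ⟨e, he⟩ | ⟨r, h⟩)
      · exact Or.inl ⟨some v, rfl⟩
      · exact Or.inr (Or.inl (Or.inr ⟨e, he⟩))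
      · by_cases h0 : r = r₀
        · subst h0
          rcases (C.mem_rayImage_iff_subdivideRay r s hs x).1 h with h | h
          · exact Or.inr (Or.inl (Or.inl h))
          · exact Or.inr (Or.inr ⟨_, h⟩)
        · exact Or.inr (Or.inr ⟨C.subdivideRayRay r₀ s hs r, by
            rwa [subdivideRay_rayImage C r₀ s hs h0]⟩)
  weight hC x hx := C.subdivideRay_inducedWeight r₀ s hs hC hx

theorem subdivideRay_incidences_lt (hC : C.Immersed) {P : Finset (ℝ × ℝ)}
    (hP : C.rayPoint r₀ s ∈ P) : (D).incidences P < C.incidences P := by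
  classical
  unfold incidences
  rw [subdivideRay_sum, subdivideRay_sum_ray, add_comm (Finset.card _), add_assoc]
  refine Nat.add_lt_add_of_le_of_lt le_rfl ?_
  rw [← Finset.add_sum_erase _ _ (Finset.mem_univ r₀),
    ← Finset.add_sum_erase Finset.univ (fun r => (P.filter (· ∈ C.openRay r)).card)
      (Finset.mem_univ r₀), ← add_assoc]
  refine Nat.add_lt_add_of_lt_of_le ?_ (Finset.sum_le_sum fun r hr => ?_)
  · rw [← Finset.card_union_of_disjoint]
    · refine Finset.card_lt_card ⟨?_, fun hsub => ?_⟩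
      · intro x hx
        simp only [Finset.mem_union, Finset.mem_filter] at hx ⊢
        rcases hx with ⟨hx, t, h0, h1, rfl⟩ | ⟨hx, t, h0, rfl⟩
        · exact ⟨hx, t, h0, rfl⟩
        · exact ⟨hx, s + t, by linarith, subdivideRay_rayPoint_self ..⟩
      · have : C.rayPoint r₀ s ∈ P.filter (· ∈ C.openRay r₀) := by
          simp only [Finset.mem_filter]
          exact ⟨hP, s, hs, rfl⟩
        have := hsub this
        simp only [Finset.mem_union, Finset.mem_filter] at this
        rcases this with ⟨-, t, h0, h1, e⟩ | ⟨-, t, h0, e⟩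
        · change t < s at h1
          have := hC.rayPoint_inj r₀ e
          linarith
        · rw [subdivideRay_rayPoint_self] at e
          have := hC.rayPoint_inj r₀ e
          linarith
    · rw [Finset.disjoint_left]
      intro x hx hx'
      simp only [Finset.mem_filter] at hx hx'
      obtain ⟨-, t, h0, h1, e⟩ := hx
      obtain ⟨-, t', h0', e'⟩ := hx'
      rw [subdivideRay_rayPoint_self] at e'
      change t < s at h1
      have := hC.rayPoint_inj r₀ (e.symm.trans e')
      linarith
  · rw [subdivideRay_openRay C r₀ s hs (Finset.ne_of_mem_erase hr)]

end SubdivideRay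

/-- A parameterized curve without contracted edges can be subdivided at finitely many points. -/
theorem exists_subdividedAt (P : Finset (ℝ × ℝ)) (C : ParamCurve)
    (hC : C.Immersed) (hP : Set.range C.pos ⊆ P) :
    ∃ D : ParamCurve, D.Immersed ∧ D.image = C.image ∧
      (∀ x ∉ P, D.inducedWeight x = C.inducedWeight x) ∧ D.firstBetti ≤ C.firstBetti ∧
      Set.range D.pos ⊆ P ∧ D.SubdividedAt P := by
  generalize h : C.incidences P = N
  induction N using Nat.strong_induction_on generalizing C with
  | _ N ih =>
  subst h
  by_cases hsub : C.SubdividedAt P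
  · exact ⟨C, hC, rfl, fun _ _ => rfl, le_rfl, hP, hsub⟩
  obtain ⟨D, p, hp, hD, hlt⟩ : ∃ D : ParamCurve, ∃ p ∈ P, C.IsSubdivisionAt D p ∧
      D.incidences P < C.incidences P := by
    by_contra hcon
    push Not at hcon
    refine hsub ⟨?_, ?_⟩
    · rintro e x hx ⟨t, h0, h1, rfl⟩
      exact (hcon _ _ hx (C.subdivideEdge_isSubdivisionAt e t h0 h1)).not_gt
        (C.subdivideEdge_incidences_lt e t h0 h1 hC hx)
    · rintro r x hx ⟨t, h0, rfl⟩
      exact (hcon _ _ hx (C.subdivideRay_isSubdivisionAt r t h0)).not_gt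
        (C.subdivideRay_incidences_lt r t h0 hC hx)
  obtain ⟨D', h1, h2, h3, h4, h5⟩ := ih _ hlt D (hD.immersed hC) (by
    rw [hD.range_pos]
    exact Set.insert_subset hp hP) rfl
  refine ⟨D', h1, h2.trans (Set.ext hD.mem_image), fun x hx => ?_, h4.trans hD.betti, h5⟩
  rw [h3 x hx, hD.weight hC x (by rintro rfl; exact hx hp)]

end ParamCurve

/-! ### Flags, moments and flows -/

namespace ParamCurve

variable (C : ParamCurve)

/-- The flags of the graph: every bounded edge has one flag at its source (first summand) and one at
its target (second summand), every ray has one flag. -/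
abbrev Flag : Type := C.E ⊕ C.E ⊕ C.R

/-- The vertex of a flag. -/
def vertex : C.Flag → C.V := Sum.elim C.src (Sum.elim C.tgt C.base)

/-- The slope of the edge of a flag, pointing away from the vertex. -/
def vec : C.Flag → ℤ × ℤ := Sum.elim C.slope (Sum.elim (fun e => -C.slope e) C.dir)

/-- A vertex that belongs to some edge or ray. -/
def Active (v : C.V) : Prop := ∃ σ, C.vertex σ = v

/-- The determinant of two vectors of the plane. -/
def _root_.planeDet (d x : ℝ × ℝ) : ℝ := d.1 * x.2 - d.2 * x.1

/-- The value at a flag of a function on the edges and rays; the orientation of an edge is reversed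
at its target. -/
def flagValue (o : C.E ⊕ C.R → ℝ) : C.Flag → ℝ :=
  Sum.elim (fun e => o (Sum.inl e)) (Sum.elim (fun e => -o (Sum.inl e)) (fun r => o (Sum.inr r)))

theorem flag_balanced (F : ℤ × ℤ →+ ℝ) (v : C.V) [DecidableEq C.V] :
    ∑ σ, (if C.vertex σ = v then F (C.vec σ) else 0) = 0 := by
  have h := congrArg F (C.balanced v)
  rw [map_zero] at h
  refine Eq.trans ?_ h
  rw [Fintype.sum_sum_type, Fintype.sum_sum_type, map_add, map_sub, map_sum, map_sum, map_sum,
    sub_eq_add_neg, ← Finset.sum_neg_distrib, add_assoc]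
  refine congrArg₂ (· + ·) ?_ (congrArg₂ (· + ·) ?_ ?_) <;> refine Finset.sum_congr rfl fun e _ => ?_
  · by_cases h : C.src e = v <;> simp [vertex, vec, h]
  · by_cases h : C.tgt e = v <;> simp [vertex, vec, h]
  · by_cases h : C.base e = v <;> simp [vertex, vec, h]

/-- The pairing with a real vector, as a homomorphism on `ℤ²`. -/
def _root_.pairingHom (d : ℝ × ℝ) : ℤ × ℤ →+ ℝ where
  toFun := pairing d
  map_zero' := by simp [lin]
  map_add' := pairing_add d

theorem _root_.pairing_eq (d : ℝ × ℝ) (u : ℤ × ℤ) : pairing d u = u.1 * d.1 + u.2 * d.2 := rfl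

theorem _root_.planeDet_latticeToReal (u : ℤ × ℤ) (x : ℝ × ℝ) :
    planeDet (latticeToReal u) x = pairing (rot (-x)) u * (-1) := by
  simp [planeDet, latticeToReal, lin, rot]
  ring

/-- The source and the target of an edge that is not contracted have distinct images. -/
theorem Immersed.pos_ne {C : ParamCurve} (hC : C.Immersed) (e : C.E) :
    C.pos (C.src e) ≠ C.pos (C.tgt e) := by
  rw [← edgePoint_zero, ← edgePoint_len]
  intro h
  exact (C.len_pos e).ne (hC.edgePoint_inj e h)

theorem _root_.normSq_latticeToReal_pos {u : ℤ × ℤ} (hu : u ≠ 0) : 0 < normSq (latticeToReal u) :=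
  normSq_pos (latticeToReal_ne_zero hu)

theorem Immersed.vec_ne {C : ParamCurve} (hC : C.Immersed) (σ : C.Flag) : C.vec σ ≠ 0 := by
  rcases σ with e | e | r
  · exact hC.slope_ne e
  · exact neg_ne_zero.2 (hC.slope_ne e)
  · exact hC.dir_ne r

/-- A function that is constant along the edges that avoid `p` and zero on the rays that do not start
at `p` vanishes away from `p`: at a vertex outside its zero set that is farthest from `p`, all edges
would point strictly closer to `p`, against the balancing condition. -/
theorem Immersed.eq_zero_of_farthest {C : ParamCurve} (hC : C.Immersed) (p : ℝ × ℝ) (φ : C.V → ℝ)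
    (hE : ∀ e, C.pos (C.src e) ≠ p → C.pos (C.tgt e) ≠ p → φ (C.src e) = φ (C.tgt e))
    (hR : ∀ r, C.pos (C.base r) ≠ p → φ (C.base r) = 0) {v : C.V} (hv : C.Active v)
    (hvp : C.pos v ≠ p) : φ v = 0 := by
  classical
  by_contra hne
  let T : Finset C.V := Finset.univ.filter fun w => C.Active w ∧ C.pos w ≠ p ∧ φ w ≠ 0
  obtain ⟨s, hsT, hmax⟩ := T.exists_max_image (fun w => normSq (C.pos w - p))
    ⟨v, by simp [T, hv, hvp, hne]⟩
  simp only [T, Finset.mem_filter, Finset.mem_univ, true_and] at hsT hmax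
  obtain ⟨⟨σ₀, hσ₀⟩, hsp, hs0⟩ := hsT
  set x := C.pos s - p with hx
  have hx0 : x ≠ 0 := sub_ne_zero.2 hsp
  -- the edge to a vertex `w` points strictly closer to `p`
  have key : ∀ (w : C.V) (u : ℤ × ℤ) (l : ℝ), 0 < l → u ≠ 0 →
      C.pos w = C.pos s + l • latticeToReal u → C.Active w → (C.pos w ≠ p → φ w = φ s) →
      pairing x u < 0 := by
    intro w u l hl hu hw hact hφ
    have hu' := normSq_latticeToReal_pos hu
    by_cases hwp : C.pos w = p
    · have h1 : x = -(l • latticeToReal u) := by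
        rw [hx, ← hwp, hw]; abel
      have : pairing x u = -(l * normSq (latticeToReal u)) := by
        rw [pairing_eq, h1]
        simp [normSq, latticeToReal]
        ring
      rw [this]
      have := mul_pos hl hu'
      linarith
    · have h1 := hmax w ⟨hact, hwp, by rw [hφ hwp]; exact hs0⟩
      have h2 : normSq (C.pos w - p) = normSq x + 2 * l * pairing x u +
          l ^ 2 * normSq (latticeToReal u) := by
        have : C.pos w - p = x + l • latticeToReal u := by rw [hx, hw]; abel
        rw [this, pairing_eq]
        simp only [normSq, latticeToReal, Prod.fst_add, Prod.snd_add, Prod.smul_fst, Prod.smul_snd,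
          smul_eq_mul]
        ring
      rw [h2] at h1
      have h3 : 0 < l ^ 2 * normSq (latticeToReal u) := by positivity
      have h4 : 2 * l * pairing x u < 0 := by linarith
      by_contra hcon
      push Not at hcon
      have := mul_nonneg (mul_nonneg zero_le_two hl.le) hcon
      linarith
  have hneg : ∀ σ, C.vertex σ = s → pairing x (C.vec σ) < 0 := by
    rintro (e | e | r) h
    · change C.src e = s at h
      refine key (C.tgt e) _ _ (C.len_pos e) (hC.slope_ne e) (by rw [← h]; exact C.pos_tgt e)
        ⟨Sum.inr (Sum.inl e), rfl⟩ fun ht => ?_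
      rw [← h]
      exact (hE e (by rwa [h]) ht).symm
    · change C.tgt e = s at h
      refine key (C.src e) (-C.slope e) _ (C.len_pos e) (neg_ne_zero.2 (hC.slope_ne e)) ?_
        ⟨Sum.inl e, rfl⟩ fun ht => ?_
      · rw [← h, C.pos_tgt e]
        ext <;> simp [latticeToReal]
      · rw [← h]
        exact hE e ht (by rwa [h])
    · change C.base r = s at h
      exact absurd (by rw [← h]; exact hR r (by rwa [h])) hs0
  have hsum := C.flag_balanced (pairingHom x) s
  refine absurd hsum (ne_of_lt ?_)
  refine Finset.sum_neg' (fun σ _ => ?_) ⟨σ₀, Finset.mem_univ _, ?_⟩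
  · split_ifs with h
    · exact (hneg σ h).le
    · exact le_rfl
  · rw [if_pos hσ₀]
    exact hneg σ₀ hσ₀

/-- A function that is constant along the edges and zero on the rays vanishes on the active
vertices. -/
theorem Immersed.eq_zero_of_flag {C : ParamCurve} (hC : C.Immersed) (φ : C.V → ℝ)
    (hE : ∀ e, φ (C.src e) = φ (C.tgt e)) (hR : ∀ r, φ (C.base r) = 0) {v : C.V}
    (hv : C.Active v) : φ v = 0 := by
  obtain ⟨p, hp⟩ := (Set.finite_range C.pos).exists_notMem
  exact hC.eq_zero_of_farthest p φ (fun e _ _ => hE e) (fun r _ => hR r) hv fun h => hp ⟨v, h⟩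

open Classical in
/-- The flow out of every vertex of a function on the edges and rays. -/
def flow : (C.E ⊕ C.R → ℝ) →ₗ[ℝ] (C.V → ℝ) where
  toFun o v := ∑ σ, if C.vertex σ = v then C.flagValue o σ else 0
  map_add' a b := by
    ext v
    rw [Pi.add_apply, ← Finset.sum_add_distrib]
    refine Finset.sum_congr rfl fun σ _ => ?_
    split_ifs
    · rcases σ with e | e | r <;> simp [flagValue]
      ring
    · simp
  map_smul' c a := by
    ext v
    rw [Pi.smul_apply, smul_eq_mul, Finset.mul_sum]
    refine Finset.sum_congr rfl fun σ _ => ?_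
    split_ifs
    · rcases σ with e | e | r <;> simp [flagValue]
    · simp

theorem sum_mul_flow (φ : C.V → ℝ) (o : C.E ⊕ C.R → ℝ) :
    ∑ v, φ v * C.flow o v = ∑ σ, φ (C.vertex σ) * C.flagValue o σ := by
  classical
  have : ∀ v, φ v * C.flow o v = ∑ σ, if C.vertex σ = v then φ v * C.flagValue o σ else 0 := by
    intro v
    change _ * (∑ σ, _) = _
    rw [Finset.mul_sum]
    refine Finset.sum_congr rfl fun σ _ => ?_
    split_ifs <;> simp
  simp only [this]
  rw [Finset.sum_comm]
  refine Finset.sum_congr rfl fun σ _ => ?_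
  simp

theorem sum_mul_flagValue (γ : C.Flag → ℝ) (o : C.E ⊕ C.R → ℝ) : ∑ σ, γ σ * C.flagValue o σ =
    ∑ e, (γ (Sum.inl e) - γ (Sum.inr (Sum.inl e))) * o (Sum.inl e) +
      ∑ r, γ (Sum.inr (Sum.inr r)) * o (Sum.inr r) := by
  rw [Fintype.sum_sum_type, Fintype.sum_sum_type, ← add_assoc, ← Finset.sum_add_distrib]
  refine congrArg₂ (· + ·) (Finset.sum_congr rfl fun e _ => ?_) rfl
  simp only [flagValue, Sum.elim_inl, Sum.elim_inr]
  ring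

/-- The infinitesimal deformations of a parameterized curve: the edges keep their direction, and
vertices with the same image stay together. -/
def deformations : Submodule ℝ (C.V → ℝ × ℝ) where
  carrier := {q | (∀ e, planeDet (latticeToReal (C.slope e)) (q (C.tgt e) - q (C.src e)) = 0) ∧
    ∀ v w, C.pos v = C.pos w → q v = q w}
  zero_mem' := ⟨fun e => by simp [planeDet], fun v w _ => rfl⟩
  add_mem' := by
    rintro a b ⟨ha, ha'⟩ ⟨hb, hb'⟩
    refine ⟨fun e => ?_, fun v w h => by rw [Pi.add_apply, Pi.add_apply, ha' v w h, hb' v w h]⟩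
    have h1 := ha e
    have h2 := hb e
    simp only [planeDet, Pi.add_apply, Prod.fst_sub, Prod.snd_sub, Prod.fst_add, Prod.snd_add]
      at h1 h2 ⊢
    linear_combination h1 + h2
  smul_mem' := by
    rintro c a ⟨ha, ha'⟩
    refine ⟨fun e => ?_, fun v w h => by rw [Pi.smul_apply, Pi.smul_apply, ha' v w h]⟩
    have h1 := ha e
    simp only [planeDet, Pi.smul_apply, Prod.fst_sub, Prod.snd_sub, Prod.smul_fst, Prod.smul_snd,
      smul_eq_mul] at h1 ⊢
    linear_combination c * h1

/-- The moments of the edges and rays for given vertex positions. For a deformation of a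
parameterized curve they determine the lines that contain the edges and rays. -/
def moments : (C.V → ℝ × ℝ) →ₗ[ℝ] (C.E ⊕ C.R → ℝ) where
  toFun q := Sum.elim (fun e => planeDet (latticeToReal (C.slope e)) (q (C.src e)))
    (fun r => planeDet (latticeToReal (C.dir r)) (q (C.base r)))
  map_add' a b := by
    ext (e | r) <;> simp [planeDet] <;> ring
  map_smul' c a := by
    ext (e | r) <;> simp [planeDet] <;> ring

variable {C} in
theorem flagValue_moments {q : C.V → ℝ × ℝ} (hq : q ∈ C.deformations) (σ : C.Flag) :
    C.flagValue (C.moments q) σ = planeDet (latticeToReal (C.vec σ)) (q (C.vertex σ)) := by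
  rcases σ with e | e | r
  · rfl
  · have h := hq.1 e
    change -planeDet (latticeToReal (C.slope e)) (q (C.src e)) =
      planeDet (latticeToReal (-C.slope e)) (q (C.tgt e))
    simp only [planeDet, latticeToReal, Prod.fst_sub, Prod.snd_sub, Prod.fst_neg, Prod.snd_neg,
      Int.cast_neg] at h ⊢
    linear_combination h
  · rfl

/-- The moments of a deformation form a flow without sources: by balancing, the moments of the flags
at a vertex `v` with respect to the point `q v` add up to zero. -/
theorem map_moments_le : C.deformations.map C.moments ≤ LinearMap.ker C.flow := by
  classical
  rintro _ ⟨q, hq, rfl⟩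
  rw [LinearMap.mem_ker]
  ext v
  have h := C.flag_balanced (pairingHom (rot (-q v))) v
  have : C.flow (C.moments q) v =
      (∑ σ, if C.vertex σ = v then pairingHom (rot (-q v)) (C.vec σ) else 0) * (-1) := by
    rw [Finset.sum_mul]
    refine Finset.sum_congr (by congr!) fun σ _ => ?_
    split_ifs with h
    · rw [flagValue_moments hq, h, planeDet_latticeToReal]; rfl
    · simp
  rw [this, h, zero_mul, Pi.zero_apply]

/-- Every flow without sources is given by the moments of a deformation. -/
def Regular : Prop := C.deformations.map C.moments = LinearMap.ker C.flow

/-- The key consequence of regularity: a linear relation between the slopes of the flags over a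
point `p` holds at every vertex over `p` with constant coefficients. Such a relation gives a linear
form on the edges and rays that vanishes on the moments of all deformations, hence factors over the
flow; the factorization is supported at the vertices over `p` by `Immersed.eq_zero_of_farthest`. -/
theorem Regular.exists_eq_vertex {C : ParamCurve} (hreg : C.Regular) (hC : C.Immersed) (p : ℝ × ℝ)
    (β : C.Flag → ℝ) (hβ0 : ∀ σ, C.pos (C.vertex σ) ≠ p → β σ = 0)
    (hβ : ∑ σ, β σ • latticeToReal (C.vec σ) = 0) :
    ∃ φ : C.V → ℝ, ∀ σ, C.pos (C.vertex σ) = p → β σ = φ (C.vertex σ) := by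
  classical
  -- the linear form defined by `β`; it vanishes on the moments of deformations
  let ω : Module.Dual ℝ (C.E ⊕ C.R → ℝ) :=
    { toFun := fun o => ∑ σ, β σ * C.flagValue o σ
      map_add' := fun a b => by
        rw [← Finset.sum_add_distrib]
        refine Finset.sum_congr rfl fun σ _ => ?_
        rcases σ with e | e | r <;> simp [flagValue] <;> ring
      map_smul' := fun c a => by
        rw [smul_eq_mul, Finset.mul_sum]
        refine Finset.sum_congr rfl fun σ _ => ?_
        rcases σ with e | e | r <;> simp [flagValue] <;> ring }
  have hω : ω ∈ (LinearMap.ker C.flow).dualAnnihilator := by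
    rw [Submodule.mem_dualAnnihilator, ← hreg]
    rintro _ ⟨q, hq, rfl⟩
    change ∑ σ, β σ * C.flagValue (C.moments q) σ = 0
    by_cases hp : ∃ v, C.pos v = p
    · obtain ⟨v, hv⟩ := hp
      have h1 : ∀ σ, β σ * C.flagValue (C.moments q) σ =
          planeDet (β σ • latticeToReal (C.vec σ)) (q v) := by
        intro σ
        by_cases hσ : C.pos (C.vertex σ) = p
        · rw [flagValue_moments hq, hq.2 (C.vertex σ) v (hσ.trans hv.symm)]
          simp only [planeDet, Prod.smul_fst, Prod.smul_snd, smul_eq_mul]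
          ring
        · rw [hβ0 σ hσ]
          simp [planeDet]
      have h2 : ∑ σ, planeDet (β σ • latticeToReal (C.vec σ)) (q v) =
          planeDet (∑ σ, β σ • latticeToReal (C.vec σ)) (q v) := by
        simp only [planeDet, Prod.fst_sum, Prod.snd_sum, Finset.sum_mul, Finset.sum_sub_distrib]
      simp only [h1]
      rw [h2, hβ]
      simp [planeDet]
    · push Not at hp
      exact Finset.sum_eq_zero fun σ _ => by rw [hβ0 σ (hp _), zero_mul]
  -- by regularity it factors over the flow, with coefficients `φ` on the vertices
  rw [← LinearMap.range_dualMap_eq_dualAnnihilator_ker] at hω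
  obtain ⟨ψ, hψ⟩ := hω
  let φ : C.V → ℝ := fun v => ψ (Pi.single v 1)
  have hφ : ∀ o, ∑ σ, φ (C.vertex σ) * C.flagValue o σ = ∑ σ, β σ * C.flagValue o σ := by
    intro o
    rw [← C.sum_mul_flow]
    have h1 : ψ (C.flow o) = ∑ σ, β σ * C.flagValue o σ := LinearMap.congr_fun hψ o
    rw [← h1]
    conv_rhs => rw [← Finset.univ_sum_single (C.flow o), map_sum]
    refine Finset.sum_congr rfl fun v _ => ?_
    have : (Pi.single v (C.flow o v) : C.V → ℝ) = C.flow o v • Pi.single v 1 := by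
      rw [← Pi.single_smul, smul_eq_mul, mul_one]
    rw [this, map_smul, smul_eq_mul, mul_comm]
  have hedge : ∀ e, φ (C.src e) - φ (C.tgt e) = β (Sum.inl e) - β (Sum.inr (Sum.inl e)) := by
    intro e
    have h := hφ (Pi.single (Sum.inl e) 1)
    rw [sum_mul_flagValue C (fun σ => φ (C.vertex σ)), sum_mul_flagValue] at h
    simpa [Pi.single_apply, vertex] using h
  have hray : ∀ r, φ (C.base r) = β (Sum.inr (Sum.inr r)) := by
    intro r
    have h := hφ (Pi.single (Sum.inr r) 1)
    rw [sum_mul_flagValue C (fun σ => φ (C.vertex σ)), sum_mul_flagValue] at h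
    simpa [Pi.single_apply, vertex] using h
  have hzero : ∀ v, C.Active v → C.pos v ≠ p → φ v = 0 := by
    intro v hv hvp
    refine hC.eq_zero_of_farthest p φ (fun e h1 h2 => ?_) (fun r h1 => ?_) hv hvp
    · have := hedge e
      rw [hβ0 (Sum.inl e) h1, hβ0 (Sum.inr (Sum.inl e)) h2] at this
      linarith
    · rw [hray, hβ0 (Sum.inr (Sum.inr r)) h1]
  refine ⟨φ, ?_⟩
  rintro (e | e | r) hσ
  · change C.pos (C.src e) = p at hσ
    have h1 : C.pos (C.tgt e) ≠ p := fun h => hC.pos_ne e (hσ.trans h.symm)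
    have := hedge e
    rw [hβ0 (Sum.inr (Sum.inl e)) h1, hzero (C.tgt e) ⟨Sum.inr (Sum.inl e), rfl⟩ h1] at this
    change _ = φ (C.src e)
    linarith
  · change C.pos (C.tgt e) = p at hσ
    have h1 : C.pos (C.src e) ≠ p := fun h => hC.pos_ne e (h.trans hσ.symm)
    have := hedge e
    rw [hβ0 (Sum.inl e) h1, hzero (C.src e) ⟨Sum.inl e, rfl⟩ h1] at this
    change _ = φ (C.tgt e)
    linarith
  · exact (hray r).symm

/-- On a regular curve, distinct flags over the same point have distinct directions. -/
theorem Regular.flag_eq {C : ParamCurve} (hreg : C.Regular) (hC : C.Immersed) {p : ℝ × ℝ}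
    {σ τ : C.Flag} (hσ : C.pos (C.vertex σ) = p) (hτ : C.pos (C.vertex τ) = p) {c : ℝ} (hc : 0 < c)
    (h : latticeToReal (C.vec τ) = c • latticeToReal (C.vec σ)) : σ = τ := by
  classical
  by_contra hne
  -- the relation `c • vec σ - vec τ = 0`
  let β : C.Flag → ℝ := Pi.single σ c - Pi.single τ 1
  have hβσ : β σ = c := by simp [β, hne]
  have hβτ : β τ = -1 := by simp [β, Ne.symm hne]
  have hβ : ∀ ρ, ρ ≠ σ → ρ ≠ τ → β ρ = 0 := fun ρ h1 h2 => by simp [β, h1, h2]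
  obtain ⟨φ, hφ⟩ := hreg.exists_eq_vertex hC p β (fun ρ hρ => hβ ρ (by rintro rfl; exact hρ hσ)
    (by rintro rfl; exact hρ hτ)) (by
      simp only [β, Pi.sub_apply, sub_smul, Finset.sum_sub_distrib]
      simp [Pi.single_apply, ite_smul, h])
  -- no other flag has its vertex in common with `σ`
  have huniq : ∀ ρ, C.vertex ρ = C.vertex σ → ρ = σ := by
    intro ρ hρ
    by_contra hρσ
    have h1 := hφ σ hσ
    have h2 := hφ ρ (by rw [hρ, hσ])
    rw [hρ, ← h1, hβσ] at h2
    by_cases hρτ : ρ = τ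
    · rw [hρτ, hβτ] at h2
      linarith
    · rw [hβ ρ hρσ hρτ] at h2
      linarith
  -- balancing at the vertex of `σ` now forces the slope of `σ` to vanish
  have hbal : ∀ d, pairing d (C.vec σ) = 0 := by
    intro d
    have := C.flag_balanced (pairingHom d) (C.vertex σ)
    rw [Finset.sum_eq_single σ] at this
    · rwa [if_pos rfl] at this
    · intro ρ _ hρ
      rw [if_neg fun h => hρ (huniq ρ h)]
    · simp
  have h1 := hbal (1, 0)
  have h2 := hbal (0, 1)
  simp [lin] at h1 h2
  exact hC.vec_ne σ (Prod.ext h1 h2)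

end ParamCurve

/-! ### Weights of tropical curves -/

theorem pairing_eq_latticeToReal (d : ℝ × ℝ) (u : ℤ × ℤ) :
    pairing d u = (latticeToReal u).1 * d.1 + (latticeToReal u).2 * d.2 := rfl

theorem latticeToReal_injective : Function.Injective latticeToReal := by
  intro u v h
  have h1 := congrArg Prod.fst h
  have h2 := congrArg Prod.snd h
  simp only [latticeToReal, Int.cast_inj] at h1 h2
  exact Prod.ext h1 h2

theorem latticeLength_pos {u : ℤ × ℤ} (hu : u ≠ 0) : 0 < latticeLength u := by
  rw [latticeLength, Int.gcd_pos_iff]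
  by_contra h
  push Not at h
  exact hu (Prod.ext h.1 h.2)

/-- The lattice length of a vector orthogonal to `u`, compared with its pairing with the rotated
vector. -/
theorem latticeLength_mul_normSq {u w : ℤ × ℤ} (hu : u ≠ 0) (h : u.1 * w.1 + u.2 * w.2 = 0) :
    (latticeLength w : ℝ) * normSq (latticeToReal u) =
      |pairing (rot (latticeToReal u)) w| * latticeLength u := by
  have hg := latticeLength_pos hu
  unfold latticeLength at hg
  obtain ⟨a, b, hab, h1, h2⟩ := Int.exists_gcd_one hg
  set l := Int.gcd u.1 u.2 with hl
  have hl0 : (l : ℤ) ≠ 0 := by exact_mod_cast hg.ne'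
  have h3 : a * w.1 + b * w.2 = 0 := by
    have : (l : ℤ) * (a * w.1 + b * w.2) = 0 := by rw [← h, h1, h2]; ring
    exact (mul_eq_zero.1 this).resolve_left hl0
  obtain ⟨x, y, hxy⟩ := Int.isCoprime_iff_gcd_eq_one.2 hab
  obtain ⟨k, hk⟩ : ∃ k, k = y * w.1 - x * w.2 := ⟨_, rfl⟩
  have hw1 : w.1 = b * k := by rw [hk]; linear_combination x * h3 - w.1 * hxy
  have hw2 : w.2 = -a * k := by rw [hk]; linear_combination y * h3 - w.2 * hxy
  have hw : latticeLength w = k.natAbs := by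
    unfold latticeLength
    rw [hw1, hw2, neg_mul, Int.gcd_neg, mul_comm b, mul_comm a, Int.gcd_mul_left, Int.gcd_comm, hab,
      mul_one]
  rw [hw, pairing_eq]
  have e1 : (w.1 : ℝ) = b * k := by exact_mod_cast hw1
  have e2 : (w.2 : ℝ) = -a * k := by exact_mod_cast hw2
  have e3 : (u.1 : ℝ) = a * l := by exact_mod_cast h1
  have e4 : (u.2 : ℝ) = b * l := by exact_mod_cast h2
  have e5 : (w.1 : ℝ) * (rot (latticeToReal u)).1 + w.2 * (rot (latticeToReal u)).2 =
      k * (l * (a ^ 2 + b ^ 2)) := by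
    simp only [rot, latticeToReal, e1, e2, e3, e4]
    ring
  rw [e5, abs_mul, abs_of_nonneg (by positivity : (0 : ℝ) ≤ l * (a ^ 2 + b ^ 2))]
  simp only [normSq, latticeToReal, e3, e4, Nat.cast_natAbs, Int.cast_abs, latticeLength, ← hl]
  ring

section

variable {A : Set (ℤ × ℤ)} {d : ℝ × ℝ}

theorem collinear_of_pairing_eq (hd : d ≠ 0) (h : ∀ a ∈ A, ∀ b ∈ A, pairing d a = pairing d b) :
    Collinear ℝ (latticeToReal '' A) := by
  rcases A.eq_empty_or_nonempty with rfl | ⟨a₀, ha₀⟩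
  · rw [Set.image_empty]; exact collinear_empty ℝ _
  have hN := normSq_pos hd
  rw [collinear_iff_of_mem (Set.mem_image_of_mem _ ha₀)]
  refine ⟨rot d, ?_⟩
  rintro _ ⟨a, ha, rfl⟩
  refine ⟨pairing (rot d) (a - a₀) / normSq d, ?_⟩
  have h1 := h a ha a₀ ha₀
  rw [pairing_eq, pairing_eq] at h1
  have h2 : pairing (rot d) (a - a₀) = (a.1 - a₀.1) * d.2 - (a.2 - a₀.2) * d.1 := by
    rw [pairing_eq]; simp [rot]; ring
  rw [h2]
  ext
  · simp only [latticeToReal, rot, vadd_eq_add, Prod.fst_add, Prod.smul_fst, smul_eq_mul]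
    field_simp
    unfold normSq
    linear_combination d.1 * h1
  · simp only [latticeToReal, rot, vadd_eq_add, Prod.snd_add, Prod.smul_snd, smul_eq_mul]
    field_simp
    unfold normSq
    linear_combination d.2 * h1

theorem pairing_eq_of_collinear (hA : Collinear ℝ (latticeToReal '' A)) {i j : ℤ × ℤ} (hi : i ∈ A)
    (hj : j ∈ A) (hij : i ≠ j) (h : pairing d j = pairing d i) :
    ∀ a ∈ A, ∀ b ∈ A, pairing d a = pairing d b := by
  rw [collinear_iff_of_mem (Set.mem_image_of_mem _ hi)] at hA
  obtain ⟨v, hv⟩ := hA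
  have key : ∀ a ∈ A, ∃ r : ℝ, latticeToReal a = r • v + latticeToReal i ∧
      pairing d a = r * (v.1 * d.1 + v.2 * d.2) + pairing d i := by
    intro a ha
    obtain ⟨r, hr⟩ := hv _ (Set.mem_image_of_mem _ ha)
    rw [vadd_eq_add] at hr
    refine ⟨r, hr, ?_⟩
    rw [pairing_eq_latticeToReal, hr, pairing_eq_latticeToReal]
    simp only [Prod.fst_add, Prod.snd_add, Prod.smul_fst, Prod.smul_snd, smul_eq_mul]
    ring
  obtain ⟨r, hr, hr'⟩ := key j hj
  have hr0 : r ≠ 0 := by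
    rintro rfl
    rw [zero_smul, zero_add] at hr
    exact hij (latticeToReal_injective hr).symm
  rw [h, right_eq_add] at hr'
  have hv0 := (mul_eq_zero.1 hr').resolve_left hr0
  have : ∀ a ∈ A, pairing d a = pairing d i := by
    intro a ha
    obtain ⟨r, -, h⟩ := key a ha
    rw [h, hv0, mul_zero, zero_add]
  exact fun a ha b hb => (this a ha).trans (this b hb).symm

theorem pairing_eq_of_argmin_nontrivial (hA : Collinear ℝ (latticeToReal '' A))
    (h : (argmin A (pairing d)).Nontrivial) : ∀ a ∈ A, ∀ b ∈ A, pairing d a = pairing d b := by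
  obtain ⟨i, hi, j, hj, hij⟩ := h
  exact pairing_eq_of_collinear hA hi.1 hj.1 hij (argmin_eq_of_mem hj hi)

theorem sSup_latticeLength_eq {i j : ℤ × ℤ} (hi : i ∈ A) (hj : j ∈ A)
    (h : ∀ a ∈ A, ∀ b ∈ A, latticeLength (a - b) ≤ latticeLength (i - j)) :
    sSup {l | ∃ u ∈ A, ∃ u' ∈ A, l = latticeLength (u - u')} = latticeLength (i - j) := by
  refine IsGreatest.csSup_eq ⟨⟨i, hi, j, hj, rfl⟩, ?_⟩
  rintro l ⟨a, ha, b, hb, rfl⟩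
  exact h a ha b hb

theorem orthogonal_of_pairing_eq {u a b : ℤ × ℤ}
    (h : pairing (latticeToReal u) a = pairing (latticeToReal u) b) :
    u.1 * (a - b).1 + u.2 * (a - b).2 = 0 := by
  rw [pairing_eq, pairing_eq] at h
  simp only [latticeToReal] at h
  have h' : (a.1 * u.1 + a.2 * u.2 : ℤ) = b.1 * u.1 + b.2 * u.2 := by exact_mod_cast h
  simp only [Prod.fst_sub, Prod.snd_sub]
  linear_combination h'

/-- The lattice length of a set of lattice points on a line, from its width along the line. -/
theorem sSup_latticeLength_mul_normSq (hA : A.Finite) (hne : A.Nonempty) {u : ℤ × ℤ} (hu : u ≠ 0)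
    (h : ∀ a ∈ A, ∀ b ∈ A, pairing (latticeToReal u) a = pairing (latticeToReal u) b) :
    ((sSup {l | ∃ a ∈ A, ∃ b ∈ A, l = latticeLength (a - b)} : ℕ) : ℝ) *
      normSq (latticeToReal u) = width A (pairing (rot (latticeToReal u))) * latticeLength u := by
  obtain ⟨i, hi, j, hj, hij, hw⟩ := exists_width_eq hA hne (pairing (rot (latticeToReal u)))
  have hN := normSq_latticeToReal_pos hu
  have key : ∀ a ∈ A, ∀ b ∈ A, (latticeLength (a - b) : ℝ) * normSq (latticeToReal u) =
      |pairing (rot (latticeToReal u)) (a - b)| * latticeLength u :=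
    fun a ha b hb => latticeLength_mul_normSq hu (orthogonal_of_pairing_eq (h a ha b hb))
  have hpos : 0 ≤ pairing (rot (latticeToReal u)) (i - j) := by
    rw [pairing_sub]; linarith [(hij i hi).1]
  rw [sSup_latticeLength_eq hi hj, key i hi j hj, abs_of_nonneg hpos, pairing_sub, hw]
  intro a ha b hb
  rw [← Nat.cast_le (α := ℝ), ← mul_le_mul_iff_left₀ hN, key a ha b hb, key i hi j hj]
  refine mul_le_mul_of_nonneg_right ?_ (Nat.cast_nonneg _)
  rw [abs_of_nonneg hpos, pairing_sub, pairing_sub, abs_le]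
  constructor <;> linarith [hij a ha, hij b hb]

end

theorem weight_mul_normSq {f : Laurent} (hf : f ≠ 0) {x : ℝ × ℝ} {u : ℤ × ℤ} (hu : u ≠ 0)
    (h : ∀ a ∈ activeSet f x, ∀ b ∈ activeSet f x,
      pairing (latticeToReal u) a = pairing (latticeToReal u) b) :
    ((tropicalization f).weight x : ℝ) * normSq (latticeToReal u) =
      width (activeSet f x) (pairing (rot (latticeToReal u))) * latticeLength u := by
  rw [← sSup_latticeLength_mul_normSq (activeSet_finite f x) (activeSet_nonempty hf x) hu h]
  have : Collinear ℝ (latticeToReal '' activeSet f x) :=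
    collinear_of_pairing_eq (latticeToReal_ne_zero hu) h
  rw [tropicalization]
  simp only [if_pos this]

theorem collinear_of_weight_pos {f : Laurent} {x : ℝ × ℝ} (h : 0 < (tropicalization f).weight x) :
    Collinear ℝ (latticeToReal '' activeSet f x) := by
  by_contra hc
  rw [tropicalization] at h
  simp only [if_neg hc, lt_self_iff_false] at h

/-- A nontrivial set of lattice points has a nontrivial face. -/
theorem exists_edgeWidth_ne_zero {A : Set (ℤ × ℤ)} (hA : A.Finite) (h : A.Nontrivial) :
    ∃ d : ℝ × ℝ, d ≠ 0 ∧ edgeWidth A d ≠ 0 := by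
  by_contra hcon
  push Not at hcon
  obtain ⟨i, hi, j, hj, hij⟩ := h
  have key : ∀ (s b : ℤ × ℤ → ℝ), (∀ d, d ≠ 0 → faceWidth A s b d = 0) → s i = s j := by
    intro s b h0
    have h1 := sum_faceWidth_of_sign s b hA ⟨i, hi⟩ 1 (Or.inl rfl) (∅ : Finset Unit) (fun _ => 0)
      (by simp) (by simp) (fun e he hne => absurd (h0 e (by rintro rfl; simp at he)) hne)
    rw [Finset.sum_empty] at h1
    have h2 := sub_le_width hA (s := s) hi hj
    have h3 := sub_le_width hA (s := s) hj hi
    linarith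
  have h1 := key (fun u => (u.1 : ℝ)) (fun u => (u.2 : ℝ)) hcon
  have h2 := key (fun u => (u.2 : ℝ)) (fun u => (u.1 : ℝ)) fun d hd => by
    have := faceWidth_swap (fun u : ℤ × ℤ => (u.1 : ℝ)) (fun u => (u.2 : ℝ)) hA d.swap
    rw [Prod.swap_swap] at this
    exact this.trans (hcon _ fun h => hd (by rw [← Prod.swap_swap d, h]; rfl))
  simp only [Int.cast_inj] at h1 h2
  exact hij (Prod.ext h1 h2)

/-! ### The tropical curve near a point of a parameterized curve -/

namespace ParamCurve

/-- The parameterized curve `C` is adapted to the finite set `P` and parameterizes `Γ`: nothing is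
contracted, the points of `P` are vertices or lie outside the image, and the weights agree away from
`P`. -/
structure IsAdapted (C : ParamCurve) (Γ : WeightedSet) (P : Finset (ℝ × ℝ)) : Prop where
  immersed : C.Immersed
  image_eq : C.image = Γ.support
  weight_eq : ∀ x ∉ P, C.inducedWeight x = Γ.weight x
  range_pos : Set.range C.pos ⊆ P
  subdivided : C.SubdividedAt P

/-- Every parameterization can be made adapted to a finite set that contains given points, without
increasing the first Betti number: remove the contracted edges and subdivide. -/
theorem exists_isAdapted {C : ParamCurve} {Γ : WeightedSet} (hC : C.Parameterizes Γ)
    (Q : Finset (ℝ × ℝ)) : ∃ (D : ParamCurve) (P : Finset (ℝ × ℝ)), D.IsAdapted Γ P ∧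
      D.Parameterizes Γ ∧ D.firstBetti ≤ C.firstBetti ∧ Q ⊆ P := by
  classical
  obtain ⟨himg, F, hF, hw⟩ := hC.removeContracted
  let P : Finset (ℝ × ℝ) := Q ∪ hF.toFinset ∪ (Set.finite_range C.removeContracted.pos).toFinset
  have hFP : ∀ x ∉ P, x ∉ F := by
    intro x hx hxF
    exact hx (by simp [P, hxF])
  obtain ⟨D, h1, h2, h3, h4, h5, h6⟩ := exists_subdividedAt P C.removeContracted
    C.removeContracted_immersed (by
      intro x hx
      simp only [P, Finset.coe_union, Set.Finite.coe_toFinset]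
      exact Or.inr hx)
  have hw' : ∀ x ∉ P, D.inducedWeight x = Γ.weight x := fun x hx => by
    rw [h3 x hx, hw x (hFP x hx)]
  refine ⟨D, P, ⟨h1, h2.trans himg, hw', h5, h6⟩, ⟨h2.trans himg, P, P.finite_toSet, ?_⟩,
    h4.trans C.removeContracted_firstBetti_le, fun x hx => by simp [P, hx]⟩
  exact fun x hx => hw' x hx

variable {C : ParamCurve} {Γ : WeightedSet} {P : Finset (ℝ × ℝ)}

theorem IsAdapted.pos_mem (hC : C.IsAdapted Γ P) (v : C.V) : C.pos v ∈ P :=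
  hC.range_pos ⟨v, rfl⟩

theorem IsAdapted.mem_edgeImage (hC : C.IsAdapted Γ P) {p : ℝ × ℝ} (hp : p ∈ P) {e : C.E}
    (h : p ∈ C.edgeImage e) : p = C.pos (C.src e) ∨ p = C.pos (C.tgt e) := by
  obtain ⟨t, h0, h1, rfl⟩ := (C.mem_edgeImage_iff e p).1 h
  rcases h0.eq_or_lt with rfl | h0
  · exact Or.inl (C.edgePoint_zero e)
  rcases h1.eq_or_lt with rfl | h1
  · exact Or.inr (C.edgePoint_len e)
  · exact absurd ⟨t, h0, h1, rfl⟩ (hC.subdivided.edge e _ hp)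

theorem IsAdapted.mem_rayImage (hC : C.IsAdapted Γ P) {p : ℝ × ℝ} (hp : p ∈ P) {r : C.R}
    (h : p ∈ C.rayImage r) : p = C.pos (C.base r) := by
  obtain ⟨t, h0, rfl⟩ := (C.mem_rayImage_iff r p).1 h
  rcases h0.eq_or_lt with rfl | h0
  · exact C.rayPoint_zero r
  · exact absurd ⟨t, h0, rfl⟩ (hC.subdivided.ray r _ hp)

/-- The points of the curve outside `P` lie in the relative interior of an edge or a ray. -/
theorem IsAdapted.mem_open (hC : C.IsAdapted Γ P) {x : ℝ × ℝ} (hx : x ∈ Γ.support) (hxP : x ∉ P) :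
    (∃ e, x ∈ C.openEdge e) ∨ ∃ r, x ∈ C.openRay r := by
  rw [← hC.image_eq, mem_image_iff] at hx
  rcases hx with ⟨v, rfl⟩ | ⟨e, he⟩ | ⟨r, hr⟩
  · exact absurd (hC.pos_mem v) hxP
  · obtain ⟨t, h0, h1, rfl⟩ := (C.mem_edgeImage_iff e x).1 he
    refine Or.inl ⟨e, t, lt_of_le_of_ne h0 ?_, lt_of_le_of_ne h1 ?_, rfl⟩
    · rintro rfl
      exact hxP (by rw [edgePoint_zero]; exact hC.pos_mem _)
    · rintro rfl
      exact hxP (by rw [edgePoint_len]; exact hC.pos_mem _)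
  · obtain ⟨t, h0, rfl⟩ := (C.mem_rayImage_iff r x).1 hr
    refine Or.inr ⟨r, t, lt_of_le_of_ne h0 ?_, rfl⟩
    rintro rfl
    exact hxP (by rw [rayPoint_zero]; exact hC.pos_mem _)

theorem openEdge_subset (e : C.E) : C.openEdge e ⊆ C.edgeImage e := by
  rintro x ⟨t, h0, h1, rfl⟩
  exact (C.mem_edgeImage_iff e _).2 ⟨t, h0.le, h1.le, rfl⟩

theorem openRay_subset (r : C.R) : C.openRay r ⊆ C.rayImage r := by
  rintro x ⟨t, h0, rfl⟩
  exact (C.mem_rayImage_iff r _).2 ⟨t, h0.le, rfl⟩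

theorem edgeImage_subset (e : C.E) : C.edgeImage e ⊆ C.image := fun _ h =>
  (C.mem_image_iff _).2 (Or.inr (Or.inl ⟨e, h⟩))

theorem rayImage_subset (r : C.R) : C.rayImage r ⊆ C.image := fun _ h =>
  (C.mem_image_iff _).2 (Or.inr (Or.inr ⟨r, h⟩))

theorem Immersed.inducedWeight_pos (hC : C.Immersed) {x : ℝ × ℝ}
    (hx : (∃ e, x ∈ C.openEdge e) ∨ ∃ r, x ∈ C.openRay r) : 0 < C.inducedWeight x := by
  classical
  unfold inducedWeight
  rcases hx with ⟨e, he⟩ | ⟨r, hr⟩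
  · refine Nat.add_pos_left (lt_of_lt_of_le ?_
      (Finset.single_le_sum (fun e _ => Nat.zero_le _) (Finset.mem_univ e))) _
    rw [if_pos (openEdge_subset e he)]
    exact latticeLength_pos (hC.slope_ne e)
  · refine Nat.add_pos_right _ (lt_of_lt_of_le ?_
      (Finset.single_le_sum (fun e _ => Nat.zero_le _) (Finset.mem_univ r)))
    rw [if_pos (openRay_subset r hr)]
    exact latticeLength_pos (hC.dir_ne r)

/-- Away from `P`, the dual cells of the points of the curve are segments. -/
theorem IsAdapted.collinear {f : Laurent} (hC : C.IsAdapted (tropicalization f) P) {x : ℝ × ℝ}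
    (hx : (activeSet f x).Nontrivial) (hxP : x ∉ P) :
    Collinear ℝ (latticeToReal '' activeSet f x) := by
  apply collinear_of_weight_pos
  rw [← hC.weight_eq x hxP]
  exact hC.immersed.inducedWeight_pos (hC.mem_open hx hxP)

theorem _root_.eventually_notMem_finset (P : Finset (ℝ × ℝ)) (p : ℝ × ℝ) {d : ℝ × ℝ} (hd : d ≠ 0) :
    ∀ᶠ ε in 𝓝[>] (0 : ℝ), p + ε • d ∉ P := by
  have h1 : ∀ x ∈ P, ∀ᶠ ε in 𝓝[>] (0 : ℝ), p + ε • d ≠ x := by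
    intro x _
    by_cases h : ∃ ε₀ : ℝ, p + ε₀ • d = x
    · obtain ⟨ε₀, rfl⟩ := h
      have hinj : ∀ ε : ℝ, p + ε • d = p + ε₀ • d → ε = ε₀ := fun ε h =>
        smul_left_injective ℝ hd (add_left_cancel h)
      by_cases h0 : ε₀ = 0
      · filter_upwards [self_mem_nhdsWithin] with ε hε h
        exact (ne_of_gt hε) ((hinj ε h).trans h0)
      · have : ∀ᶠ ε in 𝓝[>] (0 : ℝ), ε ≠ ε₀ :=
          nhdsWithin_le_nhds (isOpen_ne.mem_nhds (Ne.symm h0))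
        filter_upwards [this] with ε hε h
        exact hε (hinj ε h)
    · push Not at h
      exact Filter.Eventually.of_forall h
  filter_upwards [(Finset.eventually_all P).2 h1] with ε hε hmem
  exact hε _ hmem rfl

theorem _root_.tendsto_add_smul (p d : ℝ × ℝ) :
    Filter.Tendsto (fun ε : ℝ => p + ε • d) (𝓝[>] 0) (𝓝 p) := by
  have : Filter.Tendsto (fun ε : ℝ => p + ε • d) (𝓝 0) (𝓝 (p + (0 : ℝ) • d)) := by
    apply Continuous.tendsto
    fun_prop
  rw [zero_smul, add_zero] at this
  exact this.mono_left nhdsWithin_le_nhds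

theorem isClosed_edgeImage (e : C.E) : IsClosed (C.edgeImage e) := by
  have : C.edgeImage e = C.edgePoint e '' Set.Icc 0 (C.len e) := by
    ext x
    rw [mem_edgeImage_iff]
    constructor
    · rintro ⟨t, h0, h1, rfl⟩; exact ⟨t, ⟨h0, h1⟩, rfl⟩
    · rintro ⟨t, ⟨h0, h1⟩, rfl⟩; exact ⟨t, h0, h1, rfl⟩
  rw [this]
  refine (isCompact_Icc.image ?_).isClosed
  unfold edgePoint
  fun_prop

theorem Immersed.isClosed_rayImage (hC : C.Immersed) (r : C.R) : IsClosed (C.rayImage r) := by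
  have hd := latticeToReal_ne_zero (hC.dir_ne r)
  have : C.rayImage r = C.rayPoint r '' Set.Ici 0 := by
    ext x
    rw [mem_rayImage_iff]
    constructor
    · rintro ⟨t, h0, rfl⟩; exact ⟨t, h0, rfl⟩
    · rintro ⟨t, h0, rfl⟩; exact ⟨t, h0, rfl⟩
  rw [this]
  have h1 : Topology.IsClosedEmbedding fun t : ℝ => t • latticeToReal (C.dir r) :=
    isClosedEmbedding_smul_left hd
  have h2 : Topology.IsClosedEmbedding (C.rayPoint r) :=
    (Homeomorph.addLeft (C.pos (C.base r))).isClosedEmbedding.comp h1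
  exact h2.isClosedMap _ isClosed_Ici

/-- An edge that contains points `p + ε • d` for arbitrarily small `ε > 0` has a flag over `p` in the
direction `d`. -/
theorem IsAdapted.exists_flag_of_edge (hC : C.IsAdapted Γ P) {p d : ℝ × ℝ} (hp : p ∈ P) (hd : d ≠ 0)
    {e : C.E} (h : ∃ᶠ ε in 𝓝[>] (0 : ℝ), p + ε • d ∈ C.edgeImage e) :
    (C.pos (C.src e) = p ∧ ∃ c : ℝ, 0 < c ∧ latticeToReal (C.slope e) = c • d) ∨
      (C.pos (C.tgt e) = p ∧ ∃ c : ℝ, 0 < c ∧ latticeToReal (-C.slope e) = c • d) := by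
  have hpe : p ∈ C.edgeImage e :=
    (isClosed_edgeImage e).mem_of_frequently_of_tendsto h (tendsto_add_smul p d)
  obtain ⟨ε, hmem, hε⟩ := (h.and_eventually self_mem_nhdsWithin).exists
  replace hε : 0 < ε := hε
  obtain ⟨t, h0, h1, ht⟩ := (C.mem_edgeImage_iff e _).1 hmem
  rcases hC.mem_edgeImage hp hpe with rfl | rfl
  · left
    have ht' : ε • d = t • latticeToReal (C.slope e) := add_left_cancel ht
    have ht0 : t ≠ 0 := by
      rintro rfl
      rw [zero_smul] at ht'
      exact hd ((smul_eq_zero.1 ht').resolve_left hε.ne')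
    have htpos := lt_of_le_of_ne h0 ht0.symm
    refine ⟨rfl, ε / t, by positivity, ?_⟩
    rw [div_eq_inv_mul, mul_smul, ht', smul_smul, inv_mul_cancel₀ ht0, one_smul]
  · right
    have ht' : ε • d = (C.len e - t) • latticeToReal (-C.slope e) := by
      rw [edgePoint, C.pos_tgt e, add_assoc] at ht
      have := add_left_cancel ht
      have h2 : latticeToReal (-C.slope e) = -latticeToReal (C.slope e) := by
        ext <;> simp [latticeToReal]
      rw [h2, smul_neg, sub_smul, ← this]
      abel
    have ht0 : C.len e - t ≠ 0 := by
      intro h0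
      rw [h0, zero_smul] at ht'
      exact hd ((smul_eq_zero.1 ht').resolve_left hε.ne')
    have htpos := lt_of_le_of_ne (sub_nonneg.2 h1) ht0.symm
    refine ⟨rfl, ε / (C.len e - t), by positivity, ?_⟩
    rw [div_eq_inv_mul, mul_smul, ht', smul_smul, inv_mul_cancel₀ ht0, one_smul]

/-- A ray that contains points `p + ε • d` for arbitrarily small `ε > 0` starts over `p` in the
direction `d`. -/
theorem IsAdapted.exists_flag_of_ray (hC : C.IsAdapted Γ P) {p d : ℝ × ℝ} (hp : p ∈ P) (hd : d ≠ 0)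
    {r : C.R} (h : ∃ᶠ ε in 𝓝[>] (0 : ℝ), p + ε • d ∈ C.rayImage r) :
    C.pos (C.base r) = p ∧ ∃ c : ℝ, 0 < c ∧ latticeToReal (C.dir r) = c • d := by
  have hpe : p ∈ C.rayImage r :=
    (hC.immersed.isClosed_rayImage r).mem_of_frequently_of_tendsto h (tendsto_add_smul p d)
  obtain ⟨ε, hmem, hε⟩ := (h.and_eventually self_mem_nhdsWithin).exists
  replace hε : 0 < ε := hε
  obtain ⟨t, h0, ht⟩ := (C.mem_rayImage_iff r _).1 hmem
  obtain rfl := hC.mem_rayImage hp hpe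
  have ht' : ε • d = t • latticeToReal (C.dir r) := add_left_cancel ht
  have ht0 : t ≠ 0 := by
    rintro rfl
    rw [zero_smul] at ht'
    exact hd ((smul_eq_zero.1 ht').resolve_left hε.ne')
  have htpos := lt_of_le_of_ne h0 ht0.symm
  refine ⟨rfl, ε / t, by positivity, ?_⟩
  rw [div_eq_inv_mul, mul_smul, ht', smul_smul, inv_mul_cancel₀ ht0, one_smul]

/-- Every direction in which the dual cell of `p` has an edge is the direction of a flag over `p`. -/
theorem IsAdapted.exists_flag {f : Laurent} (hC : C.IsAdapted (tropicalization f) P) {p d : ℝ × ℝ}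
    (hp : p ∈ P) (hd : d ≠ 0) (h : edgeWidth (activeSet f p) d ≠ 0) :
    ∃ σ, C.pos (C.vertex σ) = p ∧ ∃ c : ℝ, 0 < c ∧ latticeToReal (C.vec σ) = c • d := by
  have hnt : (argmin (activeSet f p) (pairing d)).Nontrivial := by
    by_contra hcon
    rw [Set.not_nontrivial_iff] at hcon
    by_cases hne : (argmin (activeSet f p) (pairing d)).Nonempty
    · obtain ⟨i, hi, j, hj, -, hw⟩ := exists_width_eq
        ((activeSet_finite f p).subset (argmin_subset _ (pairing d))) hne (pairing (rot d))
      apply h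
      rw [hcon hi hj, sub_self] at hw
      exact hw
    · rw [Set.not_nonempty_iff_eq_empty] at hne
      apply h
      change width (argmin (activeSet f p) (pairing d)) _ = 0
      rw [hne]
      simp [width]
  have h1 : ∀ᶠ ε in 𝓝[>] (0 : ℝ), (∃ e, p + ε • d ∈ C.edgeImage e) ∨ ∃ r, p + ε • d ∈ C.rayImage r := by
    filter_upwards [eventually_activeSet_add_smul f p d, eventually_notMem_finset P p hd]
      with ε hε hεP
    have : p + ε • d ∈ (tropicalization f).support := by
      change (activeSet f _).Nontrivial
      rwa [hε]
    rcases hC.mem_open this hεP with ⟨e, he⟩ | ⟨r, hr⟩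
    · exact Or.inl ⟨e, openEdge_subset e he⟩
    · exact Or.inr ⟨r, openRay_subset r hr⟩
  by_contra hcon
  push Not at hcon
  have h2 : ∀ e, ∀ᶠ ε in 𝓝[>] (0 : ℝ), p + ε • d ∉ C.edgeImage e := by
    intro e
    by_contra hfr
    rw [Filter.not_eventually] at hfr
    simp only [not_not] at hfr
    rcases hC.exists_flag_of_edge hp hd hfr with ⟨h1, c, hc, h2⟩ | ⟨h1, c, hc, h2⟩
    · exact hcon (Sum.inl e) h1 c hc h2
    · exact hcon (Sum.inr (Sum.inl e)) h1 c hc h2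
  have h3 : ∀ r, ∀ᶠ ε in 𝓝[>] (0 : ℝ), p + ε • d ∉ C.rayImage r := by
    intro r
    by_contra hfr
    rw [Filter.not_eventually] at hfr
    simp only [not_not] at hfr
    obtain ⟨h1, c, hc, h2⟩ := hC.exists_flag_of_ray hp hd hfr
    exact hcon (Sum.inr (Sum.inr r)) h1 c hc h2
  obtain ⟨ε, h4, h5, h6⟩ :=
    (h1.and ((Filter.eventually_all.2 h2).and (Filter.eventually_all.2 h3))).exists
  rcases h4 with ⟨e, he⟩ | ⟨r, hr⟩
  · exact h5 e he
  · exact h6 r hr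

end ParamCurve

namespace ParamCurve

variable {C : ParamCurve} {Γ : WeightedSet} {P : Finset (ℝ × ℝ)}

theorem _root_.latticeLength_neg (u : ℤ × ℤ) : latticeLength (-u) = latticeLength u := by
  simp [latticeLength]

theorem _root_.latticeToReal_neg (u : ℤ × ℤ) : latticeToReal (-u) = -latticeToReal u := by
  ext <;> simp [latticeToReal]

theorem eventually_mem_openEdge_src (e : C.E) :
    ∀ᶠ ε in 𝓝[>] (0 : ℝ), C.pos (C.src e) + ε • latticeToReal (C.slope e) ∈ C.openEdge e := by
  filter_upwards [Ioo_mem_nhdsGT (C.len_pos e)] with ε hε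
  exact ⟨ε, hε.1, hε.2, rfl⟩

theorem eventually_mem_openEdge_tgt (e : C.E) :
    ∀ᶠ ε in 𝓝[>] (0 : ℝ), C.pos (C.tgt e) + ε • latticeToReal (-C.slope e) ∈ C.openEdge e := by
  filter_upwards [Ioo_mem_nhdsGT (C.len_pos e)] with ε hε
  refine ⟨C.len e - ε, by linarith [hε.2], by linarith [hε.1], ?_⟩
  rw [C.pos_tgt, edgePoint, latticeToReal_neg, sub_smul, smul_neg]
  abel

theorem eventually_mem_openRay (r : C.R) :
    ∀ᶠ ε in 𝓝[>] (0 : ℝ), C.pos (C.base r) + ε • latticeToReal (C.dir r) ∈ C.openRay r := by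
  filter_upwards [self_mem_nhdsWithin] with ε hε
  exact ⟨ε, hε, rfl⟩

/-- On a regular curve only one flag leaves a point in a given direction, so that near the point its
lattice length is the whole weight. -/
theorem IsAdapted.eventually_inducedWeight (hC : C.IsAdapted Γ P) (hreg : C.Regular) (σ : C.Flag) :
    ∀ᶠ ε in 𝓝[>] (0 : ℝ), C.inducedWeight (C.pos (C.vertex σ) + ε • latticeToReal (C.vec σ)) =
      latticeLength (C.vec σ) := by
  classical
  have hp := hC.pos_mem (C.vertex σ)
  have hd := latticeToReal_ne_zero (hC.immersed.vec_ne σ)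
  have h1 : ∀ e, ∀ᶠ ε in 𝓝[>] (0 : ℝ),
      (C.pos (C.vertex σ) + ε • latticeToReal (C.vec σ) ∈ C.edgeImage e ↔
        (σ = Sum.inl e ∨ σ = Sum.inr (Sum.inl e))) := by
    intro e
    by_cases h : σ = Sum.inl e ∨ σ = Sum.inr (Sum.inl e)
    · simp only [h, iff_true]
      rcases h with rfl | rfl
      · exact (eventually_mem_openEdge_src e).mono fun _ h => openEdge_subset e h
      · exact (eventually_mem_openEdge_tgt e).mono fun _ h => openEdge_subset e h
    · simp only [h, iff_false]
      by_contra hfr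
      rw [Filter.not_eventually] at hfr
      simp only [not_not] at hfr
      apply h
      rcases hC.exists_flag_of_edge hp hd hfr with ⟨h1, c, hc, h2⟩ | ⟨h1, c, hc, h2⟩
      · exact Or.inl (hreg.flag_eq hC.immersed rfl (τ := Sum.inl e) h1 hc h2)
      · exact Or.inr (hreg.flag_eq hC.immersed rfl (τ := Sum.inr (Sum.inl e)) h1 hc h2)
  have h2 : ∀ r, ∀ᶠ ε in 𝓝[>] (0 : ℝ),
      (C.pos (C.vertex σ) + ε • latticeToReal (C.vec σ) ∈ C.rayImage r ↔
        σ = Sum.inr (Sum.inr r)) := by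
    intro r
    by_cases h : σ = Sum.inr (Sum.inr r)
    · simp only [h, iff_true]
      exact (eventually_mem_openRay r).mono fun _ h => openRay_subset r h
    · simp only [h, iff_false]
      by_contra hfr
      rw [Filter.not_eventually] at hfr
      simp only [not_not] at hfr
      obtain ⟨h1, c, hc, h2⟩ := hC.exists_flag_of_ray hp hd hfr
      exact h (hreg.flag_eq hC.immersed rfl (τ := Sum.inr (Sum.inr r)) h1 hc h2)
  filter_upwards [Filter.eventually_all.2 h1, Filter.eventually_all.2 h2] with ε h3 h4
  unfold inducedWeight
  simp only [h3, h4]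
  rcases σ with e | e | r
  · simp [vec]
  · simp [vec, latticeLength_neg]
  · simp [vec]

/-- On a regular curve, the edge of the dual cell in the direction of a flag is as long as the
flag. -/
theorem IsAdapted.edgeWidth_vec {f : Laurent} (hf : f ≠ 0)
    (hC : C.IsAdapted (tropicalization f) P) (hreg : C.Regular) (σ : C.Flag) :
    edgeWidth (activeSet f (C.pos (C.vertex σ))) (latticeToReal (C.vec σ)) =
      normSq (latticeToReal (C.vec σ)) := by
  have hu := hC.immersed.vec_ne σ
  obtain ⟨ε, h1, h2, h3⟩ := ((hC.eventually_inducedWeight hreg σ).and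
    ((eventually_activeSet_add_smul f (C.pos (C.vertex σ)) (latticeToReal (C.vec σ))).and
      (eventually_notMem_finset P (C.pos (C.vertex σ)) (latticeToReal_ne_zero hu)))).exists
  have h4 := weight_mul_normSq hf (x := C.pos (C.vertex σ) + ε • latticeToReal (C.vec σ)) hu (by
    rw [h2]
    exact fun a ha b hb => argmin_eq_of_mem ha hb)
  rw [← hC.weight_eq _ h3, h1, h2, mul_comm] at h4
  have h5 : (latticeLength (C.vec σ) : ℝ) ≠ 0 := by exact_mod_cast (latticeLength_pos hu).ne'
  exact (mul_right_cancel₀ h5 h4).symm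

/-! ### Irreducibility -/

/-- The face of the dual cell of a factor is constant along a segment on which the dual cells are
orthogonal to the segment. -/
theorem _root_.activeSet_eq_of_line {f₁ f₂ : Laurent} (h₁ : f₁ ≠ 0) (h₂ : f₂ ≠ 0) {y w : ℝ × ℝ} (hw : w ≠ 0)
    {I : Set ℝ} (hI : _root_.IsPreconnected I) (h : ∀ t ∈ I, ∀ a ∈ activeSet (f₁ * f₂) (y + t • w),
      ∀ b ∈ activeSet (f₁ * f₂) (y + t • w), pairing w a = pairing w b)
    {t t' : ℝ} (ht : t ∈ I) (ht' : t' ∈ I) :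
    activeSet f₁ (y + t • w) = activeSet f₁ (y + t' • w) := by
  have hconst : ∀ t ∈ I, ∀ a ∈ activeSet f₁ (y + t • w), ∀ b ∈ activeSet f₁ (y + t • w),
      pairing w a = pairing w b := by
    intro t ht
    have hprod := isProductLike_tropMonomial f₁ f₂ (y + t • w)
    obtain ⟨a₁, ha₁, b₁, hb₁, -, -, hab₁, -⟩ := hprod.exists_extremal f₁.coeff.support.finite_toSet
      f₂.coeff.support.finite_toSet (support_nonempty_of_ne_zero h₁)
      (support_nonempty_of_ne_zero h₂) hw (pairing (rot w)) (pairing_add _) (fun _ _ h => h)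
    have hw' : -w ≠ 0 := neg_ne_zero.2 hw
    obtain ⟨a₂, ha₂, b₂, hb₂, -, -, hab₂, -⟩ := hprod.exists_extremal f₁.coeff.support.finite_toSet
      f₂.coeff.support.finite_toSet (support_nonempty_of_ne_zero h₁)
      (support_nonempty_of_ne_zero h₂) hw' (pairing (rot (-w))) (pairing_add _) (fun _ _ h => h)
    have hneg : ∀ u, pairing (-w) u = -pairing w u := fun u => by
      rw [pairing_eq, pairing_eq]; simp; ring
    have h3 := h t ht _ hab₁ _ hab₂
    rw [pairing_add, pairing_add] at h3
    have h4 := ha₁.2 a₂ ha₂.1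
    have h5 := hb₁.2 b₂ hb₂.1
    have key : ∀ a ∈ activeSet f₁ (y + t • w), pairing w a = pairing w a₁ := by
      intro a ha
      have h6 := ha₁.2 a ha
      have h7 := ha₂.2 a ha
      rw [hneg, hneg] at h7
      linarith
    exact fun a ha b hb => (key a ha).trans (key b hb).symm
  have hface : ∀ t ∈ I, ∀ d, (d = w ∨ d = -w) →
      argmin (activeSet f₁ (y + t • w)) (pairing d) = activeSet f₁ (y + t • w) := by
    intro t ht d hd
    refine Set.Subset.antisymm (argmin_subset _ _) fun a ha => ⟨ha, fun b hb => ?_⟩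
    have := hconst t ht a ha b hb
    rcases hd with rfl | rfl
    · exact this.le
    · rw [pairing_eq, pairing_eq] at this ⊢
      simp only [Prod.fst_neg, Prod.snd_neg]
      linarith
  refine hI.induction₂ (fun t t' => activeSet f₁ (y + t • w) = activeSet f₁ (y + t' • w)) ?_
    (fun a b c _ _ _ h1 h2 => h1.trans h2) (fun a b _ _ h => h.symm) ht ht'
  intro t ht
  apply nhdsWithin_le_nhds
  have hr := eventually_activeSet_add_smul f₁ (y + t • w) w
  have hl := eventually_activeSet_add_smul f₁ (y + t • w) (-w)
  rw [hface t ht w (Or.inl rfl)] at hr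
  rw [hface t ht (-w) (Or.inr rfl)] at hl
  rw [eventually_nhdsWithin_iff, Metric.eventually_nhds_iff] at hr hl
  obtain ⟨r₁, hr₁, H₁⟩ := hr
  obtain ⟨r₂, hr₂, H₂⟩ := hl
  change ∀ᶠ t' in 𝓝 t, activeSet f₁ (y + t • w) = activeSet f₁ (y + t' • w)
  rw [Metric.eventually_nhds_iff]
  refine ⟨min r₁ r₂, lt_min hr₁ hr₂, fun {t'} ht' => ?_⟩
  have hlt₁ := lt_of_lt_of_le ht' (min_le_left _ _)
  have hlt₂ := lt_of_lt_of_le ht' (min_le_right _ _)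
  rw [Real.dist_eq] at hlt₁ hlt₂
  rcases lt_trichotomy t t' with hlt | rfl | hlt
  · have := H₁ (y := t' - t) (by simpa [Real.dist_eq] using hlt₁) (by simpa using hlt)
    rw [← this, add_assoc, ← add_smul, add_sub_cancel]
  · rfl
  · have := H₂ (y := t - t') (by simpa [Real.dist_eq, abs_sub_comm] using hlt₂) (by simpa using hlt)
    rw [← this, add_assoc, smul_neg, ← sub_eq_add_neg, ← sub_smul, sub_sub_cancel]

/-- Along an open edge, the dual cells are orthogonal to the edge. -/
theorem IsAdapted.pairing_eq_of_openEdge {f : Laurent} (hC : C.IsAdapted (tropicalization f) P)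
    (e : C.E) {t : ℝ} (ht : t ∈ Set.Ioo 0 (C.len e)) :
    ∀ a ∈ activeSet f (C.edgePoint e t), ∀ b ∈ activeSet f (C.edgePoint e t),
      pairing (latticeToReal (C.slope e)) a = pairing (latticeToReal (C.slope e)) b := by
  have hmem : C.edgePoint e t ∈ C.openEdge e := ⟨t, ht.1, ht.2, rfl⟩
  have hsupp : ∀ t ∈ Set.Ioo 0 (C.len e), (activeSet f (C.edgePoint e t)).Nontrivial := by
    intro t ht
    change _ ∈ (tropicalization f).support
    rw [← hC.image_eq]
    exact edgeImage_subset e (openEdge_subset e ⟨t, ht.1, ht.2, rfl⟩)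
  refine pairing_eq_of_argmin_nontrivial (hC.collinear (hsupp t ht)
    fun h => hC.subdivided.edge e _ h hmem) ?_
  obtain ⟨ε, h1, h2⟩ := ((eventually_activeSet_add_smul f (C.edgePoint e t)
    (latticeToReal (C.slope e))).and (Ioo_mem_nhdsGT (sub_pos.2 ht.2))).exists
  rw [← h1]
  have : C.edgePoint e t + ε • latticeToReal (C.slope e) = C.edgePoint e (t + ε) := by
    rw [edgePoint, edgePoint, add_smul, add_assoc]
  rw [this]
  exact hsupp _ ⟨by linarith [ht.1, h2.1], by linarith [h2.2]⟩

/-- Along an open ray, the dual cells are orthogonal to the ray. -/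
theorem IsAdapted.pairing_eq_of_openRay {f : Laurent} (hC : C.IsAdapted (tropicalization f) P)
    (r : C.R) {t : ℝ} (ht : t ∈ Set.Ioi 0) :
    ∀ a ∈ activeSet f (C.rayPoint r t), ∀ b ∈ activeSet f (C.rayPoint r t),
      pairing (latticeToReal (C.dir r)) a = pairing (latticeToReal (C.dir r)) b := by
  have hmem : C.rayPoint r t ∈ C.openRay r := ⟨t, ht, rfl⟩
  have hsupp : ∀ t ∈ Set.Ioi (0 : ℝ), (activeSet f (C.rayPoint r t)).Nontrivial := by
    intro t ht
    change _ ∈ (tropicalization f).support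
    rw [← hC.image_eq]
    exact rayImage_subset r (openRay_subset r ⟨t, ht, rfl⟩)
  refine pairing_eq_of_argmin_nontrivial (hC.collinear (hsupp t ht)
    fun h => hC.subdivided.ray r _ h hmem) ?_
  obtain ⟨ε, h1, h2⟩ := ((eventually_activeSet_add_smul f (C.rayPoint r t)
    (latticeToReal (C.dir r))).and self_mem_nhdsWithin).exists
  rw [← h1]
  have : C.rayPoint r t + ε • latticeToReal (C.dir r) = C.rayPoint r (t + ε) := by
    rw [rayPoint, rayPoint, add_smul, add_assoc]
  rw [this]
  exact hsupp _ (add_pos ht h2)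

/-- A union of connected components contains all active vertices or none of them. -/
def IsConnected (C : ParamCurve) : Prop :=
  ∀ S : Set C.V, (∀ e, C.src e ∈ S ↔ C.tgt e ∈ S) → ∀ v w, C.Active v → C.Active w → v ∈ S → w ∈ S

theorem _root_.activeSet_add_smul (f : Laurent) (v w : ℝ × ℝ) (t : ℝ) : activeSet f (v + t • w) =
    argmin (f.coeff.support : Set (ℤ × ℤ)) (fun u => pairing w u * t + tropMonomial f u v) := by
  rw [activeSet_eq_argmin]
  congr 1
  ext u
  rw [tropMonomial_add_smul]
  ring

theorem _root_.finsum_width_activeSet {f : Laurent} (hf : f ≠ 0) (v w : ℝ × ℝ) :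
    ∑ᶠ t : ℝ, width (activeSet f (v + t • w)) (pairing w) =
      width (f.coeff.support : Set (ℤ × ℤ)) (pairing w) := by
  simp only [activeSet_add_smul]
  exact finsum_width_argmin _ _ f.coeff.support.finite_toSet (support_nonempty_of_ne_zero hf)

theorem _root_.width_eq_zero_of_subsingleton {ι : Type*} {B : Set ι} (hB : B.Subsingleton) (s : ι → ℝ) :
    width B s = 0 := by
  rcases hB.eq_empty_or_singleton with rfl | ⟨i, rfl⟩
  · simp [width]
  · simp [width]

theorem _root_.eq_of_width_eq_zero {ι : Type*} {B : Set ι} (hB : B.Finite) {s : ι → ℝ} (h : width B s = 0)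
    {i j : ι} (hi : i ∈ B) (hj : j ∈ B) : s i = s j := by
  have h1 := sub_le_width hB (s := s) hi hj
  have h2 := sub_le_width hB (s := s) hj hi
  linarith

/-- A Laurent polynomial without corner locus is a monomial. -/
theorem _root_.support_subsingleton {f : Laurent} (h : ∀ x, (activeSet f x).Subsingleton) :
    (f.coeff.support : Set (ℤ × ℤ)).Subsingleton := by
  intro i hi j hj
  have hf : f ≠ 0 := by
    rintro rfl
    simp at hi
  have key : ∀ w, pairing w i = pairing w j := by
    intro w
    have h1 := finsum_width_activeSet hf 0 w
    simp only [width_eq_zero_of_subsingleton (h _), finsum_zero] at h1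
    exact eq_of_width_eq_zero f.coeff.support.finite_toSet h1.symm hi hj
  exact eq_of_pairing_eq (d := (1, 0)) (by simp) (key _) (key _)

/-- The share of a factor `f₁` in the flag `σ` of the tropical curve of a multiple of `f₁`. -/
def share (C : ParamCurve) (f₁ : Laurent) (σ : C.Flag) : ℝ :=
  edgeWidth (activeSet f₁ (C.pos (C.vertex σ))) (latticeToReal (C.vec σ)) /
    normSq (latticeToReal (C.vec σ))

section Factor

variable {f₁ f₂ : Laurent} (h₁ : f₁ ≠ 0) (h₂ : f₂ ≠ 0)

include h₁ h₂ in
theorem _root_.edgeWidth_activeSet_mul (x : ℝ × ℝ) {d : ℝ × ℝ} (hd : d ≠ 0) :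
    edgeWidth (activeSet (f₁ * f₂) x) d =
      edgeWidth (activeSet f₁ x) d + edgeWidth (activeSet f₂ x) d :=
  (isProductLike_tropMonomial f₁ f₂ x).edgeWidth_add f₁.coeff.support.finite_toSet
    f₂.coeff.support.finite_toSet (support_nonempty_of_ne_zero h₁) (support_nonempty_of_ne_zero h₂)
    hd

theorem _root_.edgeWidth_nonneg {f : Laurent} (hf : f ≠ 0) (x d : ℝ × ℝ) :
    0 ≤ edgeWidth (activeSet f x) d :=
  width_nonneg ((activeSet_finite f x).subset (argmin_subset _ _))
    (argmin_nonempty (activeSet_finite f x) (activeSet_nonempty hf x) _) _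

include h₁ h₂ in
theorem _root_.edgeWidth_activeSet_mul_ne_zero (x : ℝ × ℝ) {d : ℝ × ℝ} (hd : d ≠ 0)
    (h : edgeWidth (activeSet f₁ x) d ≠ 0) : edgeWidth (activeSet (f₁ * f₂) x) d ≠ 0 := by
  rw [edgeWidth_activeSet_mul h₁ h₂ x hd]
  have h1 := edgeWidth_nonneg h₁ x d
  have h2 := edgeWidth_nonneg h₂ x d
  have h3 := lt_of_le_of_ne h1 (Ne.symm h)
  linarith

variable (hC : C.IsAdapted (tropicalization (f₁ * f₂)) P)

include h₁ h₂ hC in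
theorem share_add_share (hreg : C.Regular) (σ : C.Flag) : C.share f₁ σ + C.share f₂ σ = 1 := by
  have hu := hC.immersed.vec_ne σ
  rw [share, share, ← add_div, ← edgeWidth_activeSet_mul h₁ h₂ _ (latticeToReal_ne_zero hu),
    hC.edgeWidth_vec (mul_ne_zero h₁ h₂) hreg, div_self (normSq_latticeToReal_pos hu).ne']

include h₁ h₂ hC in
/-- On a regular curve, the share of a factor is the same in all flags at a vertex. -/
theorem exists_share_eq_vertex (hreg : C.Regular) :
    ∃ φ : C.V → ℝ, ∀ σ, C.share f₁ σ = φ (C.vertex σ) := by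
  classical
  -- the edges of the dual cell of `f₁` close up: the slopes of the flags over `p`, weighted by the
  -- shares of `f₁`, satisfy a linear relation, to which regularity applies
  have key : ∀ p, ∃ φ : C.V → ℝ, ∀ σ, C.pos (C.vertex σ) = p → C.share f₁ σ = φ (C.vertex σ) := by
    intro p
    by_cases hv : ∃ v, C.pos v = p
    swap
    · exact ⟨0, fun σ h => absurd ⟨_, h⟩ hv⟩
    obtain ⟨v, hv⟩ := hv
    have hp : p ∈ P := by rw [← hv]; exact hC.pos_mem v
    have hclosed := sum_faceWidth_smul_eq_zero (fun u : ℤ × ℤ => (u.1 : ℝ)) (fun u => (u.2 : ℝ))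
      (activeSet_finite f₁ p) (activeSet_nonempty h₁ p)
      (fun σ : {σ : C.Flag // C.pos (C.vertex σ) = p} => latticeToReal (C.vec σ))
      (fun σ τ c hc h => Subtype.ext (hreg.flag_eq hC.immersed σ.2 τ.2 hc h)) (by
        intro e he hne
        obtain ⟨σ, hσ, c, hc, h⟩ := hC.exists_flag hp he
          (edgeWidth_activeSet_mul_ne_zero h₁ h₂ p he hne)
        exact ⟨⟨σ, hσ⟩, c, hc, h⟩)
    obtain ⟨φ, hφ⟩ := hreg.exists_eq_vertex hC.immersed p
      (fun σ => if C.pos (C.vertex σ) = p then C.share f₁ σ else 0) (fun σ h => if_neg h) (by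
        rw [← sum_subtype_of_eq_zero (fun σ => C.pos (C.vertex σ) = p) _ (by
          intro σ hσ
          rw [if_neg hσ, zero_smul])]
        refine Eq.trans (Finset.sum_congr rfl fun σ _ => ?_) hclosed
        rw [if_pos σ.2, share, σ.2])
    exact ⟨φ, fun σ hσ => by rw [← hφ σ hσ, if_pos hσ]⟩
  choose φ hφ using key
  exact ⟨fun v => φ (C.pos v) v, fun σ => hφ _ σ rfl⟩

include h₁ h₂ hC in
/-- Along an open edge, the dual cell of a factor is the corresponding face of its dual cell at the
source of the edge. -/
theorem activeSet_edgePoint_eq_src (e : C.E) {t : ℝ} (ht : t ∈ Set.Ioo 0 (C.len e)) :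
    activeSet f₁ (C.edgePoint e t) = argmin (activeSet f₁ (C.pos (C.src e)))
      (pairing (latticeToReal (C.slope e))) := by
  obtain ⟨ε, h3, h4⟩ := ((eventually_activeSet_add_smul f₁ (C.pos (C.src e))
    (latticeToReal (C.slope e))).and (Ioo_mem_nhdsGT (C.len_pos e))).exists
  rw [← h3]
  exact activeSet_eq_of_line h₁ h₂ (latticeToReal_ne_zero (hC.immersed.slope_ne e))
    isPreconnected_Ioo (fun t ht => hC.pairing_eq_of_openEdge e ht) ht h4

include h₁ h₂ hC in
theorem activeSet_edgePoint_eq_tgt (e : C.E) {t : ℝ} (ht : t ∈ Set.Ioo 0 (C.len e)) :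
    activeSet f₁ (C.edgePoint e t) = argmin (activeSet f₁ (C.pos (C.tgt e)))
      (pairing (latticeToReal (-C.slope e))) := by
  obtain ⟨ε, h3, h4⟩ := ((eventually_activeSet_add_smul f₁ (C.pos (C.tgt e))
    (latticeToReal (-C.slope e))).and (Ioo_mem_nhdsGT (C.len_pos e))).exists
  rw [← h3]
  have : C.pos (C.tgt e) + ε • latticeToReal (-C.slope e) = C.edgePoint e (C.len e - ε) := by
    rw [C.pos_tgt, edgePoint, latticeToReal_neg, sub_smul, smul_neg]
    abel
  rw [this]
  exact activeSet_eq_of_line h₁ h₂ (latticeToReal_ne_zero (hC.immersed.slope_ne e))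
    isPreconnected_Ioo (fun t ht => hC.pairing_eq_of_openEdge e ht) ht
    ⟨by linarith [h4.2], by linarith [h4.1]⟩

include h₁ h₂ hC in
theorem activeSet_rayPoint_eq (r : C.R) {t : ℝ} (ht : t ∈ Set.Ioi 0) :
    activeSet f₁ (C.rayPoint r t) = argmin (activeSet f₁ (C.pos (C.base r)))
      (pairing (latticeToReal (C.dir r))) := by
  obtain ⟨ε, h3, h4⟩ := ((eventually_activeSet_add_smul f₁ (C.pos (C.base r))
    (latticeToReal (C.dir r))).and self_mem_nhdsWithin).exists
  rw [← h3]
  exact activeSet_eq_of_line h₁ h₂ (latticeToReal_ne_zero (hC.immersed.dir_ne r))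
    isPreconnected_Ioi (fun t ht => hC.pairing_eq_of_openRay r ht) ht h4

include h₁ h₂ hC in
/-- The share of a factor is constant along an edge. -/
theorem share_src_eq_tgt (e : C.E) : C.share f₁ (Sum.inl e) = C.share f₁ (Sum.inr (Sum.inl e)) := by
  have ht : C.len e / 2 ∈ Set.Ioo 0 (C.len e) := by
    have := C.len_pos e
    constructor <;> linarith
  have h3 := activeSet_edgePoint_eq_src h₁ h₂ hC e ht
  have h4 := activeSet_edgePoint_eq_tgt h₁ h₂ hC e ht
  have hN : normSq (latticeToReal (-C.slope e)) = normSq (latticeToReal (C.slope e)) := by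
    simp [normSq, latticeToReal]
  change width (argmin (activeSet f₁ (C.pos (C.src e))) (pairing (latticeToReal (C.slope e))))
      (pairing (rot (latticeToReal (C.slope e)))) / normSq (latticeToReal (C.slope e)) =
    width (argmin (activeSet f₁ (C.pos (C.tgt e))) (pairing (latticeToReal (-C.slope e))))
      (pairing (rot (latticeToReal (-C.slope e)))) / normSq (latticeToReal (-C.slope e))
  rw [hN, ← h3, ← h4]
  congr 1
  refine width_congr_neg (activeSet_finite _ _) fun i _ j _ => ?_
  rw [pairing_eq, pairing_eq, pairing_eq, pairing_eq]
  simp [rot, latticeToReal]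
  ring

include h₁ h₂ hC in
/-- On a regular connected curve, the share of a factor is the same in all flags: it is constant at
every vertex and along every edge. -/
theorem exists_share_eq (hreg : C.Regular) (hconn : C.IsConnected) :
    ∃ c, ∀ σ, C.share f₁ σ = c := by
  obtain ⟨φ, hφ⟩ := exists_share_eq_vertex h₁ h₂ hC hreg
  by_cases h : Nonempty C.Flag
  · obtain ⟨σ₀⟩ := h
    refine ⟨φ (C.vertex σ₀), fun σ => ?_⟩
    rw [hφ]
    refine hconn {v | φ v = φ (C.vertex σ₀)} (fun e => ?_) _ _ ⟨σ₀, rfl⟩ ⟨σ, rfl⟩ rfl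
    have h3 := share_src_eq_tgt h₁ h₂ hC e
    rw [hφ, hφ] at h3
    change φ (C.src e) = φ (C.tgt e) at h3
    simp only [Set.mem_ofPred_eq, h3]
  · exact ⟨0, fun σ => absurd ⟨σ⟩ h⟩

/-- In a flag of lattice length one, the share of a factor is the lattice length of an edge of its dual
cell, hence an integer. -/
theorem exists_nat_eq_share {f : Laurent} (hf : f ≠ 0) (σ : C.Flag)
    (hσ : latticeLength (C.vec σ) = 1) : ∃ m : ℕ, C.share f σ = m := by
  have hu : C.vec σ ≠ 0 := by
    intro h
    rw [h] at hσ
    simp [latticeLength] at hσ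
  obtain ⟨i, hi, j, hj, hij, hw⟩ := exists_argmin_width_eq (activeSet_finite f (C.pos (C.vertex σ)))
    (activeSet_nonempty hf (C.pos (C.vertex σ))) (latticeToReal (C.vec σ))
  have h3 := latticeLength_mul_normSq hu (orthogonal_of_pairing_eq (argmin_eq_of_mem hi hj))
  rw [hσ, Nat.cast_one, mul_one, pairing_sub, abs_of_nonneg (by linarith [(hij i hi).1]), ← hw] at h3
  refine ⟨latticeLength (i - j), ?_⟩
  rw [share, ← h3, mul_div_cancel_right₀ _ (normSq_latticeToReal_pos hu).ne']

include h₁ h₂ hC in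
/-- A factor without share in any flag is a monomial: its dual cells are points. -/
theorem support_subsingleton_of_share_eq_zero (h0 : ∀ σ, C.share f₁ σ = 0) :
    (f₁.coeff.support : Set (ℤ × ℤ)).Subsingleton := by
  have h0' : ∀ σ, edgeWidth (activeSet f₁ (C.pos (C.vertex σ))) (latticeToReal (C.vec σ)) = 0 :=
    fun σ => (div_eq_zero_iff.1 (h0 σ)).resolve_right
      (normSq_latticeToReal_pos (hC.immersed.vec_ne σ)).ne'
  have hface : ∀ σ, (argmin (activeSet f₁ (C.pos (C.vertex σ)))
      (pairing (latticeToReal (C.vec σ)))).Subsingleton := fun σ i hi j hj =>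
    eq_of_pairing_eq (latticeToReal_ne_zero (hC.immersed.vec_ne σ)) (argmin_eq_of_mem hi hj)
      (eq_of_width_eq_zero ((activeSet_finite _ _).subset (argmin_subset _ _)) (h0' σ) hi hj)
  refine support_subsingleton fun x => ?_
  by_contra hcon
  rw [Set.not_subsingleton_iff] at hcon
  obtain ⟨d, hd, hne⟩ := exists_edgeWidth_ne_zero (activeSet_finite f₁ x) hcon
  have hne' := edgeWidth_activeSet_mul_ne_zero h₁ h₂ x hd hne
  by_cases hx : x ∈ P
  · obtain ⟨σ, rfl, c, hc, h⟩ := hC.exists_flag hx hd hne'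
    have := h0' σ
    rw [h, edgeWidth, faceWidth_smul _ _ (activeSet_finite _ _) hc] at this
    exact hne ((mul_eq_zero.1 this).resolve_left hc.ne')
  · have hsupp : x ∈ (tropicalization (f₁ * f₂)).support := by
      by_contra hns
      apply hne'
      exact width_eq_zero_of_subsingleton
        ((Set.not_nontrivial_iff.1 hns).anti (argmin_subset _ _)) _
    rcases hC.mem_open hsupp hx with ⟨e, t, h3, h4, rfl⟩ | ⟨r, t, h3, rfl⟩
    · rw [activeSet_edgePoint_eq_src h₁ h₂ hC e ⟨h3, h4⟩] at hcon
      exact Set.not_subsingleton_iff.2 hcon (hface (Sum.inl e))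
    · rw [activeSet_rayPoint_eq h₁ h₂ hC r h3] at hcon
      exact Set.not_subsingleton_iff.2 hcon (hface (Sum.inr (Sum.inr r)))

end Factor

/-- A Laurent polynomial whose tropicalization has a regular connected parameterization with a
primitive ray has only trivial factorizations. -/
theorem IsAdapted.support_subsingleton_or {f₁ f₂ : Laurent} (h : f₁ * f₂ ≠ 0)
    (hC : C.IsAdapted (tropicalization (f₁ * f₂)) P) (hreg : C.Regular) (hconn : C.IsConnected)
    (r : C.R) (hr : latticeLength (C.dir r) = 1) :
    (f₁.coeff.support : Set (ℤ × ℤ)).Subsingleton ∨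
      (f₂.coeff.support : Set (ℤ × ℤ)).Subsingleton := by
  -- the constant shares of `f₁` and `f₂` are integers by the primitive ray, with sum one
  have h₁ := left_ne_zero_of_mul h
  have h₂ := right_ne_zero_of_mul h
  have hC' : C.IsAdapted (tropicalization (f₂ * f₁)) P := by rwa [mul_comm]
  obtain ⟨c₁, hc₁⟩ := exists_share_eq h₁ h₂ hC hreg hconn
  obtain ⟨c₂, hc₂⟩ := exists_share_eq h₂ h₁ hC' hreg hconn
  obtain ⟨m₁, hm₁⟩ := exists_nat_eq_share h₁ (Sum.inr (Sum.inr r)) hr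
  obtain ⟨m₂, hm₂⟩ := exists_nat_eq_share h₂ (Sum.inr (Sum.inr r)) hr
  have hadd := share_add_share h₁ h₂ hC hreg (Sum.inr (Sum.inr r))
  rw [hm₁, hm₂] at hadd
  have hadd' : m₁ + m₂ = 1 := by exact_mod_cast hadd
  rcases Nat.eq_zero_or_pos m₁ with h0 | h0
  · left
    refine support_subsingleton_of_share_eq_zero h₁ h₂ hC fun σ => ?_
    rw [hc₁ σ, ← hc₁ (Sum.inr (Sum.inr r)), hm₁, h0, Nat.cast_zero]
  · right
    refine support_subsingleton_of_share_eq_zero h₂ h₁ hC' fun σ => ?_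
    rw [hc₂ σ, ← hc₂ (Sum.inr (Sum.inr r)), hm₂, show m₂ = 0 by omega, Nat.cast_zero]

end ParamCurve

/-! ### The dimension count -/

namespace ParamCurve

variable (C : ParamCurve)

theorem stratum_subset : C.stratum ⊆ C.deformations := by
  rintro q ⟨h1, h2⟩
  refine ⟨fun e => ?_, fun v w h => (h2 v w).2 h⟩
  obtain ⟨l, -, hl⟩ := h1 e
  rw [hl, add_sub_cancel_left]
  simp only [planeDet, Prod.smul_fst, Prod.smul_snd, smul_eq_mul]
  ring

/-- Evaluation at marked vertices, as a linear map. -/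
def evalMap {k : ℕ} (m : Fin k → C.V) : (C.V → ℝ × ℝ) →ₗ[ℝ] (Fin k → ℝ × ℝ) :=
  LinearMap.funLeft ℝ (ℝ × ℝ) m

theorem map_evalMap_eq_top {k : ℕ} (m : Fin k → C.V)
    (h : (interior (C.eval m '' C.stratum)).Nonempty) : C.deformations.map (C.evalMap m) = ⊤ := by
  refine Submodule.eq_top_of_nonempty_interior' _ (h.mono (interior_mono ?_))
  rintro _ ⟨q, hq, rfl⟩
  exact ⟨q, C.stratum_subset hq, rfl⟩

/-- If the marked vertices can be moved independently, the moments of the deformations have dimension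
at least the number of marked vertices: move every marked vertex across one of its flags. -/
theorem le_finrank_moments {k : ℕ} (m : Fin k → C.V) (hC : C.Immersed)
    (hm : ∀ i, C.Active (m i)) (h : C.deformations.map (C.evalMap m) = ⊤) :
    k ≤ Module.finrank ℝ (C.deformations.map C.moments) := by
  choose σ hσ using hm
  -- the moments of one flag at every marked vertex
  let T : (C.E ⊕ C.R → ℝ) →ₗ[ℝ] (Fin k → ℝ) :=
    { toFun := fun o i => C.flagValue o (σ i)
      map_add' := fun a b => by
        ext i
        rcases hi : σ i with e | e | r <;> simp [flagValue, hi]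
        ring
      map_smul' := fun c a => by
        ext i
        rcases hi : σ i with e | e | r <;> simp [flagValue, hi] }
  have hT : (C.deformations.map C.moments).map T = ⊤ := by
    rw [eq_top_iff]
    intro y _
    have hy : (fun i => (y i / normSq (latticeToReal (C.vec (σ i)))) •
        (-(rot (latticeToReal (C.vec (σ i)))))) ∈ C.deformations.map (C.evalMap m) := by
      rw [h]; trivial
    obtain ⟨q, hq, hqy⟩ := hy
    refine ⟨C.moments q, ⟨q, hq, rfl⟩, ?_⟩
    ext i
    have h1 : q (m i) = _ := congrFun hqy i
    change C.flagValue (C.moments q) (σ i) = y i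
    rw [flagValue_moments hq, hσ, h1]
    have h2 := (normSq_latticeToReal_pos (hC.vec_ne (σ i))).ne'
    simp only [planeDet, rot, Prod.smul_fst, Prod.smul_snd, smul_eq_mul, Prod.fst_neg,
      Prod.snd_neg]
    field_simp
    unfold normSq
    ring
  have h3 := Submodule.finrank_map_le T (C.deformations.map C.moments)
  rwa [hT, finrank_top, Module.finrank_fin_fun] at h3

open Classical in
/-- The conservation conditions of flows without sources at the active vertices are linearly
independent. -/
theorem finrank_ker_flow_add_le (hC : C.Immersed) :
    Module.finrank ℝ (LinearMap.ker C.flow) + Fintype.card {v // C.Active v} ≤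
      Fintype.card C.E + Fintype.card C.R := by
  let π : (C.V → ℝ) →ₗ[ℝ] ({v // C.Active v} → ℝ) := LinearMap.funLeft ℝ ℝ Subtype.val
  have hsurj : Function.Surjective (π ∘ₗ C.flow) := by
    rw [← LinearMap.dualMap_injective_iff, injective_iff_map_eq_zero]
    intro ψ hψ
    let φ : C.V → ℝ := fun v => if h : C.Active v then ψ (Pi.single ⟨v, h⟩ 1) else 0
    have h1 : ∀ o, ∑ v, φ v * C.flow o v = 0 := by
      intro o
      have h2 : ψ (π (C.flow o)) = 0 := LinearMap.congr_fun hψ o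
      rw [← Finset.univ_sum_single (π (C.flow o)), map_sum] at h2
      rw [← h2, ← sum_subtype_of_eq_zero C.Active _ (by
        intro v hv
        simp only [φ, dif_neg hv, zero_mul])]
      refine Finset.sum_congr rfl fun v _ => ?_
      have : (Pi.single v (π (C.flow o) v) : {v // C.Active v} → ℝ) =
          C.flow o v • Pi.single v 1 := by
        rw [← Pi.single_smul, smul_eq_mul, mul_one]
        rfl
      rw [this, map_smul, smul_eq_mul, mul_comm]
      simp only [φ, dif_pos v.2]
    have h2 : ∀ v, C.Active v → φ v = 0 := by
      intro v hv
      refine hC.eq_zero_of_flag φ (fun e => ?_) (fun r => ?_) hv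
      · have := h1 (Pi.single (Sum.inl e) 1)
        rw [sum_mul_flow, C.sum_mul_flagValue (fun σ => φ (C.vertex σ))] at this
        simpa [Pi.single_apply, vertex, sub_eq_zero] using this
      · have := h1 (Pi.single (Sum.inr r) 1)
        rw [sum_mul_flow, C.sum_mul_flagValue (fun σ => φ (C.vertex σ))] at this
        simpa [Pi.single_apply, vertex] using this
    refine LinearMap.pi_ext' fun v => LinearMap.ext_ring ?_
    have := h2 v.1 v.2
    simp only [φ, dif_pos v.2] at this
    simpa using this
  have h1 := LinearMap.finrank_range_add_finrank_ker (π ∘ₗ C.flow)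
  rw [LinearMap.range_eq_top.2 hsurj, finrank_top, Module.finrank_fintype_fun_eq_card,
    Module.finrank_fintype_fun_eq_card, Fintype.card_sum] at h1
  have h2 : Module.finrank ℝ (LinearMap.ker C.flow) ≤
      Module.finrank ℝ (LinearMap.ker (π ∘ₗ C.flow)) :=
    Submodule.finrank_mono (LinearMap.ker_le_ker_comp _ _)
  omega

open Classical in
/-- The boundary map, with values at the active vertices. -/
def activeBoundary : (C.E → ℚ) →ₗ[ℚ] ({v // C.Active v} → ℚ) where
  toFun c v := (∑ e, if C.src e = v then c e else 0) - ∑ e, if C.tgt e = v then c e else 0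
  map_add' a b := by
    ext v
    simp only [Pi.add_apply, ite_add_zero, Finset.sum_add_distrib]
    ring
  map_smul' r a := by
    ext v
    simp only [Pi.smul_apply, smul_eq_mul, RingHom.id_apply, mul_sub, Finset.mul_sum, mul_ite,
      mul_zero]

theorem ker_activeBoundary : LinearMap.ker C.activeBoundary = C.cycles := by
  classical
  ext c
  rw [LinearMap.mem_ker]
  constructor
  · intro h v
    by_cases hv : C.Active v
    · exact sub_eq_zero.1 (congrFun h ⟨v, hv⟩)
    · rw [Finset.sum_eq_zero, Finset.sum_eq_zero]
      · intro e _
        exact if_neg fun h => hv ⟨Sum.inr (Sum.inl e), h⟩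
      · intro e _
        exact if_neg fun h => hv ⟨Sum.inl e, h⟩
  · intro h
    ext v
    exact sub_eq_zero.2 (h v)

open Classical in
/-- The sum over the active vertices in `S`. -/
def sumOn (S : Set C.V) : ({v // C.Active v} → ℚ) →ₗ[ℚ] ℚ where
  toFun x := ∑ v, if v.1 ∈ S then x v else 0
  map_add' a b := by
    simp only [Pi.add_apply, ite_add_zero, Finset.sum_add_distrib]
  map_smul' r a := by
    simp only [Pi.smul_apply, smul_eq_mul, RingHom.id_apply, Finset.mul_sum, mul_ite, mul_zero]

/-- A boundary has total value zero on a union of connected components. -/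
theorem sumOn_activeBoundary {S : Set C.V} (hS : ∀ e, C.src e ∈ S ↔ C.tgt e ∈ S) (c : C.E → ℚ) :
    C.sumOn S (C.activeBoundary c) = 0 := by
  classical
  have key : ∀ g : C.E → C.V, (∀ e, C.Active (g e)) →
      (∑ v : {v // C.Active v}, if v.1 ∈ S then (∑ e, if g e = v then c e else 0) else 0) =
        ∑ e, if g e ∈ S then c e else 0 := by
    intro g hg
    have : ∀ v : {v // C.Active v}, (if v.1 ∈ S then (∑ e, if g e = v then c e else 0) else 0) =
        ∑ e, if g e = v then (if g e ∈ S then c e else 0) else 0 := by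
      intro v
      split_ifs with h
      · refine Finset.sum_congr rfl fun e _ => ?_
        by_cases h2 : g e = v
        · rw [if_pos h2, if_pos h2, h2, if_pos h]
        · rw [if_neg h2, if_neg h2]
      · refine (Finset.sum_eq_zero fun e _ => ?_).symm
        by_cases h2 : g e = v
        · rw [if_pos h2, h2, if_neg h]
        · rw [if_neg h2]
    simp only [this]
    rw [Finset.sum_comm]
    refine Finset.sum_congr rfl fun e _ => ?_
    rw [Finset.sum_eq_single ⟨g e, hg e⟩]
    · rw [if_pos rfl]
    · intro v _ hv
      exact if_neg fun h => hv (Subtype.ext h.symm)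
    · simp
  have h1 : C.sumOn S (C.activeBoundary c) = (∑ v : {v // C.Active v},
      if v.1 ∈ S then (∑ e, if C.src e = v then c e else 0) else 0) -
      ∑ v : {v // C.Active v}, if v.1 ∈ S then (∑ e, if C.tgt e = v then c e else 0) else 0 := by
    rw [← Finset.sum_sub_distrib]
    refine Finset.sum_congr rfl fun v _ => ?_
    split_ifs
    · rfl
    · simp
  rw [h1, key C.src fun e => ⟨Sum.inl e, rfl⟩, key C.tgt fun e => ⟨Sum.inr (Sum.inl e), rfl⟩]
  simp only [hS, sub_self]

theorem finrank_range_add_le {K V₁ V₂ V₃ : Type*} [Field K] [AddCommGroup V₁] [AddCommGroup V₂]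
    [AddCommGroup V₃] [Module K V₁] [Module K V₂] [Module K V₃] [Module.Finite K V₂]
    (f : V₁ →ₗ[K] V₂) (g : V₂ →ₗ[K] V₃) (h : ∀ x, g (f x) = 0) (hg : Function.Surjective g) :
    Module.finrank K (LinearMap.range f) + Module.finrank K V₃ ≤ Module.finrank K V₂ := by
  have h1 := LinearMap.finrank_range_add_finrank_ker g
  rw [LinearMap.range_eq_top.2 hg, finrank_top] at h1
  have h2 : Module.finrank K (LinearMap.range f) ≤ Module.finrank K (LinearMap.ker g) := by
    refine Submodule.finrank_mono ?_
    rintro _ ⟨x, rfl⟩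
    exact h x
  omega

open Classical in
theorem sumOn_single (S : Set C.V) (v : {v // C.Active v}) (a : ℚ) :
    C.sumOn S (Pi.single v a) = if v.1 ∈ S then a else 0 := by
  change (∑ w, if w.1 ∈ S then (Pi.single v a : {v // C.Active v} → ℚ) w else 0) = _
  rw [Finset.sum_eq_single v]
  · rw [Pi.single_eq_same]
  · intro w _ hw
    rw [Pi.single_eq_of_ne hw, ite_self]
  · simp

open Classical in
/-- Euler characteristic: the first Betti number of a graph with an edge or a ray. -/
theorem card_edges_add_one_le {v : C.V} (hv : C.Active v) :
    Fintype.card C.E + 1 ≤ C.firstBetti + Fintype.card {v // C.Active v} := by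
  have h1 := LinearMap.finrank_range_add_finrank_ker C.activeBoundary
  rw [ker_activeBoundary, ← firstBetti_eq, Module.finrank_fintype_fun_eq_card] at h1
  have h2 := finrank_range_add_le C.activeBoundary (C.sumOn Set.univ)
    (C.sumOn_activeBoundary fun e => Iff.rfl) (fun a => ⟨Pi.single ⟨v, hv⟩ a, by
      rw [sumOn_single, if_pos (Set.mem_univ v)]⟩)
  rw [Module.finrank_self, Module.finrank_fintype_fun_eq_card] at h2
  omega

open Classical in
/-- Euler characteristic: the first Betti number of a disconnected graph. -/
theorem card_edges_add_two_le (h : ¬ C.IsConnected) :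
    Fintype.card C.E + 2 ≤ C.firstBetti + Fintype.card {v // C.Active v} := by
  unfold IsConnected at h
  push Not at h
  obtain ⟨S, hS, v, w, hv, hw, hvS, hwS⟩ := h
  have h1 := LinearMap.finrank_range_add_finrank_ker C.activeBoundary
  rw [ker_activeBoundary, ← firstBetti_eq, Module.finrank_fintype_fun_eq_card] at h1
  have h2 := finrank_range_add_le C.activeBoundary ((C.sumOn S).prod (C.sumOn Sᶜ))
    (fun c => Prod.ext (C.sumOn_activeBoundary hS c)
      (C.sumOn_activeBoundary (fun e => not_congr (hS e)) c))
    (by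
      rintro ⟨a, b⟩
      refine ⟨Pi.single ⟨v, hv⟩ a + Pi.single ⟨w, hw⟩ b, ?_⟩
      rw [map_add]
      simp [sumOn_single, hvS, hwS])
  rw [Module.finrank_prod, Module.finrank_self, Module.finrank_fintype_fun_eq_card] at h2
  omega

theorem Immersed.card_rays_le {C : ParamCurve} (hC : C.Immersed) :
    Fintype.card C.R ≤ ∑ r, latticeLength (C.dir r) := by
  rw [Fintype.card_eq_sum_ones]
  exact Finset.sum_le_sum fun r _ => latticeLength_pos (hC.dir_ne r)

/-- The dimension count: the deformations of a curve through `k` general points have moments of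
dimension at least `k`, the flows without sources have dimension at most `#E + #R - #V`, which is at
most `#R - 1 + b₁`, with a further loss for every additional component, and `#R` is at most the
total weight of the rays. If that weight plus `b₁` is at most `k + 1`, all these are equalities. -/
theorem Immersed.regular_of_count {C : ParamCurve} (hC : C.Immersed) {k : ℕ} (m : Fin k → C.V)
    (hm : ∀ i, C.Active (m i)) (h : (interior (C.eval m '' C.stratum)).Nonempty)
    {v₀ : C.V} (hv₀ : C.Active v₀)
    (hcount : ∑ r, latticeLength (C.dir r) + C.firstBetti ≤ k + 1) :
    C.Regular ∧ C.IsConnected ∧ (∀ r, latticeLength (C.dir r) = 1) ∧ Nonempty C.R := by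
  classical
  have h1 := C.le_finrank_moments m hC hm (C.map_evalMap_eq_top m h)
  have h2 := Submodule.finrank_mono C.map_moments_le
  have h3 := C.finrank_ker_flow_add_le hC
  have h4 := C.card_edges_add_one_le hv₀
  have h5 := hC.card_rays_le
  refine ⟨Submodule.eq_of_le_of_finrank_le C.map_moments_le (by omega), ?_, fun r => ?_, ?_⟩
  · by_contra hcon
    have := C.card_edges_add_two_le hcon
    omega
  · have h6 : ∑ r : C.R, 1 = ∑ r, latticeLength (C.dir r) := by
      rw [← Fintype.card_eq_sum_ones]
      omega
    exact ((Finset.sum_eq_sum_iff_of_le fun r _ => latticeLength_pos (hC.dir_ne r)).1 h6 r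
      (Finset.mem_univ r)).symm
  · by_contra hR
    rw [not_nonempty_iff] at hR
    exact one_ne_zero (hC.eq_zero_of_flag (fun _ => (1 : ℝ)) (fun _ => rfl)
      (fun r => hR.elim r) hv₀)

end ParamCurve

/-! ### The unbounded part of a tropical curve -/

/-- Rotation of the lattice by a right angle. -/
def latticeRot (u : ℤ × ℤ) : ℤ × ℤ := (u.2, -u.1)

theorem latticeToReal_latticeRot (u : ℤ × ℤ) :
    latticeToReal (latticeRot u) = rot (latticeToReal u) := by
  ext <;> simp [latticeRot, latticeToReal, rot]

theorem latticeToReal_add (u v : ℤ × ℤ) :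
    latticeToReal (u + v) = latticeToReal u + latticeToReal v := by
  ext <;> simp [latticeToReal]

theorem latticeToReal_nsmul (k : ℕ) (u : ℤ × ℤ) :
    latticeToReal (k • u) = (k : ℝ) • latticeToReal u := by
  ext <;> simp [latticeToReal]

theorem ne_zero_of_latticeLength {u : ℤ × ℤ} (hu : latticeLength u = 1) : u ≠ 0 := by
  rintro rfl
  simp [latticeLength] at hu

theorem exists_eq_zsmul_latticeRot {u w : ℤ × ℤ} (hu : latticeLength u = 1)
    (h : u.1 * w.1 + u.2 * w.2 = 0) : ∃ k : ℤ, w = k • latticeRot u := by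
  obtain ⟨x, y, hxy⟩ := Int.isCoprime_iff_gcd_eq_one.2 hu
  refine ⟨y * w.1 - x * w.2, Prod.ext ?_ ?_⟩
  · simp only [latticeRot, Prod.smul_mk, smul_eq_mul]
    linear_combination x * h - w.1 * hxy
  · simp only [latticeRot, Prod.smul_mk, smul_eq_mul]
    linear_combination y * h - w.2 * hxy

/-- Parallel primitive vectors agree up to sign. -/
theorem eq_or_eq_neg_of_parallel {u v : ℤ × ℤ} (hu : latticeLength u = 1) (hv : latticeLength v = 1)
    (h : u.1 * v.2 = u.2 * v.1) : v = u ∨ v = -u := by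
  obtain ⟨k, hk⟩ := exists_eq_zsmul_latticeRot (w := latticeRot v) hu (by
    simp only [latticeRot]; linarith)
  have h1 : v.2 = k * u.2 := congrArg Prod.fst hk
  have h2 : v.1 = k * u.1 := by
    have : -v.1 = k * -u.1 := congrArg Prod.snd hk
    linarith
  have h3 : k.natAbs = 1 := by
    have : latticeLength v = k.natAbs * latticeLength u := by
      unfold latticeLength
      rw [h1, h2, Int.gcd_mul_left]
    rw [hu, hv, mul_one] at this
    exact this.symm
  rcases Int.natAbs_eq_iff.1 h3 with rfl | rfl
  · left; ext <;> simp [h1, h2]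
  · right; ext <;> simp [h1, h2]

/-- The primitive vector in the direction of a lattice vector. -/
def primitivePart (w : ℤ × ℤ) : ℤ × ℤ := (w.1 / latticeLength w, w.2 / latticeLength w)

theorem nsmul_primitivePart (w : ℤ × ℤ) : latticeLength w • primitivePart w = w := by
  ext
  · simp only [primitivePart, nsmul_eq_mul, Prod.smul_mk]
    exact Int.mul_ediv_cancel' (Int.gcd_dvd_left _ _)
  · simp only [primitivePart, nsmul_eq_mul, Prod.smul_mk]
    exact Int.mul_ediv_cancel' (Int.gcd_dvd_right _ _)

theorem latticeLength_primitivePart {w : ℤ × ℤ} (hw : w ≠ 0) :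
    latticeLength (primitivePart w) = 1 :=
  Int.gcd_ediv_gcd_ediv_gcd (latticeLength_pos hw)

/-- The real pairing of two vectors of the plane. -/
def dot (d x : ℝ × ℝ) : ℝ := x.1 * d.1 + x.2 * d.2

theorem dot_latticeToReal (d : ℝ × ℝ) (u : ℤ × ℤ) : dot d (latticeToReal u) = pairing d u := rfl

theorem dot_add (d x y : ℝ × ℝ) : dot d (x + y) = dot d x + dot d y := by
  simp [dot]; ring

theorem dot_smul (d x : ℝ × ℝ) (c : ℝ) : dot d (c • x) = c * dot d x := by
  simp [dot]; ring

theorem dot_self (d : ℝ × ℝ) : dot d d = normSq d := by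
  simp [dot, normSq]; ring

/-- The infimum of a linear form over a convex hull is attained at a generator. -/
theorem le_dot_of_mem_convexHull {A : Set (ℤ × ℤ)} {d x : ℝ × ℝ} {c : ℝ}
    (hA : ∀ u ∈ A, c ≤ pairing d u) (hx : x ∈ convexHull ℝ (latticeToReal '' A)) : c ≤ dot d x := by
  have hconv : Convex ℝ {x | c ≤ dot d x} := by
    intro x hx y hy a b ha hb hab
    simp only [Set.mem_ofPred_eq] at hx hy ⊢
    rw [dot_add, dot_smul, dot_smul]
    have h1 := mul_le_mul_of_nonneg_left hx ha
    have h2 := mul_le_mul_of_nonneg_left hy hb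
    have h3 : a * c + b * c = c := by rw [← add_mul, hab, one_mul]
    linarith
  refine convexHull_min ?_ hconv hx
  rintro _ ⟨u, hu, rfl⟩
  exact hA u hu

/-- A nonzero linear form does not attain its minimum at an interior point. -/
theorem notMem_interior_of_dot_le {D : Set (ℝ × ℝ)} {d x : ℝ × ℝ} (hd : d ≠ 0)
    (h : ∀ y ∈ D, dot d x ≤ dot d y) : x ∉ interior D := by
  intro hx
  have h1 := tendsto_add_smul x (-d)
  obtain ⟨ε, h2, h3⟩ := ((h1.eventually (mem_interior_iff_mem_nhds.1 hx)).and
    self_mem_nhdsWithin).exists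
  have h4 := h _ h2
  rw [dot_add, smul_neg, ← neg_smul, dot_smul, dot_self] at h4
  have h5 : 0 < ε * normSq d := mul_pos h3 (normSq_pos hd)
  linarith

/-- Far away in the direction `d`, only the face in the direction `d` of the Newton polygon matters. -/
theorem eventually_activeSet_add_inv_smul (f : Laurent) (y d : ℝ × ℝ) :
    ∀ᶠ ε in 𝓝[>] (0 : ℝ), activeSet f (y + ε⁻¹ • d) =
      argmin (argmin (f.coeff.support : Set (ℤ × ℤ)) (pairing d)) (fun u => tropMonomial f u y) := by
  filter_upwards [eventually_argmin_add f.coeff.support.finite_toSet (pairing d)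
    (fun u => tropMonomial f u y), self_mem_nhdsWithin] with ε h hε
  replace hε : 0 < ε := hε
  rw [← h, activeSet_eq_argmin]
  ext u
  refine and_congr_right fun _ => forall₂_congr fun v _ => ?_
  beta_reduce
  rw [tropMonomial_add_smul, tropMonomial_add_smul, ← mul_le_mul_iff_right₀ hε]
  have : ∀ u, ε * (tropMonomial f u y + ε⁻¹ * pairing d u) =
      pairing d u + ε * tropMonomial f u y := by
    intro u
    field_simp
    ring
  rw [this, this]

theorem eventually_add_inv_smul_notMem (P : Finset (ℝ × ℝ)) (y : ℝ × ℝ) {d : ℝ × ℝ} (hd : d ≠ 0) :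
    ∀ᶠ ε in 𝓝[>] (0 : ℝ), y + ε⁻¹ • d ∉ P := by
  have hfin : {t : ℝ | y + t • d ∈ P}.Finite :=
    P.finite_toSet.preimage fun s _ t _ h => smul_left_injective ℝ hd (add_left_cancel h)
  obtain ⟨b, hb⟩ := hfin.bddAbove
  filter_upwards [tendsto_inv_nhdsGT_zero.eventually (Filter.eventually_gt_atTop b)] with ε hε h
  exact (hb h).not_gt hε

namespace ParamCurve

variable {C : ParamCurve} {P : Finset (ℝ × ℝ)} {f : Laurent}

open Classical in
/-- The rays in the direction of a primitive vector `u` have total weight at most the lattice length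
of the corresponding face of the Newton polygon. -/
theorem IsAdapted.sum_rays_le (hf : f ≠ 0) (hC : C.IsAdapted (tropicalization f) P) {u : ℤ × ℤ}
    (hu : latticeLength u = 1) :
    (∑ r, if primitivePart (C.dir r) = u then (latticeLength (C.dir r) : ℝ) else 0) *
      normSq (latticeToReal u) ≤ edgeWidth (f.coeff.support : Set (ℤ × ℤ)) (latticeToReal u) := by
  have hu0 := ne_zero_of_latticeLength hu
  set d := latticeToReal u with hd
  have hd0 : d ≠ 0 := latticeToReal_ne_zero hu0
  have hN : 0 < normSq d := normSq_pos hd0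
  set w := rot d with hw
  set F := argmin (f.coeff.support : Set (ℤ × ℤ)) (pairing d) with hF
  have hFfin : F.Finite := f.coeff.support.finite_toSet.subset (argmin_subset _ _)
  have hFne : F.Nonempty := argmin_nonempty f.coeff.support.finite_toSet
    (support_nonempty_of_ne_zero hf) _
  -- coordinates of the base of a ray
  let τ : C.R → ℝ := fun r => dot w (C.pos (C.base r)) / normSq d
  let ρ : C.R → ℝ := fun r => dot d (C.pos (C.base r)) / normSq d
  have hcoord : ∀ r, C.pos (C.base r) = τ r • w + ρ r • d := by
    intro r
    ext <;> simp only [τ, ρ, hw, dot, rot, Prod.fst_add, Prod.snd_add, Prod.smul_fst, Prod.smul_snd,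
      smul_eq_mul] <;> field_simp <;> unfold normSq <;> ring
  let Ru : Finset C.R := Finset.univ.filter fun r => primitivePart (C.dir r) = u
  let T : Finset ℝ := Ru.image τ
  have h1 : ∀ t : ℝ, ∀ᶠ ε in 𝓝[>] (0 : ℝ), ∀ r, ρ r ≤ ε⁻¹ ∧
      activeSet f (t • w + ε⁻¹ • d) = argmin F (fun k => tropMonomial f k (t • w)) ∧
      t • w + ε⁻¹ • d ∉ P := by
    intro t
    refine Filter.eventually_all.2 fun r => ?_
    filter_upwards [tendsto_inv_nhdsGT_zero.eventually (Filter.eventually_ge_atTop (ρ r)),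
      eventually_activeSet_add_inv_smul f (t • w) d,
      eventually_add_inv_smul_notMem P (t • w) hd0] with ε h1 h2 h3
    exact ⟨h1, h2, h3⟩
  -- far out, the point `t • w + ε⁻¹ • d` lies on all rays in direction `u` that are contained in
  -- the line through `t • w`, and the weight there is that of an edge in the subdivision of `F`
  have h2 : ∀ t ∈ T, (∑ r ∈ Ru with τ r = t, (latticeLength (C.dir r) : ℝ)) * normSq d ≤
      width (argmin F (fun k => tropMonomial f k (t • w))) (pairing w) := by
    intro t ht
    obtain ⟨r₀, -, -⟩ := Finset.mem_image.1 ht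
    obtain ⟨ε, hε⟩ := (h1 t).exists
    obtain ⟨-, hact, hP⟩ := hε r₀
    have h3 := weight_mul_normSq hf (x := t • w + ε⁻¹ • d) hu0 (by
      rw [hact]
      exact fun a ha b hb => argmin_eq_of_mem ha.1 hb.1)
    rw [hu, Nat.cast_one, mul_one, hact, ← hC.weight_eq _ hP] at h3
    rw [← hw, ← hd] at h3
    rw [← h3]
    refine mul_le_mul_of_nonneg_right ?_ hN.le
    unfold inducedWeight
    push_cast
    refine le_add_of_nonneg_of_le (Finset.sum_nonneg fun e _ => by positivity) ?_
    rw [← Finset.sum_filter]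
    simp only [Ru, Finset.filter_filter]
    refine Finset.sum_le_sum_of_subset_of_nonneg ?_ fun _ _ _ => Nat.cast_nonneg _
    intro r hr
    simp only [Finset.mem_filter, Finset.mem_univ, true_and] at hr ⊢
    have hl : (0 : ℝ) < latticeLength (C.dir r) := by
      exact_mod_cast latticeLength_pos (hC.immersed.dir_ne r)
    refine ⟨(ε⁻¹ - ρ r) / latticeLength (C.dir r),
      div_nonneg (sub_nonneg.2 (hε r).1) hl.le, ?_⟩
    have hdir : latticeToReal (C.dir r) = (latticeLength (C.dir r) : ℝ) • d := by
      conv_lhs => rw [← nsmul_primitivePart (C.dir r), latticeToReal_nsmul, hr.1]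
    rw [hcoord, hr.2, hdir, smul_smul, div_mul_cancel₀ _ hl.ne', sub_smul]
    abel
  have h3 := finsum_width_argmin (pairing w) (fun k => Puiseux.val (f.coeff k)) hFfin hFne
  have h4 : ∀ t : ℝ, argmin F (fun k => tropMonomial f k (t • w)) =
      argmin F (fun k => pairing w k * t + Puiseux.val (f.coeff k)) := by
    intro t
    congr 1
    ext k
    have := tropMonomial_add_smul f k 0 w t
    rw [zero_add] at this
    rw [this]
    simp only [tropMonomial, Prod.fst_zero, Prod.snd_zero]
    ring
  simp only [← h4] at h3
  change _ ≤ width F (pairing w)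
  rw [← h3, finsum_eq_sum_of_support_subset (s := (T ∪ (finite_setOf_width_ne_zero (pairing w)
    (fun k => Puiseux.val (f.coeff k)) hFfin).toFinset)) _ (by
      intro t ht
      simp only [Finset.coe_union, Set.Finite.coe_toFinset]
      right
      simpa [h4] using ht)]
  rw [← Finset.sum_filter, ← Finset.sum_fiberwise_of_maps_to (g := τ) (t := T)
    (fun r hr => Finset.mem_image_of_mem τ hr), Finset.sum_mul]
  refine (Finset.sum_le_sum h2).trans (Finset.sum_le_sum_of_subset_of_nonneg
    Finset.subset_union_left fun t _ _ => width_nonneg (hFfin.subset (argmin_subset _ _))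
      (argmin_nonempty hFfin hFne _) _)

/-- The total weight of the rays of a tropical curve of degree `Δ` is at most the number of lattice
points on the boundary of `Δ`. -/
theorem IsAdapted.sum_latticeLength_dir_le {Δ : LatticePolygon} (hf : f ≠ 0)
    (hΔ : newtonPolygon f = Δ.carrier) (hC : C.IsAdapted (tropicalization f) P)
    (hfin : Δ.latticePoints.Finite) :
    ∑ r, latticeLength (C.dir r) ≤ (Δ.latticePoints \ Δ.interiorLatticePoints).ncard := by
  classical
  let D : Finset (ℤ × ℤ) := Finset.univ.image fun r => primitivePart (C.dir r)
  have hD : ∀ u ∈ D, latticeLength u = 1 := by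
    intro u hu
    obtain ⟨r, -, rfl⟩ := Finset.mem_image.1 hu
    exact latticeLength_primitivePart (hC.immersed.dir_ne r)
  have hsub : ∀ u ∈ (f.coeff.support : Set (ℤ × ℤ)), latticeToReal u ∈ Δ.carrier := by
    intro u hu
    rw [← hΔ]
    exact subset_convexHull ℝ _ (Set.mem_image_of_mem _ hu)
  -- the face in a primitive direction
  have hface : ∀ u ∈ D, ∃ (j : ℤ × ℤ) (L : ℕ),
      (∀ m ≤ L, latticeToReal (j + m • latticeRot u) ∈ Δ.carrier) ∧
      (∀ y ∈ Δ.carrier, pairing (latticeToReal u) j ≤ dot (latticeToReal u) y) ∧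
      (∑ r, if primitivePart (C.dir r) = u then latticeLength (C.dir r) else 0) ≤ L := by
    intro u hu
    obtain ⟨i, hi, j, hj, hij, hw⟩ := exists_argmin_width_eq f.coeff.support.finite_toSet
      (support_nonempty_of_ne_zero hf) (latticeToReal u)
    obtain ⟨k, hk⟩ := exists_eq_zsmul_latticeRot (hD u hu)
      (orthogonal_of_pairing_eq (argmin_eq_of_mem hi hj))
    have hN := normSq_latticeToReal_pos (ne_zero_of_latticeLength (hD u hu))
    have hk' : pairing (rot (latticeToReal u)) (i - j) = k * normSq (latticeToReal u) := by
      rw [hk, pairing_eq]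
      simp [latticeRot, rot, latticeToReal, normSq]
      ring
    have hk0 : 0 ≤ k := by
      have : 0 ≤ (k : ℝ) * normSq (latticeToReal u) := by
        rw [← hk', pairing_sub]; linarith [(hij i hi).1]
      exact_mod_cast nonneg_of_mul_nonneg_left this hN
    obtain ⟨L, rfl⟩ := Int.eq_ofNat_of_zero_le hk0
    have hiL : i = j + L • latticeRot u := by
      rw [← sub_eq_iff_eq_add', hk, natCast_zsmul]
    refine ⟨j, L, fun m hm => ?_, fun y hy => ?_, ?_⟩
    · have hseg : latticeToReal (j + m • latticeRot u) ∈
          segment ℝ (latticeToReal j) (latticeToReal i) := by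
        rw [segment_eq_image']
        rcases Nat.eq_zero_or_pos L with h0 | h0
        · refine ⟨0, by simp, ?_⟩
          obtain rfl : m = 0 := by omega
          simp
        · refine ⟨m / L, ⟨by positivity, ?_⟩, ?_⟩
          · rw [div_le_one (by exact_mod_cast h0)]
            exact_mod_cast hm
          · simp only
            rw [hiL, latticeToReal_add, latticeToReal_add, add_sub_cancel_left,
              latticeToReal_nsmul, latticeToReal_nsmul, smul_smul,
              div_mul_cancel₀ _ (by exact_mod_cast h0.ne')]
      exact Δ.convex.segment_subset (hsub j hj.1) (hsub i hi.1) hseg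
    · rw [← hΔ] at hy
      exact le_dot_of_mem_convexHull (fun v hv => hj.2 v hv) hy
    · have h1 := hC.sum_rays_le hf (hD u hu)
      rw [hw, ← pairing_sub, hk'] at h1
      have h2 := le_of_mul_le_mul_right h1 hN
      exact_mod_cast h2
  choose! j L hin hmin hL using hface
  -- the lattice points of the face in direction `u`, without one of its endpoints
  let S : ℤ × ℤ → Finset (ℤ × ℤ) := fun u => (Finset.range (L u)).image fun m => j u + m • latticeRot u
  have hS : ∀ u ∈ D, ∀ z ∈ S u, latticeToReal z ∈ Δ.carrier ∧
      latticeToReal z + rot (latticeToReal u) ∈ Δ.carrier ∧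
      ∀ y ∈ Δ.carrier, dot (latticeToReal u) (latticeToReal z) ≤ dot (latticeToReal u) y := by
    intro u hu z hz
    obtain ⟨m, hm, rfl⟩ := Finset.mem_image.1 hz
    rw [Finset.mem_range] at hm
    refine ⟨hin u hu m hm.le, ?_, fun y hy => ?_⟩
    · rw [← latticeToReal_latticeRot, ← latticeToReal_add, add_assoc, ← succ_nsmul]
      exact hin u hu (m + 1) hm
    · refine Eq.trans_le ?_ (hmin u hu y hy)
      rw [dot_latticeToReal, pairing_add, add_eq_left, pairing_eq]
      simp [latticeRot, latticeToReal]
      ring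
  have hcard : ∀ u ∈ D, (S u).card = L u := by
    intro u hu
    rw [Finset.card_image_of_injective, Finset.card_range]
    intro a b hab
    have hne : latticeToReal (latticeRot u) ≠ 0 := latticeToReal_ne_zero fun h => by
      have := ne_zero_of_latticeLength (hD u hu)
      have h1 := congrArg Prod.fst h
      have h2 := congrArg Prod.snd h
      simp only [latticeRot, Prod.fst_zero, Prod.snd_zero, neg_eq_zero] at h1 h2
      exact this (Prod.ext h2 h1)
    have := congrArg latticeToReal (add_left_cancel hab)
    rw [latticeToReal_nsmul, latticeToReal_nsmul] at this
    exact_mod_cast smul_left_injective ℝ hne this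
  have hnint : ∀ u ∈ D, ∀ z ∈ S u, latticeToReal z ∉ interior Δ.carrier := fun u hu z hz =>
    notMem_interior_of_dot_le (latticeToReal_ne_zero (ne_zero_of_latticeLength (hD u hu)))
      (hS u hu z hz).2.2
  -- from a common point `z` of two faces one can move along both: each normal is nonnegative on the
  -- edge vector of the other face; these two values are opposite, so the normals are parallel
  have hdisj : ∀ u ∈ D, ∀ v ∈ D, u ≠ v → Disjoint (S u) (S v) := by
    intro u hu v hv huv
    rw [Finset.disjoint_left]
    intro z hzu hzv
    obtain ⟨-, hu1, hu2⟩ := hS u hu z hzu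
    obtain ⟨-, hv1, hv2⟩ := hS v hv z hzv
    have h1 := hu2 _ hv1
    have h2 := hv2 _ hu1
    rw [dot_add] at h1 h2
    have h3 : dot (latticeToReal u) (rot (latticeToReal v)) =
        -dot (latticeToReal v) (rot (latticeToReal u)) := by
      simp [dot, rot]; ring
    have h4 : dot (latticeToReal v) (rot (latticeToReal u)) = 0 := by linarith
    have h5 : u.1 * v.2 = u.2 * v.1 := by
      simp only [dot, rot, latticeToReal] at h4
      have : (u.1 * v.2 : ℝ) = u.2 * v.1 := by linarith
      exact_mod_cast this
    rcases eq_or_eq_neg_of_parallel (hD u hu) (hD v hv) h5 with h | h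
    · exact huv h.symm
    · obtain ⟨x, hx⟩ := Δ.nonempty_interior
      refine notMem_interior_of_dot_le (latticeToReal_ne_zero (ne_zero_of_latticeLength (hD u hu)))
        (fun y hy => (?_ : dot _ x ≤ _).trans (hu2 y hy)) hx
      have h6 := hv2 x (interior_subset hx)
      rw [h, latticeToReal_neg] at h6
      simp only [dot, Prod.fst_neg, Prod.snd_neg] at h6 ⊢
      linarith
  have h1 : ∑ r, latticeLength (C.dir r) = ∑ u ∈ D,
      ∑ r, if primitivePart (C.dir r) = u then latticeLength (C.dir r) else 0 := by
    rw [Finset.sum_comm]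
    refine Finset.sum_congr rfl fun r _ => ?_
    rw [Finset.sum_ite_eq, if_pos]
    exact Finset.mem_image_of_mem (fun r => primitivePart (C.dir r)) (Finset.mem_univ r)
  rw [h1]
  refine (Finset.sum_le_sum hL).trans ?_
  rw [← Finset.sum_congr rfl hcard, ← Finset.card_biUnion hdisj, ← Set.ncard_coe_finset]
  refine Set.ncard_le_ncard ?_ (hfin.subset Set.sdiff_subset)
  intro z hz
  obtain ⟨u, hu, hzu⟩ := Finset.mem_biUnion.1 hz
  exact ⟨(hS u hu z hzu).1, hnint u hu z hzu⟩

end ParamCurve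

/-! ### The Newton polygon -/

/-- A finite set of lattice points has a point in its convex hull as soon as no linear form
separates it. -/
theorem mem_convexHull_of_forall_dot {A : Set (ℤ × ℤ)} (hA : A.Finite) {z : ℝ × ℝ}
    (h : ∀ e, ∃ i ∈ A, pairing e i ≤ dot e z) : z ∈ convexHull ℝ (latticeToReal '' A) := by
  by_contra hz
  obtain ⟨l, c, h1, h2⟩ := geometric_hahn_banach_point_closed (convex_convexHull ℝ _)
    ((hA.image latticeToReal).isCompact_convexHull ℝ).isClosed hz
  have hl : ∀ x, l x = dot (l (1, 0), l (0, 1)) x := by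
    intro x
    have : x = x.1 • ((1, 0) : ℝ × ℝ) + x.2 • ((0, 1) : ℝ × ℝ) := by ext <;> simp
    conv_lhs => rw [this, map_add, map_smul, map_smul]
    simp [dot]
  obtain ⟨i, hi, h3⟩ := h (l (1, 0), l (0, 1))
  rw [← hl, ← dot_latticeToReal, ← hl] at h3
  have := h2 _ (subset_convexHull ℝ _ (Set.mem_image_of_mem _ hi))
  linarith

/-- If the dual cells at `x` are points or segments, their widths are determined by the tropical
curve: the direction of a segment by the support near `x`, and its length by the weight. -/
theorem width_activeSet_eq {f f' : Laurent} (hf : f ≠ 0) (hf' : f' ≠ 0)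
    (hΓ : tropicalization f = tropicalization f') {x : ℝ × ℝ}
    (hx : (activeSet f x).Nontrivial → Collinear ℝ (latticeToReal '' activeSet f x))
    (hx' : (activeSet f' x).Nontrivial → Collinear ℝ (latticeToReal '' activeSet f' x))
    (e : ℝ × ℝ) : width (activeSet f x) (pairing e) = width (activeSet f' x) (pairing e) := by
  have hsupp : ∀ y, (activeSet f y).Nontrivial ↔ (activeSet f' y).Nontrivial := by
    intro y
    change y ∈ (tropicalization f).support ↔ y ∈ (tropicalization f').support
    rw [hΓ]
  by_cases hnt : (activeSet f x).Nontrivial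
  swap
  · rw [width_eq_zero_of_subsingleton (Set.not_nontrivial_iff.1 hnt),
      width_eq_zero_of_subsingleton (Set.not_nontrivial_iff.1 fun h => hnt ((hsupp x).2 h))]
  have hcol := hx hnt
  have hcol' := hx' ((hsupp x).1 hnt)
  obtain ⟨i, hi, j, hj, hij⟩ := id hnt
  -- `u` is orthogonal to the dual cell
  set u := latticeRot (i - j) with hu
  have hu0 : u ≠ 0 := by
    intro h
    have h1 := congrArg Prod.fst h
    have h2 := congrArg Prod.snd h
    simp only [hu, latticeRot, Prod.fst_zero, Prod.snd_zero, neg_eq_zero] at h1 h2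
    exact hij (sub_eq_zero.1 (Prod.ext h2 h1))
  have hN := normSq_latticeToReal_pos hu0
  have h1 := pairing_eq_of_collinear (d := latticeToReal u) hcol hi hj hij (by
    rw [pairing_eq, pairing_eq]
    simp [hu, latticeRot, latticeToReal]
    ring)
  have h2 : ∀ a ∈ activeSet f' x, ∀ b ∈ activeSet f' x,
      pairing (latticeToReal u) a = pairing (latticeToReal u) b := by
    refine pairing_eq_of_argmin_nontrivial hcol' ?_
    obtain ⟨ε, h3, h4⟩ := ((eventually_activeSet_add_smul f x (latticeToReal u)).and
      (eventually_activeSet_add_smul f' x (latticeToReal u))).exists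
    rw [← h4, ← hsupp, h3]
    exact ⟨i, ⟨hi, fun b hb => (h1 i hi b hb).le⟩, j, ⟨hj, fun b hb => (h1 j hj b hb).le⟩, hij⟩
  have h3 : width (activeSet f x) (pairing (rot (latticeToReal u))) =
      width (activeSet f' x) (pairing (rot (latticeToReal u))) := by
    have h4 := weight_mul_normSq hf hu0 h1
    have h5 := weight_mul_normSq hf' hu0 h2
    rw [hΓ, h5] at h4
    have h6 : (latticeLength u : ℝ) ≠ 0 := by exact_mod_cast (latticeLength_pos hu0).ne'
    exact (mul_right_cancel₀ h6 h4).symm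
  -- the width in any direction is proportional to the width along the segment
  have key : ∀ e, 0 ≤ dot e (rot (latticeToReal u)) →
      width (activeSet f x) (pairing e) = width (activeSet f' x) (pairing e) := by
    intro e he
    have h4 : ∀ a b, pairing (latticeToReal u) a = pairing (latticeToReal u) b →
        normSq (latticeToReal u) * (pairing e a - pairing e b) =
        dot e (rot (latticeToReal u)) *
          (pairing (rot (latticeToReal u)) a - pairing (rot (latticeToReal u)) b) := by
      intro a b hab
      simp only [pairing_eq, normSq, dot, rot] at hab ⊢
      linear_combination (e.1 * (latticeToReal u).1 + e.2 * (latticeToReal u).2) * hab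
    have h5 := width_smul (activeSet_finite f x) hN.le he fun a ha b hb => h4 a b (h1 a ha b hb)
    have h6 := width_smul (activeSet_finite f' x) hN.le he fun a ha b hb => h4 a b (h2 a ha b hb)
    rw [h3, ← h6] at h5
    exact mul_left_cancel₀ hN.ne' h5
  rcases le_total 0 (dot e (rot (latticeToReal u))) with he | he
  · exact key e he
  · have hneg : ∀ a b, pairing e a - pairing e b = -(pairing (-e) a - pairing (-e) b) := by
      intro a b
      simp only [pairing_eq, Prod.fst_neg, Prod.snd_neg]
      ring
    rw [width_congr_neg (activeSet_finite f x) fun a _ b _ => hneg a b,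
      width_congr_neg (activeSet_finite f' x) fun a _ b _ => hneg a b]
    refine key (-e) ?_
    simp only [dot, Prod.fst_neg, Prod.snd_neg] at he ⊢
    linarith

/-- The tropicalization determines the widths of the Newton polygon. -/
theorem width_support_eq {f f' : Laurent} (hf : f ≠ 0) (hf' : f' ≠ 0)
    (hΓ : tropicalization f = tropicalization f') (P : Finset (ℝ × ℝ))
    (hP : ∀ x ∉ P, (activeSet f x).Nontrivial → Collinear ℝ (latticeToReal '' activeSet f x))
    (hP' : ∀ x ∉ P, (activeSet f' x).Nontrivial → Collinear ℝ (latticeToReal '' activeSet f' x))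
    (e : ℝ × ℝ) : width (f.coeff.support : Set (ℤ × ℤ)) (pairing e) =
      width (f'.coeff.support : Set (ℤ × ℤ)) (pairing e) := by
  -- a line in the direction `e` that avoids `P`
  obtain ⟨v, hv⟩ : ∃ v : ℝ × ℝ, e = 0 ∨ ∀ t : ℝ, v + t • e ∉ P := by
    by_cases he : e = 0
    · exact ⟨0, Or.inl he⟩
    have hN := normSq_pos he
    obtain ⟨s, hs⟩ := ((P.finite_toSet.image fun x => dot (rot e) x / normSq e)).exists_notMem
    refine ⟨s • rot e, Or.inr fun t ht => hs ⟨_, ht, ?_⟩⟩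
    simp only
    rw [div_eq_iff hN.ne']
    simp only [dot, rot, normSq, Prod.fst_add, Prod.snd_add, Prod.smul_fst, Prod.smul_snd,
      smul_eq_mul]
    ring
  rcases hv with rfl | hv
  · have : ∀ B : Set (ℤ × ℤ), B.Finite → B.Nonempty → width B (pairing 0) = 0 := by
      rintro B - ⟨i, hi⟩
      rw [width_eq hi hi fun k _ => by simp [pairing_eq], sub_self]
    rw [this _ f.coeff.support.finite_toSet (support_nonempty_of_ne_zero hf),
      this _ f'.coeff.support.finite_toSet (support_nonempty_of_ne_zero hf')]
  · rw [← finsum_width_activeSet hf v e, ← finsum_width_activeSet hf' v e]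
    exact finsum_congr fun t => width_activeSet_eq hf hf' hΓ (hP _ (hv t)) (hP' _ (hv t)) e

theorem ne_zero_of_newtonPolygon {Δ : LatticePolygon} {f : Laurent}
    (h : newtonPolygon f = Δ.carrier) : f ≠ 0 := by
  rintro rfl
  have := Δ.nonempty
  rw [← h] at this
  simp [newtonPolygon] at this

/-- A Laurent polynomial with exponents in `Δ` and with a tropicalization of degree `Δ` has Newton
polygon `Δ`. -/
theorem newtonPolygon_eq {Δ : LatticePolygon} {f f' : Laurent} (hf : f ≠ 0)
    (hsub : ∀ u ∈ f.coeff.support, latticeToReal u ∈ Δ.carrier)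
    (hf' : newtonPolygon f' = Δ.carrier)
    (hΓ : tropicalization f = tropicalization f') (P : Finset (ℝ × ℝ))
    (hP : ∀ x ∉ P, (activeSet f x).Nontrivial → Collinear ℝ (latticeToReal '' activeSet f x))
    (hP' : ∀ x ∉ P, (activeSet f' x).Nontrivial → Collinear ℝ (latticeToReal '' activeSet f' x)) :
    newtonPolygon f = Δ.carrier := by
  refine Set.Subset.antisymm (convexHull_min ?_ Δ.convex) fun z hz => ?_
  · rintro _ ⟨u, hu, rfl⟩
    exact hsub u hu
  have h0 := ne_zero_of_newtonPolygon hf'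
  refine mem_convexHull_of_forall_dot f.coeff.support.finite_toSet fun e => ?_
  -- both polygons have the same width in direction `e`, and one is contained in the other
  have hw := width_support_eq hf h0 hΓ P hP hP' e
  obtain ⟨i, hi, j, hj, hij, h1⟩ := exists_width_eq f.coeff.support.finite_toSet
    (support_nonempty_of_ne_zero hf) (pairing e)
  obtain ⟨i', hi', j', hj', hij', h2⟩ := exists_width_eq f'.coeff.support.finite_toSet
    (support_nonempty_of_ne_zero h0) (pairing e)
  rw [← hf'] at hz
  have h3 := le_dot_of_mem_convexHull (d := e) (fun u hu => (hij' u hu).1) hz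
  have h4 : pairing e i ≤ pairing e i' := by
    have h5 := hsub i hi
    rw [← hf'] at h5
    have h6 := le_dot_of_mem_convexHull (d := -e) (c := -pairing e i') (fun u hu => by
      have := (hij' u hu).2
      simp only [pairing_eq, Prod.fst_neg, Prod.snd_neg] at this ⊢
      linarith) h5
    simp only [dot_latticeToReal, pairing_eq, Prod.fst_neg, Prod.snd_neg] at h6 ⊢
    linarith
  refine ⟨j, hj, ?_⟩
  linarith

/-- The tropical content of the theorem: a Laurent polynomial with exponents in `Δ` whose
tropicalization has the minimal genus for a curve through the given points in general position has
Newton polygon `Δ` and only trivial factorizations. -/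
theorem newtonPolygon_eq_and_irreducible {Δ : LatticePolygon} {n g δ : ℕ}
    (hn : Δ.latticePoints.ncard = n + 1) (hg : Δ.interiorLatticePoints.ncard = g) (hδ : δ ≤ g)
    {v : Fin (n - δ) → ℝ × ℝ} (hv : InGeneralPosition Δ (g - δ) v)
    {f : Laurent} (hf : f ≠ 0) (hsub : ∀ u ∈ f.coeff.support, latticeToReal u ∈ Δ.carrier)
    (hdeg : IsTropicalCurveOfDegree Δ (tropicalization f))
    (hgenus : HasGenus (tropicalization f) (g - δ))
    (hthrough : ∀ i, v i ∈ (tropicalization f).support) :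
    newtonPolygon f = Δ.carrier ∧ ∀ f₁ f₂, f = f₁ * f₂ →
      (f₁.coeff.support : Set (ℤ × ℤ)).Subsingleton ∨
      (f₂.coeff.support : Set (ℤ × ℤ)).Subsingleton := by
  classical
  obtain ⟨f', hf'Δ, hf'Γ⟩ := id hdeg
  have hf' := ne_zero_of_newtonPolygon hf'Δ
  obtain ⟨⟨C₀, hC₀, hb⟩, hmin⟩ := hgenus
  obtain ⟨C, P, hC, hCΓ, hbetti, hQ⟩ := ParamCurve.exists_isAdapted hC₀ (Finset.univ.image v)
  have hbC : C.firstBetti = g - δ := le_antisymm (hbetti.trans hb.le) (hmin ⟨C, hCΓ, rfl⟩)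
  have hC' : C.IsAdapted (tropicalization f') P := by rwa [hf'Γ]
  have hNewt := newtonPolygon_eq hf hsub hf'Δ hf'Γ.symm P (fun x hx h => hC.collinear h hx)
    (fun x hx h => hC'.collinear h hx)
  refine ⟨hNewt, ?_⟩
  -- the vertices over the given points
  have hσ : ∀ i, ∃ σ, C.pos (C.vertex σ) = v i := by
    intro i
    have h1 : (activeSet f (v i)).Nontrivial := hthrough i
    obtain ⟨d, hd, hne⟩ := exists_edgeWidth_ne_zero (activeSet_finite f (v i)) h1
    obtain ⟨σ, hσ, -⟩ := hC.exists_flag (hQ (Finset.mem_image_of_mem v (Finset.mem_univ i))) hd hne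
    exact ⟨σ, hσ⟩
  choose σ hσ using hσ
  obtain ⟨σ₀⟩ : Nonempty C.Flag := by
    by_contra hempty
    have hsing : ∀ x, (activeSet f x).Subsingleton := by
      intro x
      by_contra hx
      rw [Set.not_subsingleton_iff] at hx
      by_cases hxP : x ∈ P
      · obtain ⟨d, hd, hne⟩ := exists_edgeWidth_ne_zero (activeSet_finite f x) hx
        obtain ⟨σ, -⟩ := hC.exists_flag hxP hd hne
        exact hempty ⟨σ⟩
      · rcases hC.mem_open hx hxP with ⟨e, -⟩ | ⟨r, -⟩
        · exact hempty ⟨Sum.inl e⟩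
        · exact hempty ⟨Sum.inr (Sum.inr r)⟩
    obtain ⟨x, hx⟩ := Δ.nonempty_interior
    rw [← hNewt] at hx
    have hss := (support_subsingleton hsing).image latticeToReal
    obtain ⟨u, hu⟩ := support_nonempty_of_ne_zero hf
    rw [newtonPolygon, hss.eq_singleton_of_mem (Set.mem_image_of_mem _ hu), convexHull_singleton,
      interior_singleton] at hx
    exact hx
  -- the number of rays is bounded by the `n + 1 - g` lattice points on the boundary, and the genus is
  -- `g - δ`, which is what the dimension count needs for `n - δ` points
  have hint := hv _ hdeg C hCΓ hbC (fun i => C.vertex (σ i)) (funext hσ)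
  have hfin : Δ.latticePoints.Finite := Set.finite_of_ncard_ne_zero (by omega)
  have hsum := hC'.sum_latticeLength_dir_le hf' hf'Δ hfin
  have hcard := Set.ncard_sdiff_add_ncard_of_subset (s := Δ.interiorLatticePoints)
    (t := Δ.latticePoints) (fun u hu => interior_subset (s := Δ.carrier) hu) hfin
  obtain ⟨hreg, hconn, hprim, ⟨r⟩⟩ := hC.immersed.regular_of_count (fun i => C.vertex (σ i))
    (fun i => ⟨σ i, rfl⟩) ⟨_, hint⟩ ⟨σ₀, rfl⟩ (by omega)
  rintro f₁ f₂ rfl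
  exact hC.support_subsingleton_or hf hreg hconn r (hprim r)

/-! ### Prime elements of the homogeneous coordinate algebra -/

instance {R : Type*} [CommRing R] [IsDomain R] [UniqueFactorizationMonoid R] :
    UniqueFactorizationMonoid (LaurentPolynomial R) :=
  UniqueFactorizationMonoid.of_isLocalization
    (Submonoid.powers (Polynomial.X : Polynomial R)) _

instance : UniqueFactorizationMonoid Laurent :=
  (AddMonoidAlgebra.curryRingEquiv (R := Puiseux) (M := ℤ) (N := ℤ)).symm.toMulEquiv.uniqueFactorizationMonoid
    (inferInstanceAs (UniqueFactorizationMonoid (LaurentPolynomial (LaurentPolynomial Puiseux))))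

theorem isUnit_of_support_subsingleton {f : Laurent} (hf : f ≠ 0)
    (h : (f.coeff.support : Set (ℤ × ℤ)).Subsingleton) : IsUnit f := by
  obtain ⟨u, hu⟩ := support_nonempty_of_ne_zero hf
  have hu' : f.coeff u ≠ 0 := Finsupp.mem_support_iff.1 hu
  have hfu : f = AddMonoidAlgebra.single u (f.coeff u) := by
    refine AddMonoidAlgebra.coeff_inj.1 (Finsupp.ext fun v => ?_)
    rw [AddMonoidAlgebra.coeff_single]
    by_cases hv : v = u
    · rw [hv, Finsupp.single_eq_same]
    · rw [Finsupp.single_eq_of_ne hv]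
      by_contra hne
      exact hv (h (Finsupp.mem_support_iff.2 hne) hu)
  refine IsUnit.of_mul_eq_one (AddMonoidAlgebra.single (-u) (f.coeff u)⁻¹) ?_
  generalize f.coeff u = a at hfu hu'
  rw [hfu, AddMonoidAlgebra.single_mul_single, add_neg_cancel, mul_inv_cancel₀ hu',
    AddMonoidAlgebra.one_def]

/-- The Newton polygon of a factor is contained in the Minkowski difference of the polygons. -/
theorem le_pairing_of_mul {Δ : LatticePolygon} {f g : Laurent} (hf : newtonPolygon f = Δ.carrier)
    {i : ℕ} (hfg : ∀ w ∈ (f * g).coeff.support, latticeToReal w ∈ (i : ℝ) • Δ.carrier)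
    {u : ℤ × ℤ} (hu : u ∈ g.coeff.support) {e : ℝ × ℝ} (he : e ≠ 0) :
    ∃ a ∈ f.coeff.support, (∀ a' ∈ f.coeff.support, pairing e a ≤ pairing e a') ∧
      (i : ℝ) * pairing e a ≤ pairing e a + pairing e u := by
  have hf0 := ne_zero_of_newtonPolygon hf
  obtain ⟨a, ha, b, hb, -, -, h1, -⟩ := (isProductLike_support f g).exists_extremal
    f.coeff.support.finite_toSet g.coeff.support.finite_toSet (support_nonempty_of_ne_zero hf0)
    ⟨u, hu⟩ he (pairing (rot e)) (pairing_add _) (fun _ _ h => h)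
  have ha2 : ∀ a' ∈ f.coeff.support, pairing e a ≤ pairing e a' := fun a' ha' =>
    ha.2 a' ⟨ha', fun _ _ => le_rfl⟩
  have hb2 : pairing e b ≤ pairing e u := hb.2 u ⟨hu, fun _ _ => le_rfl⟩
  refine ⟨a, ha.1.1, ha2, ?_⟩
  obtain ⟨x, hx, hxe⟩ := hfg _ h1.1
  rw [← hf] at hx
  have h2 := le_dot_of_mem_convexHull ha2 hx
  have h3 := congrArg (dot e) hxe
  simp only [dot_smul, dot_latticeToReal, pairing_add] at h3
  have h4 := mul_le_mul_of_nonneg_left h2 (Nat.cast_nonneg (α := ℝ) i)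
  linarith

theorem eq_zero_of_forall_pairing_nonneg {u : ℤ × ℤ} (h : ∀ e : ℝ × ℝ, e ≠ 0 → 0 ≤ pairing e u) :
    u = 0 := by
  have h1 := h (1, 0) (by simp)
  have h2 := h (-1, 0) (by simp)
  have h3 := h (0, 1) (by simp)
  have h4 := h (0, -1) (by simp)
  simp only [lin] at h1 h2 h3 h4
  ext
  · have : (u.1 : ℝ) = 0 := by linarith
    exact_mod_cast this
  · have : (u.2 : ℝ) = 0 := by linarith
    exact_mod_cast this

theorem not_subsingleton_support {Δ : LatticePolygon} {f : Laurent}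
    (hf : newtonPolygon f = Δ.carrier) : ¬ (f.coeff.support : Set (ℤ × ℤ)).Subsingleton := by
  intro h
  obtain ⟨u, hu⟩ := support_nonempty_of_ne_zero (ne_zero_of_newtonPolygon hf)
  obtain ⟨x, hx⟩ := Δ.nonempty_interior
  rw [← hf, newtonPolygon,
    (h.image latticeToReal).eq_singleton_of_mem (Set.mem_image_of_mem _ hu), convexHull_singleton,
    interior_singleton] at hx
  exact hx

/-- A factor of a section of degree zero has at most one exponent. -/
theorem not_support_subset_zero_smul {Δ : LatticePolygon} {f g : Laurent}
    (hf : newtonPolygon f = Δ.carrier) (hg : g ≠ 0) :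
    ¬ ∀ w ∈ (f * g).coeff.support, latticeToReal w ∈ ((0 : ℕ) : ℝ) • Δ.carrier := by
  intro h
  obtain ⟨u, hu⟩ := support_nonempty_of_ne_zero hg
  refine not_subsingleton_support hf fun a ha b hb => ?_
  have key : ∀ a ∈ f.coeff.support, a + u = 0 := by
    intro a ha
    refine eq_zero_of_forall_pairing_nonneg fun e he => ?_
    obtain ⟨c, -, h1, h2⟩ := le_pairing_of_mul hf h hu he
    have h3 := h1 a ha
    rw [Nat.cast_zero, zero_mul] at h2
    rw [pairing_add]
    linarith
  exact add_right_cancel ((key a ha).trans (key b hb).symm)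

theorem not_isUnit_of_newtonPolygon {Δ : LatticePolygon} {f : Laurent}
    (hf : newtonPolygon f = Δ.carrier) : ¬ IsUnit f := by
  intro h
  obtain ⟨g, hg⟩ := h.exists_right_inv
  refine not_support_subset_zero_smul hf (right_ne_zero_of_mul_eq_one hg) ?_
  rw [hg]
  intro w hw
  rw [AddMonoidAlgebra.one_def, AddMonoidAlgebra.coeff_single] at hw
  have := Finset.mem_singleton.1 (Finsupp.support_single_subset hw)
  subst this
  exact Δ.coneMonoid.zero_mem

/-- A Laurent polynomial with only trivial factorizations is prime. -/
theorem prime_of_newtonPolygon {Δ : LatticePolygon} {f : Laurent}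
    (hf : newtonPolygon f = Δ.carrier)
    (hirr : ∀ f₁ f₂, f = f₁ * f₂ → (f₁.coeff.support : Set (ℤ × ℤ)).Subsingleton ∨
      (f₂.coeff.support : Set (ℤ × ℤ)).Subsingleton) : Prime f := by
  have hf0 := ne_zero_of_newtonPolygon hf
  refine Irreducible.prime ⟨not_isUnit_of_newtonPolygon hf, fun f₁ f₂ h => ?_⟩
  rw [h] at hf0
  exact (hirr f₁ f₂ h).imp (isUnit_of_support_subsingleton (left_ne_zero_of_mul hf0))
    (isUnit_of_support_subsingleton (right_ne_zero_of_mul hf0))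

/-- Division by a polynomial with Newton polygon `Δ` lowers the degree by one. -/
theorem mem_smul_of_mul {Δ : LatticePolygon} {f g : Laurent} (hf : newtonPolygon f = Δ.carrier)
    {k : ℕ} (hfg : ∀ w ∈ (f * g).coeff.support, latticeToReal w ∈ ((k + 1 : ℕ) : ℝ) • Δ.carrier)
    {u : ℤ × ℤ} (hu : u ∈ g.coeff.support) : latticeToReal u ∈ (k : ℝ) • Δ.carrier := by
  have key : ∀ e : ℝ × ℝ, e ≠ 0 → ∃ a ∈ f.coeff.support, (k : ℝ) * pairing e a ≤ pairing e u := by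
    intro e he
    obtain ⟨a, ha, -, h⟩ := le_pairing_of_mul hf hfg hu he
    refine ⟨a, ha, ?_⟩
    push_cast at h
    linarith
  rcases Nat.eq_zero_or_pos k with rfl | hk
  · have : u = 0 := by
      refine eq_zero_of_forall_pairing_nonneg fun e he => ?_
      obtain ⟨a, -, h⟩ := key e he
      rwa [Nat.cast_zero, zero_mul] at h
    subst this
    exact Δ.coneMonoid.zero_mem
  · have hk' : (0 : ℝ) < k := by exact_mod_cast hk
    rw [Set.mem_smul_set_iff_inv_smul_mem₀ hk'.ne', ← hf]
    refine mem_convexHull_of_forall_dot f.coeff.support.finite_toSet fun e => ?_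
    by_cases he : e = 0
    · obtain ⟨a, ha⟩ := support_nonempty_of_ne_zero (ne_zero_of_newtonPolygon hf)
      exact ⟨a, ha, by simp [he, lin, dot]⟩
    · obtain ⟨a, ha, h⟩ := key e he
      refine ⟨a, ha, ?_⟩
      rw [dot_smul, dot_latticeToReal, ← div_eq_inv_mul, le_div_iff₀ hk']
      linarith

namespace LatticePolygon

variable (Δ : LatticePolygon)

/-- Dehomogenization: the restriction to the dense torus. -/
def dehom : Δ.CoordAlgebra →+* Laurent :=
  AddMonoidAlgebra.mapDomainRingHom Puiseux
    ((AddMonoidHom.fst (ℤ × ℤ) ℕ).comp Δ.coneMonoid.subtype)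

variable {Δ}

theorem degree_of_mem_support {i : ℕ} {x : Δ.CoordAlgebra} (hx : x ∈ Δ.grading i)
    {p : Δ.coneMonoid} (hp : p ∈ x.coeff.support) : p.1.2 = i :=
  hx p hp

theorem mem_smul_of_mem_support_dehom {i : ℕ} {x : Δ.CoordAlgebra} (hx : x ∈ Δ.grading i)
    {u : ℤ × ℤ} (hu : u ∈ (Δ.dehom x).coeff.support) :
    latticeToReal u ∈ (i : ℝ) • Δ.carrier := by
  classical
  have := Finsupp.mapDomain_support hu
  obtain ⟨p, hp, rfl⟩ := Finset.mem_image.1 this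
  rw [← degree_of_mem_support hx hp]
  exact p.2

theorem dehom_injOn (i : ℕ) {x y : Δ.CoordAlgebra} (hx : x ∈ Δ.grading i) (hy : y ∈ Δ.grading i)
    (h : Δ.dehom x = Δ.dehom y) : x = y := by
  refine AddMonoidAlgebra.coeff_inj.1 (Finsupp.mapDomain_injOn {p : Δ.coneMonoid | p.1.2 = i}
    (f := fun p : Δ.coneMonoid => p.1.1) ?_ ?_ ?_ (AddMonoidAlgebra.coeff_inj.2 h))
  · intro p hp q hq hpq
    exact Subtype.ext (Prod.ext hpq ((hp : p.1.2 = i).trans (hq : q.1.2 = i).symm))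
  · exact fun p hp => degree_of_mem_support hx hp
  · exact fun p hp => degree_of_mem_support hy hp

/-- Every Laurent polynomial with exponents in `k Δ` is the dehomogenization of a form of
degree `k`. -/
theorem exists_dehom_eq {k : ℕ} {g : Laurent}
    (hg : ∀ u ∈ g.coeff.support, latticeToReal u ∈ (k : ℝ) • Δ.carrier) :
    ∃ c ∈ Δ.grading k, Δ.dehom c = g := by
  classical
  refine ⟨∑ u ∈ g.coeff.support.attach,
    AddMonoidAlgebra.single (⟨(u.1, k), hg u.1 u.2⟩ : Δ.coneMonoid) (g.coeff u.1), ?_, ?_⟩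
  · exact Submodule.sum_mem _ fun u _ => AddMonoidAlgebra.single_mem_gradeBy _ _ _
  · rw [map_sum]
    have : ∀ u ∈ g.coeff.support.attach, Δ.dehom (AddMonoidAlgebra.single
        (⟨(u.1, k), hg u.1 u.2⟩ : Δ.coneMonoid) (g.coeff u.1)) =
        AddMonoidAlgebra.single u.1 (g.coeff u.1) := fun u _ => by
      simp [dehom]
    rw [Finset.sum_congr rfl this, Finset.sum_attach g.coeff.support
      fun u => (AddMonoidAlgebra.single u (g.coeff u) : Laurent)]
    refine AddMonoidAlgebra.coeff_inj.1 ?_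
    have h2 := Finsupp.sum_single g.coeff
    conv_rhs => rw [← h2]
    simp [Finsupp.sum]

/-- A homogeneous form whose dehomogenization is divisible by that of `s` is a multiple of `s`. -/
theorem mem_span_of_dvd {s : Δ.Sections} (hs : newtonPolygon (Δ.dehom s.1) = Δ.carrier) {i : ℕ}
    {x : Δ.CoordAlgebra} (hx : x ∈ Δ.grading i) (h : Δ.dehom s.1 ∣ Δ.dehom x) :
    x ∈ Ideal.span {s.1} := by
  obtain ⟨g, hg⟩ := h
  by_cases hg0 : g = 0
  · have : x = 0 := dehom_injOn i hx (Submodule.zero_mem _) (by rw [hg, hg0, mul_zero, map_zero])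
    rw [this]
    exact Ideal.zero_mem _
  have hsupp : ∀ w ∈ (Δ.dehom s.1 * g).coeff.support, latticeToReal w ∈ (i : ℝ) • Δ.carrier := by
    rw [← hg]
    exact fun w hw => mem_smul_of_mem_support_dehom hx hw
  rcases i with - | k
  · exact absurd hsupp (not_support_subset_zero_smul hs hg0)
  · obtain ⟨c, hc, rfl⟩ := exists_dehom_eq fun u hu => mem_smul_of_mul hs hsupp hu
    have : x = s.1 * c := by
      refine dehom_injOn (k + 1) hx ?_ (by rw [hg, map_mul])
      rw [add_comm k 1]
      exact SetLike.mul_mem_graded s.2 hc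
    rw [this]
    exact Ideal.mul_mem_right _ _ (Ideal.mem_span_singleton_self _)

/-- A section with Newton polygon `Δ` that is prime on the torus generates a prime ideal of the
homogeneous coordinate algebra. It suffices to test homogeneous elements, and for these divisibility
can be tested on the torus by `mem_span_of_dvd`. -/
theorem isPrime_span {s : Δ.Sections} (hs : newtonPolygon (Δ.dehom s.1) = Δ.carrier)
    (hp : Prime (Δ.dehom s.1)) : (Ideal.span {s.1} : Ideal Δ.CoordAlgebra).IsPrime := by
  have hdvd : ∀ {x : Δ.CoordAlgebra}, x ∈ Ideal.span {s.1} → Δ.dehom s.1 ∣ Δ.dehom x := by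
    intro x hx
    exact map_dvd _ (Ideal.mem_span_singleton.1 hx)
  refine Ideal.IsHomogeneous.isPrime_of_homogeneous_mem_or_mem (𝒜 := Δ.grading)
    (Ideal.homogeneous_span _ _ fun x hx => ?_) (fun h => ?_) ?_
  · rw [Set.mem_singleton_iff.1 hx]
    exact ⟨1, s.2⟩
  · have := hdvd (h ▸ Submodule.mem_top : (1 : Δ.CoordAlgebra) ∈ _)
    rw [map_one] at this
    exact hp.not_isUnit (isUnit_of_dvd_one this)
  · rintro x y ⟨i, hx⟩ ⟨j, hy⟩ hxy
    have := hdvd hxy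
    rw [map_mul] at this
    exact (hp.dvd_or_dvd this).imp (mem_span_of_dvd hs hx) (mem_span_of_dvd hs hy)

/-- No monomial is a multiple of `s`. -/
theorem single_notMem_span {s : Δ.Sections} (hp : Prime (Δ.dehom s.1)) (p : Δ.coneMonoid) :
    (AddMonoidAlgebra.single p 1 : Δ.CoordAlgebra) ∉ Ideal.span {s.1} := by
  intro h
  have h1 := map_dvd Δ.dehom (Ideal.mem_span_singleton.1 h)
  refine hp.not_isUnit (isUnit_of_dvd_unit h1 ?_)
  have : Δ.dehom (AddMonoidAlgebra.single p 1) = AddMonoidAlgebra.single p.1.1 1 := by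
    simp [dehom]
  rw [this]
  refine isUnit_of_support_subsingleton (by simp) fun a ha b hb => ?_
  rw [AddMonoidAlgebra.coeff_single] at ha hb
  exact (Finset.mem_singleton.1 (Finsupp.support_single_subset ha)).trans
    (Finset.mem_singleton.1 (Finsupp.support_single_subset hb)).symm

end LatticePolygon

/-! ### Zero schemes of homogeneous prime elements -/

namespace AlgebraicGeometry.Proj

variable {A σ : Type} [CommRing A] [SetLike σ A] [AddSubgroupClass σ A] (𝒜 : ℕ → σ) [GradedRing 𝒜]

/-- The value at `x` of a section, in the localization at `x` of the homogeneous coordinate ring. -/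
def germAt (U : (Proj 𝒜).Opens) (x : ProjectiveSpectrum 𝒜) (hx : x ∈ U) :
    Γ(Proj 𝒜, U) →+* Localization.AtPrime x.asHomogeneousIdeal.toIdeal :=
  (algebraMap (HomogeneousLocalization.AtPrime 𝒜 x.asHomogeneousIdeal.toIdeal)
    (Localization.AtPrime x.asHomogeneousIdeal.toIdeal)).comp
      (AlgebraicGeometry.openToLocalization 𝒜 U x hx).hom

variable {𝒜}

theorem mem_basicOpen_iff_isUnit_germAt {U : (Proj 𝒜).Opens} {x : ProjectiveSpectrum 𝒜} (hx : x ∈ U)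
    (h : Γ(Proj 𝒜, U)) : x ∈ (Proj 𝒜).basicOpen h ↔ IsUnit (germAt 𝒜 U x hx h) := by
  have e1 : IsUnit (germAt 𝒜 U x hx h) ↔
      IsUnit ((AlgebraicGeometry.openToLocalization 𝒜 U x hx).hom h) :=
    HomogeneousLocalization.isUnit_iff_isUnit_val _ _ _
  have e3 := isUnit_map_iff (Proj.stalkIso' 𝒜 x)
    ((ProjectiveSpectrum.Proj.structureSheaf 𝒜).presheaf.germ U x hx h)
  rw [Proj.stalkIso'_germ 𝒜 U x hx h] at e3
  exact (Scheme.mem_basicOpen (Proj 𝒜) h x hx).trans (e3.symm.trans e1.symm)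

/-- Near every point a section is a fraction of homogeneous elements of the same degree. -/
theorem exists_fraction {U : (Proj 𝒜).Opens} {x : ProjectiveSpectrum 𝒜} (hx : x ∈ U)
    (h : Γ(Proj 𝒜, U)) : ∃ (V : (Proj 𝒜).Opens) (_ : x ∈ V) (a b : A), ∀ (y : ProjectiveSpectrum 𝒜) (hy : y ∈ U),
      y ∈ V → b ∉ y.asHomogeneousIdeal.toIdeal ∧
        germAt 𝒜 U y hy h * algebraMap A _ b = algebraMap A _ a := by
  obtain ⟨V, hxV, i, n, a, b, hb, e⟩ := h.2 ⟨x, hx⟩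
  refine ⟨V, hxV, a.1, b.1, fun y hy hyV => ⟨hb ⟨y, hyV⟩, ?_⟩⟩
  have h1 : h.1 ⟨y, hy⟩ = HomogeneousLocalization.mk ⟨n, a, b, hb ⟨y, hyV⟩⟩ := e ⟨y, hyV⟩
  have h2 : germAt 𝒜 U y hy h = (h.1 ⟨y, hy⟩).val := rfl
  rw [h2, h1, HomogeneousLocalization.val_mk, Localization.mk_eq_mk']
  exact IsLocalization.mk'_spec _ _ _

/-- If `s` generates a homogeneous prime ideal, the functions whose germs are multiples of `s` are
those that vanish at the corresponding point. -/
theorem forall_germAt_mem_iff {s : A} {η : ProjectiveSpectrum 𝒜}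
    (hη : η.asHomogeneousIdeal.toIdeal = Ideal.span {s}) {U : (Proj 𝒜).Opens} (h : Γ(Proj 𝒜, U)) :
    (∀ (x : ProjectiveSpectrum 𝒜) (hx : x ∈ U), germAt 𝒜 U x hx h ∈ Ideal.span {algebraMap A _ s}) ↔
      η ∉ (Proj 𝒜).basicOpen h := by
  have unit : ∀ (x : ProjectiveSpectrum 𝒜) (b : A), b ∉ x.asHomogeneousIdeal.toIdeal →
      IsUnit (algebraMap A (Localization.AtPrime x.asHomogeneousIdeal.toIdeal) b) := fun x b hb =>
    IsLocalization.map_units (M := x.asHomogeneousIdeal.toIdeal.primeCompl) _ ⟨b, hb⟩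
  constructor
  · intro hU hmem
    have hηU := (Proj 𝒜).basicOpen_le h hmem
    rw [mem_basicOpen_iff_isUnit_germAt hηU] at hmem
    have h1 := Ideal.eq_top_of_isUnit_mem _ (hU η hηU) hmem
    rw [Ideal.span_singleton_eq_top] at h1
    have h2 := (IsLocalization.AtPrime.isUnit_to_map_iff _ η.asHomogeneousIdeal.toIdeal s).1 h1
    exact h2 (hη ▸ Ideal.mem_span_singleton_self s)
  · intro hη' x hx
    by_cases hs : s ∈ x.asHomogeneousIdeal.toIdeal
    swap
    · rw [Ideal.span_singleton_eq_top.2 (unit x s hs)]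
      trivial
    have hle : η.asHomogeneousIdeal.toIdeal ≤ x.asHomogeneousIdeal.toIdeal := by
      rw [hη, Ideal.span_singleton_le_iff_mem]
      exact hs
    have hsp : η ⤳ x :=
      specializes_iff_mem_closure.2 ((ProjectiveSpectrum.le_iff_mem_closure 𝒜 η x).1 hle)
    have hηU := hsp.mem_open U.2 hx
    -- `h` is a fraction `a / b` near `x`, hence also at `η`, where it is not a unit: `s` divides `a`
    obtain ⟨V, hxV, a, b, hab⟩ := exists_fraction hx h
    obtain ⟨hb, e⟩ := hab η hηU (hsp.mem_open V.2 hxV)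
    obtain ⟨hb', e'⟩ := hab x hx hxV
    have ha : a ∈ η.asHomogeneousIdeal.toIdeal := by
      by_contra ha
      have h1 := unit η a ha
      rw [← e] at h1
      exact hη' ((mem_basicOpen_iff_isUnit_germAt hηU h).2 (isUnit_of_mul_isUnit_left h1))
    rw [hη] at ha
    obtain ⟨c, rfl⟩ := Ideal.mem_span_singleton.1 ha
    rw [← Ideal.mul_unit_mem_iff_mem _ (unit x b hb'), e', map_mul]
    exact Ideal.mul_mem_right _ _ (Ideal.mem_span_singleton_self _)

end AlgebraicGeometry.Proj

namespace AlgebraicGeometry.Scheme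

variable {X : Scheme.{0}} (η : X)

instance : QuasiCompact (X.fromSpecResidueField η) where
  isCompact_preimage _ _ _ := (Set.toFinite _).isCompact

theorem mem_ker_fromSpecResidueField_iff {U : X.Opens} (h : Γ(X, U)) :
    h ∈ RingHom.ker ((X.fromSpecResidueField η).app U).hom ↔ η ∉ X.basicOpen h := by
  rw [RingHom.mem_ker, ← basicOpen_eq_bot_iff, ← Scheme.preimage_basicOpen]
  constructor
  · intro h1 h2
    have : η ∈ Set.range (X.fromSpecResidueField η) := by
      rw [Scheme.range_fromSpecResidueField]
      rfl
    obtain ⟨y, hy⟩ := this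
    have h3 : y ∈ (X.fromSpecResidueField η) ⁻¹ᵁ X.basicOpen h := by
      change X.fromSpecResidueField η y ∈ X.basicOpen h
      rwa [hy]
    rw [h1] at h3
    exact h3
  · intro h1
    refine eq_bot_iff.2 fun y hy => h1 ?_
    have h2 : X.fromSpecResidueField η y ∈ X.basicOpen h := hy
    rwa [Scheme.fromSpecResidueField_apply] at h2

/-- The closure of a point, with its reduced structure, is an integral scheme. -/
theorem isIntegral_subscheme_ker :
    IsIntegral (X.fromSpecResidueField η).ker.subscheme := by
  set j := X.fromSpecResidueField η
  have hirr : IrreducibleSpace j.ker.subscheme := by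
    have h := j.toImage.denseRange.closure_range
    rw [← Set.image_univ] at h
    rw [irreducibleSpace_def]
    change IsIrreducible (Set.univ : Set j.image)
    rw [← h]
    exact ((IrreducibleSpace.isIrreducible_univ _).image _
      j.toImage.continuous.continuousOn).closure
  have hred : IsReduced j.ker.subscheme := by
    have (U : X.affineOpens) : IsReduced (Spec (.of (Γ(X, U.1) ⧸ j.ker.ideal U))) := by
      have h1 : (j.ker.ideal U).IsRadical := by
        rw [Hom.ker_apply, RingHom.ker_eq_comap_bot]
        exact Ideal.IsRadical.comap _ Ideal.isRadical_bot
      have := (Ideal.isRadical_iff_quotient_reduced _).1 h1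
      infer_instance
    have (U : j.ker.subschemeCover.openCover.I₀) :
        IsReduced (j.ker.subschemeCover.openCover.X U) := this U
    exact IsReduced.of_openCover _ j.ker.subschemeCover.openCover
  exact isIntegral_of_irreducibleSpace_of_isReduced _

theorem range_subschemeι_ker :
    Set.range (X.fromSpecResidueField η).ker.subschemeι = closure {η} := by
  rw [IdealSheafData.range_subschemeι, Hom.support_ker]
  rw [← Scheme.range_fromSpecResidueField]

end AlgebraicGeometry.Scheme

namespace LatticePolygon

variable {Δ : LatticePolygon}

/-- The generic point of the zero scheme of `s`. -/
theorem exists_genericPoint {s : Δ.Sections} (hs : newtonPolygon (Δ.dehom s.1) = Δ.carrier)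
    (hp : Prime (Δ.dehom s.1)) :
    ∃ η : ProjectiveSpectrum Δ.grading, η.asHomogeneousIdeal.toIdeal = Ideal.span {s.1} := by
  obtain ⟨u, hu⟩ := support_nonempty_of_ne_zero hp.ne_zero
  have hu' := mem_smul_of_mem_support_dehom s.2 hu
  refine ⟨⟨⟨Ideal.span {s.1}, Ideal.homogeneous_span _ _ fun x hx => ?_⟩, isPrime_span hs hp,
    fun h => single_notMem_span hp ⟨(u, 1), hu'⟩ (h ?_)⟩, rfl⟩
  · rw [Set.mem_singleton_iff.1 hx]
    exact ⟨1, s.2⟩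
  · exact HomogeneousIdeal.mem_irrelevant_of_mem Δ.grading one_pos
      (AddMonoidAlgebra.single_mem_gradeBy _ _ _)

/-- The ideal sheaf of the zero scheme consists of the functions that vanish at its generic point. -/
theorem idealSheaf_eq {s : Δ.Sections} {η : ProjectiveSpectrum Δ.grading}
    (hη : η.asHomogeneousIdeal.toIdeal = Ideal.span {s.1}) :
    Δ.idealSheaf s = (Scheme.fromSpecResidueField (Proj Δ.grading) η).ker := by
  refine congrArg Scheme.IdealSheafData.ofIdeals (funext fun U => Ideal.ext fun h => ?_)
  refine Iff.trans ?_ ((Proj.forall_germAt_mem_iff hη h).trans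
    (Scheme.mem_ker_fromSpecResidueField_iff (X := Proj Δ.grading) η h).symm)
  exact Ideal.mem_iInf.trans (forall_congr' fun x => Ideal.mem_iInf)

theorem isIntegral_subscheme {s : Δ.Sections} (hs : newtonPolygon (Δ.dehom s.1) = Δ.carrier)
    (hp : Prime (Δ.dehom s.1)) : IsIntegral (Δ.idealSheaf s).subscheme := by
  obtain ⟨η, hη⟩ := exists_genericPoint hs hp
  rw [idealSheaf_eq hη]
  exact Scheme.isIntegral_subscheme_ker (X := Proj Δ.grading) η

/-- The section `s` vanishes at the points of its zero scheme. -/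
theorem mem_of_mem_range_subschemeι {s : Δ.Sections}
    (hs : newtonPolygon (Δ.dehom s.1) = Δ.carrier)
    (hp : Prime (Δ.dehom s.1)) {x : ProjectiveSpectrum Δ.grading}
    (hx : x ∈ Set.range (Δ.idealSheaf s).subschemeι) : s.1 ∈ x.asHomogeneousIdeal.toIdeal := by
  obtain ⟨η, hη⟩ := exists_genericPoint hs hp
  rw [idealSheaf_eq hη] at hx
  have h1 : x ∈ closure {η} :=
    (Scheme.range_subschemeι_ker (X := Proj Δ.grading) η) ▸ hx
  have h2 := (ProjectiveSpectrum.le_iff_mem_closure Δ.grading η x).2 h1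
  have h3 : s.1 ∈ η.asHomogeneousIdeal.toIdeal := hη ▸ Ideal.mem_span_singleton_self _
  exact h2 h3

end LatticePolygon

/-! ### Smooth charts of the toric surface -/

namespace RingHom.Smooth

theorem polynomial_C (R : Type*) [CommRing R] : (Polynomial.C : R →+* Polynomial R).Smooth := by
  have h1 : (algebraMap R (MvPolynomial Unit R)).Smooth :=
    RingHom.smooth_algebraMap.2 ⟨inferInstance, inferInstance⟩
  have h2 := h1.comp (RingHom.Smooth.of_bijective
    (f := (MvPolynomial.uniqueAlgEquiv R Unit).toRingEquiv.toRingHom)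
      (MvPolynomial.uniqueAlgEquiv R Unit).bijective)
  convert! h2 using 1
  ext a
  simp

theorem single_zero_nat (R : Type*) [CommRing R] :
    (AddMonoidAlgebra.singleZeroRingHom : R →+* AddMonoidAlgebra R ℕ).Smooth := by
  have h2 := (polynomial_C R).comp (RingHom.Smooth.of_bijective
    (f := (Polynomial.toFinsuppIso R).toRingHom) (RingEquiv.bijective _))
  convert! h2 using 1

theorem single_zero_int (R : Type*) [CommRing R] :
    (AddMonoidAlgebra.singleZeroRingHom : R →+* AddMonoidAlgebra R ℤ).Smooth := by
  have h1 : (algebraMap (Polynomial R) (LaurentPolynomial R)).Smooth := by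
    rw [RingHom.smooth_algebraMap]
    exact Algebra.Smooth.of_isLocalization_Away (Polynomial.X : Polynomial R)
  have h2 := (polynomial_C R).comp h1
  convert! h2 using 1
  ext a
  simp

theorem single_zero_prod (R : Type*) [CommRing R] {N : Type*} [AddCommMonoid N]
    (hN : (AddMonoidAlgebra.singleZeroRingHom : R →+* AddMonoidAlgebra R N).Smooth) :
    (AddMonoidAlgebra.singleZeroRingHom : R →+* AddMonoidAlgebra R (ℤ × N)).Smooth := by
  have h2 := (hN.comp (single_zero_int (AddMonoidAlgebra R N))).comp (RingHom.Smooth.of_bijective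
    (f := (AddMonoidAlgebra.curryRingEquiv (R := R) (M := ℤ) (N := N)).symm.toRingHom)
    (RingEquiv.bijective _))
  convert! h2 using 1
  exact RingHom.ext fun a =>
    (AddMonoidAlgebra.curryRingEquiv_symm_single (0 : ℤ) (0 : N) a).symm

/-- Smoothness of an algebra can be tested on any ring with the same image in a common
overring. -/
theorem of_range_eq {K R R' S : Type*} [CommRing K] [CommRing R] [CommRing R'] [CommRing S]
    {φ : K →+* R} {φ' : K →+* R'} {ρ : R →+* S} {ι : R' →+* S} (hρ : Function.Injective ρ)
    (hι : Function.Injective ι) (hcomp : ρ.comp φ = ι.comp φ') (h1 : ∀ x, ρ x ∈ ι.range)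
    (h2 : ∀ y, ι y ∈ ρ.range) (h : φ'.Smooth) : φ.Smooth := by
  choose f hf using h2
  let e : R' →+* R :=
    { toFun := f
      map_one' := hρ (by rw [hf, map_one, map_one])
      map_zero' := hρ (by rw [hf, map_zero, map_zero])
      map_mul' := fun a b => hρ (by rw [hf, map_mul, map_mul, hf, hf])
      map_add' := fun a b => hρ (by rw [hf, map_add, map_add, hf, hf]) }
  have he : Function.Bijective e := by
    refine ⟨fun a b hab => hι ?_, fun x => ?_⟩
    · rw [← hf, ← hf]
      exact congrArg ρ hab
    · obtain ⟨y, hy⟩ := h1 x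
      exact ⟨y, hρ ((hf y).trans hy)⟩
  have : φ = e.comp φ' := by
    ext a
    refine hρ ((RingHom.congr_fun hcomp a).trans (hf _).symm)
  rw [this]
  exact h.comp (RingHom.Smooth.of_bijective he)

end RingHom.Smooth

/-- The direction of a linear form that vanishes on a lattice vector is a primitive vector. -/
theorem exists_primitive {e : ℝ × ℝ} (he : e ≠ 0) {k : ℤ × ℤ} (hk : k ≠ 0) (h : pairing e k = 0) :
    ∃ c : ℤ × ℤ, latticeLength c = 1 ∧ ∃ t : ℝ, 0 < t ∧ e = t • latticeToReal c := by
  set k' := primitivePart k with hk'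
  have hlen := latticeLength_primitivePart hk
  have hlen' : latticeLength (latticeRot k') = 1 := by
    rw [← hlen, latticeLength, latticeLength, latticeRot, Int.gcd_neg, Int.gcd_comm]
  have hne := ne_zero_of_latticeLength hlen
  have hN := normSq_latticeToReal_pos hne
  have h1 : pairing e k' = 0 := by
    have h2 : pairing e k = latticeLength k * pairing e k' := by
      conv_lhs => rw [← nsmul_primitivePart k, ← dot_latticeToReal, latticeToReal_nsmul, dot_smul,
        dot_latticeToReal]
    rw [h] at h2
    exact (mul_eq_zero.1 h2.symm).resolve_left (by exact_mod_cast (latticeLength_pos hk).ne')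
  set s := (e.1 * k'.2 - e.2 * k'.1) / normSq (latticeToReal k') with hs
  have hes : e = s • latticeToReal (latticeRot k') := by
    simp only [lin] at h1
    simp only [normSq, latticeToReal] at hN hs
    ext
    · simp only [latticeToReal, latticeRot, Prod.smul_fst, smul_eq_mul, hs]
      rw [div_mul_eq_mul_div, eq_div_iff hN.ne']
      linear_combination (k'.1 : ℝ) * h1
    · simp only [latticeToReal, latticeRot, Prod.smul_snd, smul_eq_mul, hs]
      rw [div_mul_eq_mul_div, eq_div_iff hN.ne']
      push_cast
      linear_combination (k'.2 : ℝ) * h1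
  have hs0 : s ≠ 0 := by
    intro h0
    rw [h0, zero_smul] at hes
    exact he hes
  rcases lt_or_gt_of_ne hs0 with hneg | hpos
  · refine ⟨-latticeRot k', by rw [latticeLength_neg, hlen'], -s, neg_pos.2 hneg, ?_⟩
    rw [latticeToReal_neg, smul_neg, neg_smul, neg_neg]
    exact hes
  · exact ⟨_, hlen', s, hpos, hes⟩

/-- A half plane bounded by a rational line is, as a monoid, the product of `ℤ` and `ℕ`. -/
theorem exists_halfPlane_basis {c : ℤ × ℤ} (hc : latticeLength c = 1) :
    ∃ φ : ℤ × ℕ →+ ℤ × ℤ, Function.Injective φ ∧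
      ∀ m : ℤ × ℤ, 0 ≤ c.1 * m.1 + c.2 * m.2 ↔ m ∈ Set.range φ := by
  obtain ⟨x, y, hxy⟩ : ∃ x y : ℤ, c.1 * x + c.2 * y = 1 := by
    refine ⟨Int.gcdA c.1 c.2, Int.gcdB c.1 c.2, ?_⟩
    rw [← Int.gcd_eq_gcd_ab]
    exact_mod_cast hc
  have hval : ∀ (i : ℤ) (j : ℕ), c.1 * (-i * c.2 + j * x) + c.2 * (i * c.1 + j * y) = j := by
    intro i j
    linear_combination (j : ℤ) * hxy
  refine ⟨⟨⟨fun p => (-p.1 * c.2 + p.2 * x, p.1 * c.1 + p.2 * y), by simp⟩, fun p q => ?_⟩, ?_, ?_⟩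
  · ext <;> simp <;> ring
  · rintro ⟨i, j⟩ ⟨i', j'⟩ h
    obtain ⟨h1, h2⟩ := Prod.ext_iff.1 h
    simp only [AddMonoidHom.coe_mk, ZeroHom.coe_mk] at h1 h2
    have e1 := hval i j
    have e2 := hval i' j'
    rw [h1, h2, e2] at e1
    have e3 : j' = j := by exact_mod_cast e1
    subst e3
    refine Prod.ext ?_ rfl
    linear_combination y * (-h1) + x * h2 + (i' - i) * hxy
  · intro m
    constructor
    · intro hm
      refine ⟨(x * m.2 - y * m.1, (c.1 * m.1 + c.2 * m.2).toNat), ?_⟩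
      have := Int.toNat_of_nonneg hm
      ext
      · simp only [AddMonoidHom.coe_mk, ZeroHom.coe_mk, this]
        linear_combination m.1 * hxy
      · simp only [AddMonoidHom.coe_mk, ZeroHom.coe_mk, this]
        linear_combination m.2 * hxy
    · rintro ⟨⟨i, j⟩, rfl⟩
      simp only [AddMonoidHom.coe_mk, ZeroHom.coe_mk, hval]
      exact Int.natCast_nonneg j

theorem Laurent.mem_of_forall_single_mem {H : Subring Laurent} {f : Laurent}
    (h : ∀ u ∈ f.coeff.support, AddMonoidAlgebra.single u (f.coeff u) ∈ H) : f ∈ H := by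
  have : f = ∑ u ∈ f.coeff.support, AddMonoidAlgebra.single u (f.coeff u) := by
    refine AddMonoidAlgebra.coeff_inj.1 ?_
    conv_lhs => rw [← Finsupp.sum_single f.coeff]
    simp [Finsupp.sum]
  rw [this]
  exact H.sum_mem h

namespace LatticePolygon

variable {Δ : LatticePolygon}

/-- The monomial of exponent `p` in the homogeneous coordinate algebra. -/
def monomial (p : Δ.coneMonoid) : Δ.CoordAlgebra := AddMonoidAlgebra.single p 1

theorem monomial_mem (p : Δ.coneMonoid) : monomial p ∈ Δ.grading p.1.2 :=
  AddMonoidAlgebra.single_mem_gradeBy _ _ _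

theorem dehom_single (p : Δ.coneMonoid) (a : Puiseux) :
    Δ.dehom (AddMonoidAlgebra.single p a) = AddMonoidAlgebra.single p.1.1 a := by
  simp [dehom]

theorem isUnit_dehom_monomial (p : Δ.coneMonoid) : IsUnit (Δ.dehom (monomial p)) := by
  refine IsUnit.of_mul_eq_one (AddMonoidAlgebra.single (-p.1.1) 1) ?_
  rw [monomial, dehom_single, AddMonoidAlgebra.single_mul_single, add_neg_cancel, mul_one,
    AddMonoidAlgebra.one_def]

/-- Dehomogenization on the chart where the monomial of exponent `p` does not vanish. -/
def dehomAway (p : Δ.coneMonoid) :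
    HomogeneousLocalization.Away Δ.grading (monomial p) →+* Laurent :=
  (IsLocalization.Away.lift (S := Localization.Away (monomial p)) (monomial p)
    (isUnit_dehom_monomial p)).comp
    (algebraMap (HomogeneousLocalization.Away Δ.grading (monomial p))
      (Localization.Away (monomial p)))

theorem dehomAway_mk_mul (p : Δ.coneMonoid) (n : ℕ) (x : Δ.CoordAlgebra)
    (hx : x ∈ Δ.grading (n • p.1.2)) :
    dehomAway p (HomogeneousLocalization.Away.mk Δ.grading (monomial_mem p) n x hx) *
      AddMonoidAlgebra.single (n • p.1.1) 1 = Δ.dehom x := by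
  have h1 : (AddMonoidAlgebra.single (n • p.1.1) 1 : Laurent) = Δ.dehom (monomial p ^ n) := by
    rw [map_pow, monomial, dehom_single, AddMonoidAlgebra.single_pow, one_pow]
  have h2 : Localization.mk x (⟨monomial p ^ n, ⟨n, rfl⟩⟩ : Submonoid.powers (monomial p)) *
      algebraMap Δ.CoordAlgebra (Localization.Away (monomial p)) (monomial p ^ n) =
      algebraMap _ _ x := by
    rw [Localization.mk_eq_mk']
    exact IsLocalization.mk'_spec _ _ _
  rw [h1, dehomAway, RingHom.comp_apply, HomogeneousLocalization.algebraMap_apply,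
    HomogeneousLocalization.Away.val_mk,
    ← IsLocalization.Away.lift_eq (S := Localization.Away (monomial p)) (monomial p)
      (isUnit_dehom_monomial p) (monomial p ^ n), ← map_mul, h2, IsLocalization.Away.lift_eq]

theorem dehomAway_injective (p : Δ.coneMonoid) : Function.Injective (dehomAway p) := by
  rw [injective_iff_map_eq_zero]
  intro z hz
  obtain ⟨n, x, hx, rfl⟩ := HomogeneousLocalization.Away.mk_surjective Δ.grading (monomial_mem p) z
  have h := dehomAway_mk_mul p n x hx
  rw [hz, zero_mul] at h
  have : x = 0 := dehom_injOn _ hx (Submodule.zero_mem _) (by rw [← h, map_zero])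
  exact HomogeneousLocalization.mk_eq_zero_of_num _ (Subtype.ext this)

/-- The structure map of the chart of exponent `p`. -/
def awayStr (p : Δ.coneMonoid) :
    Puiseux →+* HomogeneousLocalization.Away Δ.grading (monomial p) :=
  (HomogeneousLocalization.fromZeroRingHom Δ.grading (Submonoid.powers (monomial p))).comp
    (algebraMap Puiseux (Δ.grading 0))

theorem dehomAway_awayStr (p : Δ.coneMonoid) (a : Puiseux) :
    dehomAway p (awayStr p a) = AddMonoidAlgebra.single 0 a := by
  have h : ((awayStr p a).val : Localization.Away (monomial p)) =
      algebraMap Δ.CoordAlgebra _ (AddMonoidAlgebra.single 0 a) := by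
    change Localization.mk ((algebraMap Puiseux (Δ.grading 0) a : Δ.grading 0) : Δ.CoordAlgebra)
      (1 : Submonoid.powers (monomial p)) = _
    rw [Localization.mk_one_eq_algebraMap]
    rfl
  rw [dehomAway, RingHom.comp_apply, HomogeneousLocalization.algebraMap_apply, h,
    IsLocalization.Away.lift_eq, dehom_single]
  rfl

/-- The chart of exponent `p` is smooth if its character monoid is a lattice or a half plane in a
lattice. -/
theorem smooth_awayStr {p : Δ.coneMonoid} {N : Type} [AddCommMonoid N]
    (hN : (AddMonoidAlgebra.singleZeroRingHom : Puiseux →+* AddMonoidAlgebra Puiseux N).Smooth)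
    {φ : N →+ ℤ × ℤ} (hφ : Function.Injective φ)
    (h : ∀ m, (∃ k : ℕ, (m + k • p.1.1, k * p.1.2) ∈ Δ.coneMonoid) ↔ m ∈ Set.range φ) :
    (awayStr p).Smooth := by
  refine RingHom.Smooth.of_range_eq (ρ := dehomAway p) (dehomAway_injective p)
    (ι := AddMonoidAlgebra.mapDomainRingHom Puiseux φ)
    (AddMonoidAlgebra.mapDomain_injective hφ) ?_ ?_ ?_ hN
  · ext a : 1
    rw [RingHom.comp_apply, dehomAway_awayStr]
    simp [AddMonoidAlgebra.singleZeroRingHom]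
  · intro z
    obtain ⟨n, x, hx, rfl⟩ := HomogeneousLocalization.Away.mk_surjective Δ.grading (monomial_mem p) z
    refine Laurent.mem_of_forall_single_mem fun m hm => ?_
    have h1 := dehomAway_mk_mul p n x hx
    set f := dehomAway p (HomogeneousLocalization.Away.mk Δ.grading (monomial_mem p) n x hx)
    have h2 : m + n • p.1.1 ∈ (Δ.dehom x).coeff.support := by
      rw [← h1, Finsupp.mem_support_iff, AddMonoidAlgebra.coeff_mul_single_add, mul_one]
      exact Finsupp.mem_support_iff.1 hm
    obtain ⟨i, hi⟩ := (h m).1 ⟨n, mem_smul_of_mem_support_dehom hx h2⟩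
    refine ⟨AddMonoidAlgebra.single i (f.coeff m), ?_⟩
    rw [← hi]
    simp
  · intro y
    have : ∀ i a, AddMonoidAlgebra.mapDomainRingHom Puiseux φ (AddMonoidAlgebra.single i a) ∈
        (dehomAway p).range := by
      intro i a
      obtain ⟨k, hk⟩ := (h (φ i)).2 ⟨i, rfl⟩
      refine ⟨HomogeneousLocalization.Away.mk Δ.grading (monomial_mem p) k
        (AddMonoidAlgebra.single ⟨_, hk⟩ a) (AddMonoidAlgebra.single_mem_gradeBy _ _ _), ?_⟩
      have h1 := dehomAway_mk_mul p k (AddMonoidAlgebra.single ⟨_, hk⟩ a)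
        (AddMonoidAlgebra.single_mem_gradeBy _ _ _)
      have h3 : IsUnit (AddMonoidAlgebra.single (k • p.1.1) 1 : Laurent) :=
        IsUnit.of_mul_eq_one (AddMonoidAlgebra.single (-(k • p.1.1)) 1) (by
          rw [AddMonoidAlgebra.single_mul_single, add_neg_cancel, mul_one,
            AddMonoidAlgebra.one_def])
      refine h3.mul_right_cancel (h1.trans ?_)
      rw [dehom_single]
      simp
    induction y using AddMonoidAlgebra.induction_linear with
    | zero => rw [map_zero]; exact Subring.zero_mem _
    | add x y hx hy => rw [map_add]; exact Subring.add_mem _ hx hy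
    | single i a => exact this i a

/-- The chart of exponent `p` lies in the smooth locus if its coordinate algebra is smooth. -/
theorem mem_smoothLocus {p : Δ.coneMonoid} (hp : 0 < p.1.2) (h : (awayStr p).Smooth)
    {x : ProjectiveSpectrum Δ.grading} (hx : monomial p ∉ x.asHomogeneousIdeal) :
    x ∈ Δ.smoothLocus := by
  refine ⟨Proj.basicOpen Δ.grading (monomial p), hx, ?_⟩
  have h1 : (Proj.basicOpen Δ.grading (monomial p)).ι =
      (Proj.basicOpenIsoSpec Δ.grading (monomial p) (monomial_mem p) hp).hom ≫
        Proj.awayι Δ.grading (monomial p) (monomial_mem p) hp := by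
    rw [← Proj.basicOpenIsoSpec_inv_ι, Iso.hom_inv_id_assoc]
  have h2 : (Proj.basicOpen Δ.grading (monomial p)).ι ≫ (Proj.toSpecZero Δ.grading ≫
      Spec.map (CommRingCat.ofHom (algebraMap Puiseux (Δ.grading 0)))) =
      (Proj.basicOpenIsoSpec Δ.grading (monomial p) (monomial_mem p) hp).hom ≫
        Spec.map (CommRingCat.ofHom (awayStr p)) := by
    rw [h1, Category.assoc, Proj.awayι_toSpecZero_assoc, ← Spec.map_comp]
    rfl
  have h3 : Smooth (Spec.map (CommRingCat.ofHom (awayStr p))) :=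
    (HasRingHomProperty.Spec_iff (P := @Smooth)).2 h
  have h4 : Smooth ((Proj.basicOpenIsoSpec Δ.grading (monomial p) (monomial_mem p) hp).hom ≫
        Spec.map (CommRingCat.ofHom (awayStr p))) := inferInstance
  rw [← h2] at h4
  exact h4

end LatticePolygon

/-! ### Points of the polygon that are not vertices -/

/-- The cone of directions in which one can move from `p` without leaving `D`. -/
def feasibleDirections (D : Set (ℝ × ℝ)) (p : ℝ × ℝ) : Set (ℝ × ℝ) :=
  {m | ∃ ε : ℝ, 0 < ε ∧ p + ε • m ∈ D}

section

variable {D : Set (ℝ × ℝ)} {p : ℝ × ℝ}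

theorem add_smul_mem_of_le (hD : Convex ℝ D) (hp : p ∈ D) {m : ℝ × ℝ} {ε ε' : ℝ}
    (h : p + ε • m ∈ D) (h0 : 0 ≤ ε') (h1 : ε' ≤ ε) : p + ε' • m ∈ D := by
  rcases h0.eq_or_lt with rfl | h0
  · simpa using hp
  have hε := h0.trans_le h1
  have := hD.add_smul_sub_mem hp h (t := ε' / ε) ⟨by positivity, (div_le_one hε).2 h1⟩
  rwa [add_sub_cancel_left, smul_smul, div_mul_cancel₀ _ hε.ne'] at this

theorem smul_mem_feasibleDirections (hp : p ∈ D) {m : ℝ × ℝ} (hm : m ∈ feasibleDirections D p)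
    {t : ℝ} (ht : 0 ≤ t) : t • m ∈ feasibleDirections D p := by
  obtain ⟨ε, hε, h⟩ := hm
  rcases ht.eq_or_lt with rfl | ht
  · exact ⟨1, one_pos, by simpa using hp⟩
  · refine ⟨ε / t, by positivity, ?_⟩
    rwa [smul_smul, div_mul_cancel₀ _ ht.ne']

theorem add_mem_feasibleDirections (hD : Convex ℝ D) (hp : p ∈ D) {m m' : ℝ × ℝ}
    (hm : m ∈ feasibleDirections D p) (hm' : m' ∈ feasibleDirections D p) :
    m + m' ∈ feasibleDirections D p := by
  obtain ⟨ε, hε, h⟩ := hm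
  obtain ⟨ε', hε', h'⟩ := hm'
  refine ⟨min ε ε' / 2, by positivity, ?_⟩
  have h1 := add_smul_mem_of_le hD hp h (lt_min hε hε').le (min_le_left ε ε')
  have h2 := add_smul_mem_of_le hD hp h' (lt_min hε hε').le (min_le_right ε ε')
  have h3 := hD h1 h2 (a := 1 / 2) (b := 1 / 2) (by norm_num) (by norm_num) (by norm_num)
  convert h3 using 1
  module

theorem sub_mem_feasibleDirections {x : ℝ × ℝ} (hx : x ∈ D) : x - p ∈ feasibleDirections D p :=
  ⟨1, one_pos, by simpa using hx⟩

/-- At an interior point every direction is feasible. -/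
theorem mem_feasibleDirections_of_mem_interior (h : p ∈ interior D) (m : ℝ × ℝ) :
    m ∈ feasibleDirections D p := by
  have h1 : Filter.Tendsto (fun ε : ℝ => p + ε • m) (𝓝[>] 0) (𝓝 p) := tendsto_add_smul p m
  obtain ⟨ε, h2, h3⟩ := ((h1.eventually_mem (isOpen_interior.mem_nhds h)).and
    self_mem_nhdsWithin).exists
  exact ⟨ε, h3, interior_subset h2⟩

/-- A supporting linear form at a point that is not interior. -/
theorem exists_supporting_form (hD : Convex ℝ D) (hne : (interior D).Nonempty)
    (hp : p ∉ interior D) :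
    ∃ e : ℝ × ℝ, (∀ x ∈ D, dot e p ≤ dot e x) ∧ ∃ y ∈ D, dot e p < dot e y := by
  obtain ⟨l, hl⟩ := geometric_hahn_banach_open_point hD.interior isOpen_interior hp
  have hdot : ∀ x, l x = -dot (-l (1, 0), -l (0, 1)) x := by
    intro x
    have : x = x.1 • ((1, 0) : ℝ × ℝ) + x.2 • ((0, 1) : ℝ × ℝ) := by ext <;> simp
    conv_lhs => rw [this, map_add, map_smul, map_smul]
    simp [dot]
    ring
  refine ⟨(-l (1, 0), -l (0, 1)), fun x hx => ?_, ?_⟩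
  · have hcl : x ∈ closure (interior D) := by
      rw [hD.closure_interior_eq_closure_of_nonempty_interior hne]
      exact subset_closure hx
    have h1 : l x ≤ l p := closure_minimal (t := {x | l x ≤ l p}) (fun y hy => (hl y hy).le)
      (isClosed_le l.continuous continuous_const) hcl
    rw [hdot x, hdot p] at h1
    exact neg_le_neg_iff.1 h1
  · obtain ⟨y, hy⟩ := hne
    have h1 := hl y hy
    rw [hdot y, hdot p] at h1
    exact ⟨y, interior_subset hy, neg_lt_neg_iff.1 h1⟩

theorem dot_eq_of_mem_openSegment {e q r : ℝ × ℝ} (hp : p ∈ openSegment ℝ q r)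
    (hq : dot e p ≤ dot e q) (hr : dot e p ≤ dot e r) : dot e q = dot e p ∧ dot e r = dot e p := by
  obtain ⟨a, b, ha, hb, hab, h⟩ := hp
  have h1 : a * dot e q + b * dot e r = dot e p := by rw [← h, dot_add, dot_smul, dot_smul]
  have h2 : dot e p = a * dot e p + b * dot e p := by rw [← add_mul, hab, one_mul]
  have h3 := mul_le_mul_of_nonneg_left hq ha.le
  have h4 := mul_le_mul_of_nonneg_left hr hb.le
  exact ⟨mul_left_cancel₀ ha.ne' (by linarith), mul_left_cancel₀ hb.ne' (by linarith)⟩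

/-- In the relative interior of an edge the feasible directions form a half plane. -/
theorem mem_feasibleDirections_iff (hD : Convex ℝ D) {e : ℝ × ℝ}
    (he : ∀ x ∈ D, dot e p ≤ dot e x) {y : ℝ × ℝ} (hy : y ∈ D) (hey : dot e p < dot e y)
    {q r : ℝ × ℝ} (hq : q ∈ D) (hr : r ∈ D) (hqr : q ≠ r) (hp : p ∈ openSegment ℝ q r)
    (m : ℝ × ℝ) : m ∈ feasibleDirections D p ↔ 0 ≤ dot e m := by
  have hpD : p ∈ D := hD.openSegment_subset hq hr hp
  obtain ⟨hq', hr'⟩ := dot_eq_of_mem_openSegment hp (he q hq) (he r hr)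
  obtain ⟨a, b, ha, hb, hab, rfl⟩ := hp
  set p := a • q + b • r with hpdef
  constructor
  · rintro ⟨ε, hε, h⟩
    have h1 := he _ h
    rw [dot_add e p, dot_smul] at h1
    exact nonneg_of_mul_nonneg_right (by linarith) hε
  · intro hm
    have hu : r - q ∈ feasibleDirections D p := by
      have := smul_mem_feasibleDirections hpD (sub_mem_feasibleDirections (p := p) hr)
        (inv_nonneg.2 ha.le)
      convert this using 1
      rw [hpdef, eq_inv_smul_iff₀ ha.ne', show b = 1 - a by linarith]
      module
    have hu' : -(r - q) ∈ feasibleDirections D p := by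
      have := smul_mem_feasibleDirections hpD (sub_mem_feasibleDirections (p := p) hq)
        (inv_nonneg.2 hb.le)
      convert this using 1
      rw [hpdef, eq_inv_smul_iff₀ hb.ne', show a = 1 - b by linarith]
      module
    -- decompose `m` along the edge and an inward direction
    set α := dot e m / (dot e y - dot e p) with hα
    have hα0 : 0 ≤ α := div_nonneg hm (sub_pos.2 hey).le
    have hue : dot e (r - q) = 0 := by
      have := dot_add e (r - q) q
      rw [sub_add_cancel] at this
      linarith
    have hrest : dot e (m - α • (y - p)) = 0 := by
      have h4 := dot_add e (m - α • (y - p)) (α • (y - p))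
      have h5 := dot_add e (y - p) p
      rw [sub_add_cancel] at h4 h5
      rw [dot_smul] at h4
      have h6 : α * (dot e y - dot e p) = dot e m := div_mul_cancel₀ _ (sub_pos.2 hey).ne'
      have h7 : dot e (y - p) = dot e y - dot e p := by linarith
      rw [h7, h6] at h4
      linarith
    have he0 : e ≠ 0 := by
      rintro rfl
      simp [dot] at hey
    obtain ⟨t, ht⟩ : ∃ t : ℝ, m - α • (y - p) = t • (r - q) := by
      have hw : r - q ≠ 0 := sub_ne_zero.2 hqr.symm
      have hN := normSq_pos hw
      set z := m - α • (y - p)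
      set w := r - q
      have hpar : z.1 * w.2 = z.2 * w.1 := by
        have hNe := normSq_pos he0
        simp only [dot, normSq] at hue hrest hNe
        refine mul_right_cancel₀ hNe.ne' ?_
        linear_combination (e.1 * w.2 - e.2 * w.1) * hrest - (e.1 * z.2 - e.2 * z.1) * hue
      refine ⟨(z.1 * w.1 + z.2 * w.2) / normSq w, ?_⟩
      simp only [normSq] at hN ⊢
      ext
      · rw [Prod.smul_fst, smul_eq_mul, div_mul_eq_mul_div, eq_div_iff hN.ne']
        linear_combination w.2 * hpar
      · rw [Prod.smul_snd, smul_eq_mul, div_mul_eq_mul_div, eq_div_iff hN.ne']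
        linear_combination -w.1 * hpar
    have hm' : m = α • (y - p) + t • (r - q) := by rw [← ht]; abel
    rw [hm']
    refine add_mem_feasibleDirections hD hpD
      (smul_mem_feasibleDirections hpD (sub_mem_feasibleDirections hy) hα0) ?_
    rcases le_total 0 t with h0 | h0
    · exact smul_mem_feasibleDirections hpD hu h0
    · have := smul_mem_feasibleDirections hpD hu' (neg_nonneg.2 h0)
      rwa [smul_neg, neg_smul, neg_neg] at this

end

/-- An edge of a lattice polygon contains two lattice points. -/
theorem exists_ne_of_face {A : Set (ℤ × ℤ)} {e : ℝ × ℝ} {c : ℝ} (hA : ∀ a ∈ A, c ≤ pairing e a)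
    {q r : ℝ × ℝ} (hq : q ∈ convexHull ℝ (latticeToReal '' A))
    (hr : r ∈ convexHull ℝ (latticeToReal '' A)) (hqr : q ≠ r) (hqc : dot e q = c)
    (hrc : dot e r = c) : ∃ a b : ℤ × ℤ, a ≠ b ∧ pairing e a = pairing e b := by
  by_contra! hinj
  have key : ∀ z : ℝ × ℝ, dot e z = c → (∀ a ∈ A, pairing e a = c → latticeToReal a = z) →
      convexHull ℝ (latticeToReal '' A) ⊆ {x | c < dot e x ∨ x = z} := by
    intro z hz hAz
    refine convexHull_min ?_ ?_
    · rintro _ ⟨a, ha, rfl⟩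
      rcases (hA a ha).lt_or_eq with h | h
      · exact Or.inl h
      · exact Or.inr (hAz a ha h.symm)
    · rw [convex_iff_forall_pos]
      intro x hx y hy α β hα hβ hαβ
      have hx' : c ≤ dot e x := hx.elim le_of_lt fun h => by rw [h, hz]
      have hy' : c ≤ dot e y := hy.elim le_of_lt fun h => by rw [h, hz]
      have hc : c = α * c + β * c := by rw [← add_mul, hαβ, one_mul]
      rcases hx with hx | rfl
      · left
        rw [dot_add, dot_smul, dot_smul]
        have h1 := mul_lt_mul_of_pos_left hx hα
        have h2 := mul_le_mul_of_nonneg_left hy' hβ.le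
        linarith
      rcases hy with hy | rfl
      · left
        rw [dot_add, dot_smul, dot_smul]
        have h1 := mul_le_mul_of_nonneg_left hx' hα.le
        have h2 := mul_lt_mul_of_pos_left hy hβ
        linarith
      · right
        rw [← add_smul, hαβ, one_smul]
  obtain ⟨z, hz⟩ : ∃ z : ℝ × ℝ, convexHull ℝ (latticeToReal '' A) ⊆ {x | c < dot e x ∨ x = z} := by
    by_cases h : ∃ a ∈ A, pairing e a = c
    · obtain ⟨a, ha, hac⟩ := h
      refine ⟨latticeToReal a, key _ hac fun b _ hbc => ?_⟩
      by_contra hne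
      exact hinj b a (fun h => hne (by rw [h])) (hbc.trans hac.symm)
    · push Not at h
      exact ⟨q, key q hqc fun a ha hac => absurd hac (h a ha)⟩
  have h1 := (hz hq).resolve_left (by rw [hqc]; exact lt_irrefl _)
  have h2 := (hz hr).resolve_left (by rw [hrc]; exact lt_irrefl _)
  exact hqr (h1.trans h2.symm)

namespace LatticePolygon

variable {Δ : LatticePolygon}

/-- The point of `Δ` below an element of positive degree of the cone monoid. -/
def basePoint (p : Δ.coneMonoid) : ℝ × ℝ := (p.1.2 : ℝ)⁻¹ • latticeToReal p.1.1

theorem smul_basePoint {p : Δ.coneMonoid} (hp : 0 < p.1.2) :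
    (p.1.2 : ℝ) • basePoint p = latticeToReal p.1.1 := by
  rw [basePoint, smul_inv_smul₀]
  exact_mod_cast hp.ne'

theorem basePoint_mem {p : Δ.coneMonoid} (hp : 0 < p.1.2) : basePoint p ∈ Δ.carrier := by
  have hp' : (p.1.2 : ℝ) ≠ 0 := by exact_mod_cast hp.ne'
  exact (Set.mem_smul_set_iff_inv_smul_mem₀ hp' _ _).1 p.2

/-- The character monoid of the chart of exponent `p` consists of the feasible lattice directions
at the point of `Δ` below `p`. -/
theorem exists_add_nsmul_mem_iff {p : Δ.coneMonoid} (hp : 0 < p.1.2) (m : ℤ × ℤ) :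
    (∃ k : ℕ, (m + k • p.1.1, k * p.1.2) ∈ Δ.coneMonoid) ↔
      latticeToReal m ∈ feasibleDirections Δ.carrier (basePoint p) := by
  have hd : (0 : ℝ) < p.1.2 := by exact_mod_cast hp
  have key : ∀ k : ℕ, 0 < k → ((m + k • p.1.1, k * p.1.2) ∈ Δ.coneMonoid ↔
      basePoint p + ((k : ℝ) * p.1.2)⁻¹ • latticeToReal m ∈ Δ.carrier) := by
    intro k hk
    have hk' : (0 : ℝ) < k := by exact_mod_cast hk
    have hkd : (k : ℝ) * p.1.2 ≠ 0 := (mul_pos hk' hd).ne'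
    change latticeToReal (m + k • p.1.1) ∈ ((k * p.1.2 : ℕ) : ℝ) • Δ.carrier ↔ _
    rw [Nat.cast_mul, Set.mem_smul_set_iff_inv_smul_mem₀ hkd, latticeToReal_add,
      latticeToReal_nsmul, ← smul_basePoint hp, smul_smul, smul_add, smul_smul,
      inv_mul_cancel₀ hkd, one_smul, add_comm]
  constructor
  · rintro ⟨k, hk⟩
    rcases Nat.eq_zero_or_pos k with rfl | h
    · have h0 : latticeToReal m = 0 := by
        have h1 : latticeToReal (m + 0 • p.1.1) ∈ ((0 * p.1.2 : ℕ) : ℝ) • Δ.carrier := hk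
        rw [zero_mul, Nat.cast_zero, zero_smul, add_zero, Set.zero_smul_set Δ.nonempty] at h1
        exact h1
      refine ⟨1, one_pos, ?_⟩
      rw [h0, smul_zero, add_zero]
      exact basePoint_mem hp
    · have hk' : (0 : ℝ) < k := by exact_mod_cast h
      exact ⟨_, inv_pos.2 (mul_pos hk' hd), (key k h).1 hk⟩
  · rintro ⟨ε, hε, h⟩
    obtain ⟨n, hn⟩ := exists_nat_gt (ε * p.1.2)⁻¹
    have hn0 : 0 < n := by
      have : (0 : ℝ) < n := (inv_pos.2 (mul_pos hε hd)).trans hn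
      exact_mod_cast this
    have hn' : (0 : ℝ) < n := by exact_mod_cast hn0
    refine ⟨n, (key n hn0).2 (add_smul_mem_of_le Δ.convex (basePoint_mem hp) h ?_ ?_)⟩
    · positivity
    · rw [inv_le_comm₀ (mul_pos hn' hd) hε]
      rw [mul_inv, ← div_eq_mul_inv, div_lt_iff₀ hd] at hn
      exact hn.le

/-- The chart of a point of `Δ` that is not a vertex is smooth. -/
theorem smooth_awayStr_of_notMem_extremePoints {p : Δ.coneMonoid} (hp : 0 < p.1.2)
    (hext : basePoint p ∉ Δ.carrier.extremePoints ℝ) : (awayStr p).Smooth := by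
  -- below an interior point the character monoid is `ℤ²`, in an edge it is a half plane in `ℤ²`
  by_cases hint : basePoint p ∈ interior Δ.carrier
  · refine smooth_awayStr (N := ℤ × ℤ) (φ := AddMonoidHom.id _)
      (RingHom.Smooth.single_zero_prod _ (RingHom.Smooth.single_zero_int _))
      Function.injective_id fun m => ?_
    rw [exists_add_nsmul_mem_iff hp]
    exact iff_of_true (mem_feasibleDirections_of_mem_interior hint _) ⟨m, rfl⟩
  obtain ⟨e, he, y, hy, hey⟩ := exists_supporting_form Δ.convex Δ.nonempty_interior hint
  obtain ⟨q, hq, r, hr, hpqr, hne⟩ : ∃ q ∈ Δ.carrier, ∃ r ∈ Δ.carrier,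
      basePoint p ∈ openSegment ℝ q r ∧ q ≠ basePoint p := by
    rw [mem_extremePoints_iff_left] at hext
    push Not at hext
    obtain ⟨q, hq, r, hr, h1, h2⟩ := hext (basePoint_mem hp)
    exact ⟨q, hq, r, hr, h1, h2⟩
  have hqr : q ≠ r := by
    rintro rfl
    rw [openSegment_same] at hpqr
    exact hne hpqr.symm
  have hfeas := mem_feasibleDirections_iff Δ.convex he hy hey hq hr hqr hpqr
  obtain ⟨hqe, hre⟩ := dot_eq_of_mem_openSegment hpqr (he q hq) (he r hr)
  obtain ⟨A, hA⟩ := Δ.exists_eq_convexHull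
  rw [hA] at hq hr
  obtain ⟨a, b, hab, habe⟩ := exists_ne_of_face (A := (A : Set (ℤ × ℤ))) (fun a ha => he _ (by
    rw [hA]
    exact subset_convexHull ℝ _ (Set.mem_image_of_mem _ ha))) hq hr hqr hqe hre
  have he0 : e ≠ 0 := by
    rintro rfl
    simp [dot] at hey
  obtain ⟨c, hc, t, ht, rfl⟩ := exists_primitive he0 (sub_ne_zero.2 hab) (by
    rw [pairing_sub, habe, sub_self])
  obtain ⟨φ, hφ, hφ'⟩ := exists_halfPlane_basis hc
  refine smooth_awayStr (N := ℤ × ℕ)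
    (RingHom.Smooth.single_zero_prod _ (RingHom.Smooth.single_zero_nat _)) hφ fun m => ?_
  rw [exists_add_nsmul_mem_iff hp, hfeas, ← hφ']
  have : dot (t • latticeToReal c) (latticeToReal m) =
      t * ((c.1 * m.1 + c.2 * m.2 : ℤ) : ℝ) := by
    simp only [dot, latticeToReal, Prod.smul_fst, Prod.smul_snd, smul_eq_mul]
    push_cast
    ring
  rw [this, mul_nonneg_iff_of_pos_left ht]
  exact_mod_cast Iff.rfl

end LatticePolygon

/-! ### The zero scheme avoids the torus-fixed points -/

namespace LatticePolygon

variable {Δ : LatticePolygon}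

theorem monomial_mul (p q : Δ.coneMonoid) :
    (monomial p * monomial q : Δ.CoordAlgebra) = monomial (p + q) := by
  rw [monomial, monomial, AddMonoidAlgebra.single_mul_single, mul_one, monomial]

theorem monomial_nsmul (k : ℕ) (p : Δ.coneMonoid) :
    (monomial (k • p) : Δ.CoordAlgebra) = monomial p ^ k := by
  rw [monomial, monomial, AddMonoidAlgebra.single_pow, one_pow]

theorem single_eq_mul_monomial (p : Δ.coneMonoid) (a : Puiseux) :
    (AddMonoidAlgebra.single p a : Δ.CoordAlgebra) =
      AddMonoidAlgebra.single 0 a * monomial p := by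
  rw [monomial, AddMonoidAlgebra.single_mul_single, zero_add, mul_one]

theorem mem_of_forall_monomial_mem {I : Ideal Δ.CoordAlgebra} {f : Δ.CoordAlgebra}
    (h : ∀ p ∈ f.coeff.support, monomial p ∈ I) : f ∈ I := by
  have : f = ∑ p ∈ f.coeff.support, AddMonoidAlgebra.single p (f.coeff p) := by
    refine AddMonoidAlgebra.coeff_inj.1 ?_
    conv_lhs => rw [← Finsupp.sum_single f.coeff]
    simp [Finsupp.sum]
  rw [this]
  refine I.sum_mem fun p hp => ?_
  rw [single_eq_mul_monomial]
  exact I.mul_mem_left _ (h p hp)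

/-- The irrelevant ideal is generated by the monomials of positive degree. -/
theorem exists_monomial_notMem (x : ProjectiveSpectrum Δ.grading) :
    ∃ p : Δ.coneMonoid, 0 < p.1.2 ∧ monomial p ∉ x.asHomogeneousIdeal.toIdeal := by
  by_contra! h
  refine x.not_irrelevant_le ((HomogeneousIdeal.irrelevant_le _).2 fun i hi f hf => ?_)
  refine mem_of_forall_monomial_mem fun p hp => h p ?_
  rw [degree_of_mem_support hf hp]
  exact hi

/-- If a section whose support contains all the vertices of `Δ` vanishes at a point, then some
monomial whose exponent is not a vertex does not vanish there: the zero scheme avoids the torus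
fixed points. -/
theorem exists_monomial_notMem_of_mem {s : Δ.Sections}
    (hs : newtonPolygon (Δ.dehom s.1) = Δ.carrier) {x : ProjectiveSpectrum Δ.grading}
    (hx : s.1 ∈ x.asHomogeneousIdeal.toIdeal) :
    ∃ p : Δ.coneMonoid, 0 < p.1.2 ∧ monomial p ∉ x.asHomogeneousIdeal.toIdeal ∧
      basePoint p ∉ Δ.carrier.extremePoints ℝ := by
  by_contra! hall
  obtain ⟨p, hp, hpx⟩ := exists_monomial_notMem x
  have hext := hall p hp hpx
  -- the vertex below `p` is an exponent of `s`
  obtain ⟨v, hv, hvp⟩ : basePoint p ∈ latticeToReal '' ((Δ.dehom s.1).coeff.support : Set _) := by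
    rw [← hs] at hext
    exact extremePoints_convexHull_subset hext
  obtain ⟨P, hP, hPv⟩ : ∃ P ∈ s.1.coeff.support, P.1.1 = v := by
    classical
    obtain ⟨P, hP, h⟩ := Finset.mem_image.1 (Finsupp.mapDomain_support hv)
    exact ⟨P, hP, h⟩
  have hP1 : ∀ Q ∈ s.1.coeff.support, Q.1.2 = 1 := fun Q hQ => degree_of_mem_support s.2 hQ
  have hpP : p = p.1.2 • P := by
    refine Subtype.ext (Prod.ext (latticeToReal_injective ?_) ?_)
    · change _ = latticeToReal (p.1.2 • P.1.1)
      rw [latticeToReal_nsmul, hPv, hvp, smul_basePoint hp]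
    · change _ = p.1.2 • P.1.2
      rw [hP1 P hP, smul_eq_mul, mul_one]
  have hPx : monomial P ∉ x.asHomogeneousIdeal.toIdeal := by
    intro h
    rw [hpP, monomial_nsmul] at hpx
    exact hpx (Ideal.pow_mem_of_mem _ h _ hp)
  -- the other monomials of `s` vanish at `x`, as the midpoint of two exponents is not a vertex
  have hother : ∀ Q ∈ s.1.coeff.support, Q ≠ P → monomial Q ∈ x.asHomogeneousIdeal.toIdeal := by
    intro Q hQ hQP
    by_contra hQx
    have h1 : monomial (P + Q) ∉ x.asHomogeneousIdeal.toIdeal := by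
      rw [← monomial_mul]
      exact fun h => (x.isPrime.mem_or_mem h).elim hPx hQx
    have hdeg : (P + Q).1.2 = 2 := by
      change P.1.2 + Q.1.2 = 2
      rw [hP1 P hP, hP1 Q hQ]
    have h2 := hall (P + Q) (by rw [hdeg]; exact two_pos) h1
    have hmem : ∀ R ∈ s.1.coeff.support, latticeToReal R.1.1 ∈ Δ.carrier := by
      intro R hR
      have h := R.2
      change latticeToReal R.1.1 ∈ (R.1.2 : ℝ) • Δ.carrier at h
      rwa [hP1 R hR, Nat.cast_one, one_smul] at h
    have hmid : basePoint (P + Q) ∈ openSegment ℝ (latticeToReal P.1.1) (latticeToReal Q.1.1) := by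
      refine ⟨1 / 2, 1 / 2, by norm_num, by norm_num, by norm_num, ?_⟩
      rw [basePoint, hdeg]
      change _ = _ • latticeToReal (P.1.1 + Q.1.1)
      rw [latticeToReal_add, smul_add]
      norm_num
    have h3 := (mem_extremePoints.1 h2).2 _ (hmem P hP) _ (hmem Q hQ) hmid
    refine hQP (Subtype.ext (Prod.ext (latticeToReal_injective (h3.2.trans h3.1.symm)) ?_))
    rw [hP1 P hP, hP1 Q hQ]
  refine hPx ?_
  -- so the remaining term of `s` vanishes at `x` as well, although its coefficient is a unit
  have hunit : AddMonoidAlgebra.single P (s.1.coeff P) ∈ x.asHomogeneousIdeal.toIdeal := by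
    have h1 : s.1 - AddMonoidAlgebra.single P (s.1.coeff P) ∈ x.asHomogeneousIdeal.toIdeal := by
      refine mem_of_forall_monomial_mem fun Q hQ => ?_
      rw [Finsupp.mem_support_iff, AddMonoidAlgebra.coeff_sub, AddMonoidAlgebra.coeff_single,
        Finsupp.sub_apply] at hQ
      have hQP : Q ≠ P := by
        rintro rfl
        rw [Finsupp.single_eq_same, sub_self] at hQ
        exact hQ rfl
      rw [Finsupp.single_eq_of_ne hQP, sub_zero] at hQ
      exact hother Q (Finsupp.mem_support_iff.2 hQ) hQP
    simpa using Ideal.sub_mem _ hx h1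
  have h2 := Ideal.mul_mem_left _ (AddMonoidAlgebra.single 0 (s.1.coeff P)⁻¹) hunit
  rwa [AddMonoidAlgebra.single_mul_single, zero_add,
    inv_mul_cancel₀ (Finsupp.mem_support_iff.1 hP)] at h2

theorem range_subschemeι_subset_smoothLocus {s : Δ.Sections}
    (hs : newtonPolygon (Δ.dehom s.1) = Δ.carrier) (hp : Prime (Δ.dehom s.1)) :
    Set.range (Δ.idealSheaf s).subschemeι ⊆ Δ.smoothLocus := by
  intro x hx
  obtain ⟨p, hp0, hpx, hext⟩ :=
    exists_monomial_notMem_of_mem hs (mem_of_mem_range_subschemeι hs hp hx)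
  exact mem_smoothLocus hp0 (smooth_awayStr_of_notMem_extremePoints hp0 hext) hpx

end LatticePolygon

end

theorem mainTheorem12 (Δ : LatticePolygon) (n g δ : ℕ)
    (hn : Δ.latticePoints.ncard = n + 1) (hg : Δ.interiorLatticePoints.ncard = g) (hδ : δ ≤ g)
    (S : Fin (n - δ) → TorusPoint)
    (hS : InGeneralPosition Δ (g - δ) fun i => (S i).trop)
    (Γ : WeightedSet) (hdeg : IsTropicalCurveOfDegree Δ Γ) (hgenus : HasGenus Γ (g - δ))
    (hthrough : ∀ i, (S i).trop ∈ Γ.support) :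
    ∀ C ∈ (LatticePolygon.linearSeriesWithTrop S Γ : Set Δ.LinearSeries),
      IsIntegral (LatticePolygon.curveIdeal C).subscheme ∧
        Set.range (LatticePolygon.curveIdeal C).subschemeι ⊆ Δ.smoothLocus := by
  rintro C ⟨-, rfl⟩
  have hne : Δ.dehom C.rep.1 ≠ 0 := fun h => C.rep_nonzero (Subtype.ext
    (LatticePolygon.dehom_injOn 1 C.rep.2 (Submodule.zero_mem _) (h.trans (map_zero _).symm)))
  have hsub : ∀ u ∈ (Δ.dehom C.rep.1).coeff.support, latticeToReal u ∈ Δ.carrier := by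
    intro u hu
    simpa using LatticePolygon.mem_smul_of_mem_support_dehom C.rep.2 hu
  obtain ⟨hs, hirr⟩ :=
    newtonPolygon_eq_and_irreducible hn hg hδ hS hne hsub hdeg hgenus hthrough
  have hp := prime_of_newtonPolygon hs hirr
  exact ⟨LatticePolygon.isIntegral_subscheme hs hp,
    LatticePolygon.range_subschemeι_subset_smoothLocus hs hp⟩
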